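/- Let $(Z,\varpi)$ be a smooth finite-dimensional Poisson manifold with bundle map $\varpi^\sharp:T^*Z\to TZ$, let $i_S:S\to Z$ be a symplectic leaf with symplectic form $\omega_S$ (so $\varpi^\sharp=Ti_S\circ(\omega_S^\flat)^{-1}\circ(Ti_S)^*$ on $S$), and let $X\subset S$ be a Lagrangian submanifold. Put $E_X=(TX)^0\subset T^*Z|_X$, $E_X^*=TZ|_X/TX$, $L_X=(TS)^0|_X\subset E_X$, let $(\underline{TX})^0\subset T^*S|_X$ be the annihilator of $TX$ in $TS|_X$, and $\omega_X^\flat=\omega_S^\flat|_{TX}:TX\to(\underline{TX})^0$. A field of scalar products (on $TX$: a metric) is a smooth field of nondegenerate symmetric bilinear forms. An $E_X$-connection form is a smooth bundle map $\alpha^\flat:TX\to E_X$ with $-\varpi^\sharp\circ\alpha^\flat=\mathrm{Id}_{TX}$. For a Lie algebra $\mathfrak g$, $R_X$ is the Lie frame bundle, with fibres the Lie algebra isomorphisms $\mathfrak g\to(L_X)_x$, where $L_X$ carries the fibrewise bracket $[df_z,dg_z]=d\{f,g\}_z$ ($\mathfrak g$ being the transverse Lie algebra of the leaf, $L_X=\mathfrak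 g(R_X)$). Let $H\in C^\infty(Z)$ with $dH|_X=0$. (1) The vertical part of $T(dH)|_{TZ|_X}:TZ|_X\to T(T^*Z)|_{\text{zero section}}=TZ|_X\oplus T^*Z|_X$ is induced by a unique field $j^VH$ of bilinear forms on the fibres of $E_X^*=TZ|_X/TX$, and $j^VH$ is a smooth section of $S^2(E_X)$ (the vertical Hessian). Write $j^VH^\sharp:E_X^*\to E_X$ and $j^VH_0^\sharp=(Ti_S)^*\circ j^VH^\sharp\circ Ti_S:TS|_X/TX\to(\underline{TX})^0$. (2) If $j^VH^\sharp$ is invertible, then $\eta^\flat=(j^VH^\sharp)^{-1}$ is given by a unique field $\eta$ of bilinear forms on $E_X$, which is a field of scalar products. At each point, $j^VH_0^\sharp$ is invertible if and only if $\eta|_{L_X}$ is nondegenerate; this is automatic where $\eta$ is (positive or negative) definite. (3) If moreover $j^VH_0^\sharp$ is invertible at every point of $X$, then $$\gamma_H^\flat=(-\omega_X^\flat)^*\circ (j^VH_0^{\sharp})^{-1}\circ(-\omega_X^\flat),\qquad \alpha_H^\flat=j^VH^\sharp\circ Ti_S\circ (j^VH_0^{\sharp})^{-1}\circ(-\omega_X^\flat),\qquad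 \chi_H=\eta|_{L_X}$$ define a metric $\gamma_H$ on $X$, an $E_X$-connection form $\alpha_H$ and a field $\chi_H$ of scalar products on $L_X$. (4) The same formulas, with $j^\sharp=(\eta^\flat)^{-1}$ in place of $j^VH^\sharp$, define a bijection between the fields $\eta$ of scalar products on $E_X$ whose restriction to $L_X$ is nondegenerate, and the triples $(\gamma,\alpha,\chi)$ of a metric on $X$, an $E_X$-connection form and a field of scalar products on $L_X$. At each point, $\eta$ is positive definite if and only if both $\gamma$ and $\chi$ are. (5) Every $E_X$-connection form $\alpha$ (in particular $\alpha_H$) determines a unique principal connection form $A$ on $R_X$, the one of the covariant derivative $\nabla_V s=\{\alpha(V),s\}$ on $L_X$, where the bracket is induced by the bracket $\{a,b\}=i_{\varpi^\sharp b}da-i_{\varpi^\sharp a}db+d(\varpi(a,b))$ of one-forms on $Z$: for every smooth local section $\sigma$ of $R_X$, $\sigma\big((\sigma^*A)(V)\,c\big)=\{\alpha(V),\sigma(c)\}$ for all $c\in\mathfrak g$. -/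

import Mathlib

open scoped Manifold ContDiff Topology
open Bundle Set

noncomputable section

universe u

/-! ## Covectors, one-forms and Poisson structures -/

section Poisson

variable {E : Type*} [NormedAddCommGroup E] [NormedSpace ℝ E]
  {Z : Type*} [TopologicalSpace Z] [ChartedSpace E Z]

/-- The cotangent space of a manifold modelled on `E`. -/
abbrev Cotan (E : Type*) [NormedAddCommGroup E] [NormedSpace ℝ E]
    {Z : Type*} [TopologicalSpace Z] [ChartedSpace E Z] (z : Z) : Type _ :=
  TangentSpace 𝓘(ℝ, E) z →L[ℝ] ℝ

/-- The differential of a real function, as a covector. -/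
def dFun (E : Type*) [NormedAddCommGroup E] [NormedSpace ℝ E]
    {Z : Type*} [TopologicalSpace Z] [ChartedSpace E Z] (f : Z → ℝ) (z : Z) : Cotan E z :=
  mfderiv 𝓘(ℝ, E) 𝓘(ℝ, ℝ) f z

/-- A linear form on a (finite-dimensional) tangent space, as a covector. -/
def toCotan [FiniteDimensional ℝ E] {z : Z} (l : TangentSpace 𝓘(ℝ, E) z →ₗ[ℝ] ℝ) : Cotan E z :=
  let l' : E →ₗ[ℝ] ℝ := l
  let m : E →L[ℝ] ℝ := LinearMap.toContinuousLinearMap l'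
  m

/-- A point of the total space of the cotangent bundle. -/
def cotPoint [IsManifold 𝓘(ℝ, E) ∞ Z] (z : Z) (ξ : Cotan E z) :
    TotalSpace (E →L[ℝ] ℝ) (fun z : Z => Cotan E z) :=
  ⟨z, ξ⟩

/-- Smoothness of a one-form: it is smooth as a section of the cotangent bundle. -/
def SmoothForm [IsManifold 𝓘(ℝ, E) ∞ Z] (a : ∀ z : Z, Cotan E z) : Prop :=
  ContMDiff 𝓘(ℝ, E) (𝓘(ℝ, E).prod 𝓘(ℝ, E →L[ℝ] ℝ)) ∞ (fun z => cotPoint z (a z))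

/-- A Poisson structure on a manifold `Z`, given by a smooth bivector field `w`, here through its
bundle morphism `w♯ : T*Z → TZ`, so that `w(ξ, ζ) = ξ (w♯ ζ)`. Smoothness says that the bracket
`{f, g} = w(df, dg)` of smooth functions is smooth, and the last field is the Jacobi identity. -/
structure PoissonStructure (E : Type*) [NormedAddCommGroup E] [NormedSpace ℝ E]
    (Z : Type*) [TopologicalSpace Z] [ChartedSpace E Z] where
  sharp : ∀ z : Z, Cotan E z →L[ℝ] TangentSpace 𝓘(ℝ, E) z
  skew : ∀ (z : Z) (ξ ζ : Cotan E z), ξ (sharp z ζ) = -ζ (sharp z ξ)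
  smooth : ∀ f g : Z → ℝ, ContMDiff 𝓘(ℝ, E) 𝓘(ℝ, ℝ) ∞ f → ContMDiff 𝓘(ℝ, E) 𝓘(ℝ, ℝ) ∞ g →
    ContMDiff 𝓘(ℝ, E) 𝓘(ℝ, ℝ) ∞ (fun z => dFun E f z (sharp z (dFun E g z)))
  jacobi : ∀ f g h : Z → ℝ, ContMDiff 𝓘(ℝ, E) 𝓘(ℝ, ℝ) ∞ f → ContMDiff 𝓘(ℝ, E) 𝓘(ℝ, ℝ) ∞ g →
    ContMDiff 𝓘(ℝ, E) 𝓘(ℝ, ℝ) ∞ h → ∀ z : Z,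
      dFun E f z (sharp z (dFun E (fun y => dFun E g y (sharp y (dFun E h y))) z)) +
      dFun E g z (sharp z (dFun E (fun y => dFun E h y (sharp y (dFun E f y))) z)) +
      dFun E h z (sharp z (dFun E (fun y => dFun E f y (sharp y (dFun E g y))) z)) = 0

/-- The Poisson bracket `{f, g} = w(df, dg)`. -/
def PoissonStructure.bracket (P : PoissonStructure E Z) (f g : Z → ℝ) (z : Z) : ℝ :=
  dFun E f z (P.sharp z (dFun E g z))

/-- The one-form `a` read in the chart at `z`: its pull-back by the inverse of the chart. -/
def formInChart (a : ∀ z : Z, Cotan E z) (z : Z) (e : E) : E →L[ℝ] ℝ :=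
  (a ((extChartAt 𝓘(ℝ, E) z).symm e)).comp
    (mfderiv 𝓘(ℝ, E) 𝓘(ℝ, E) (extChartAt 𝓘(ℝ, E) z).symm e)

/-- The exterior derivative of a one-form at `z`, `da(u, v) = (D a · u)(v) - (D a · v)(u)` in the
chart at `z`. -/
def extD (a : ∀ z : Z, Cotan E z) (z : Z) : TangentSpace 𝓘(ℝ, E) z →L[ℝ] Cotan E z :=
  let D : E →L[ℝ] E →L[ℝ] ℝ := fderiv ℝ (formInChart a z) (extChartAt 𝓘(ℝ, E) z z)
  let T : E →L[ℝ] E := mfderiv 𝓘(ℝ, E) 𝓘(ℝ, E) (extChartAt 𝓘(ℝ, E) z) z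
  let dA : E →L[ℝ] E →L[ℝ] ℝ := (D - D.flip).bilinearComp T T
  dA

/-- The bracket of one-forms of a Poisson manifold,
`{a, b} = i_{w♯b} da - i_{w♯a} db + d (w(a, b))`. -/
def PoissonStructure.formBracket (P : PoissonStructure E Z) (a b : ∀ z : Z, Cotan E z) (z : Z) :
    Cotan E z :=
  extD a z (P.sharp z (b z)) - extD b z (P.sharp z (a z)) +
    dFun E (fun y => a y (P.sharp y (b y))) z

/-- A smooth function with prescribed differential at `z`. -/
def funWith (z : Z) (ξ : Cotan E z) : Z → ℝ :=
  Classical.epsilon fun f => ContMDiff 𝓘(ℝ, E) 𝓘(ℝ, ℝ) ∞ f ∧ dFun E f z = ξ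

/-- The Lie bracket `[ξ, ζ] = d{f, g}_z`, `df_z = ξ`, `dg_z = ζ`, of covectors at `z` which
annihilate the symplectic leaf through `z`. -/
def PoissonStructure.isotropyBracket (P : PoissonStructure E Z) (z : Z) (ξ ζ : Cotan E z) :
    Cotan E z :=
  dFun E (P.bracket (funWith z ξ) (funWith z ζ)) z

end Poisson

/-! ## Symplectic leaves -/

section Leaf

variable {E : Type*} [NormedAddCommGroup E] [NormedSpace ℝ E]
  {F : Type*} [NormedAddCommGroup F] [NormedSpace ℝ F]
  {Z : Type*} [TopologicalSpace Z] [ChartedSpace E Z]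
  {S : Type*} [TopologicalSpace S] [ChartedSpace F S]

/-- `ι : S → Z` is an injectively immersed integral manifold of the distribution `w♯(T*Z)`. -/
structure IsIntegralManifold (P : PoissonStructure E Z) (ι : S → Z) : Prop where
  smooth : ContMDiff 𝓘(ℝ, F) 𝓘(ℝ, E) ∞ ι
  injective : Function.Injective ι
  immersion : ∀ s, Function.Injective (mfderiv 𝓘(ℝ, F) 𝓘(ℝ, E) ι s)
  range_eq : ∀ s, LinearMap.range (mfderiv 𝓘(ℝ, F) 𝓘(ℝ, E) ι s).toLinearMap =
    LinearMap.range (P.sharp (ι s)).toLinearMap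

end Leaf

section Leaf2

variable {E : Type*} [NormedAddCommGroup E] [NormedSpace ℝ E]
  {F : Type*} [NormedAddCommGroup F] [NormedSpace ℝ F]
  {Z : Type u} [TopologicalSpace Z] [ChartedSpace E Z]
  {S : Type*} [TopologicalSpace S] [ChartedSpace F S]

/-- A symplectic leaf: a maximal connected integral manifold of `w♯(T*Z)`. -/
structure IsSymplecticLeaf (P : PoissonStructure E Z) (ι : S → Z) : Prop
    extends IsIntegralManifold (F := F) P ι where
  connected : ConnectedSpace S
  maximal : ∀ (T : Type u) [TopologicalSpace T] [ChartedSpace F T] [IsManifold 𝓘(ℝ, F) ∞ T]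
    [ConnectedSpace T] (κ : T → Z), IsIntegralManifold (F := F) P κ →
      (range κ ∩ range ι).Nonempty → range κ ⊆ range ι

/-- The symplectic form of a leaf as a map `ω♭ : TS → T*S`: if `w♯ ξ = Tι u`, then
`ω♭ u = ξ ∘ Tι`. -/
def leafFlat (P : PoissonStructure E Z) (ι : S → Z) (s : S) (u : TangentSpace 𝓘(ℝ, F) s) :
    Cotan F s :=
  (Classical.epsilon fun ξ : Cotan E (ι s) =>
    P.sharp (ι s) ξ = mfderiv 𝓘(ℝ, F) 𝓘(ℝ, E) ι s u).comp (mfderiv 𝓘(ℝ, F) 𝓘(ℝ, E) ι s)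

/-- A Lagrangian submanifold `X` of a symplectic leaf `S` of a Poisson manifold `Z`: an immersed
submanifold whose tangent spaces equal their own orthogonals for the symplectic form of `S`. -/
structure LagrangianInLeaf (E F G : Type*)
    [NormedAddCommGroup E] [NormedSpace ℝ E] [NormedAddCommGroup F] [NormedSpace ℝ F]
    [NormedAddCommGroup G] [NormedSpace ℝ G]
    (Z : Type u) [TopologicalSpace Z] [ChartedSpace E Z]
    (S : Type*) [TopologicalSpace S] [ChartedSpace F S]
    (X : Type*) [TopologicalSpace X] [ChartedSpace G X] where
  P : PoissonStructure E Z
  iS : S → Z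
  leaf : IsSymplecticLeaf (F := F) P iS
  iX : X → S
  smooth : ContMDiff 𝓘(ℝ, G) 𝓘(ℝ, F) ∞ iX
  injective : Function.Injective iX
  immersion : ∀ x, Function.Injective (mfderiv 𝓘(ℝ, G) 𝓘(ℝ, F) iX x)
  lagrangian : ∀ (x : X) (y : TangentSpace 𝓘(ℝ, F) (iX x)),
    y ∈ LinearMap.range (mfderiv 𝓘(ℝ, G) 𝓘(ℝ, F) iX x).toLinearMap ↔
      ∀ v : TangentSpace 𝓘(ℝ, G) x,
        leafFlat P iS (iX x) y (mfderiv 𝓘(ℝ, G) 𝓘(ℝ, F) iX x v) = 0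

end Leaf2

/-! ## Symmetric forms on families of vector spaces -/

/-- A smooth field of scalar products, i.e. of nondegenerate symmetric bilinear forms, on a family
`V` of vector spaces over `X` whose smooth sections are the elements of `Γ`. -/
structure IsScalarProductField {G : Type*} [NormedAddCommGroup G] [NormedSpace ℝ G]
    {X : Type*} [TopologicalSpace X] [ChartedSpace G X]
    {V : X → Type*} [∀ x, AddCommGroup (V x)] [∀ x, Module ℝ (V x)]
    (Γ : Set (∀ x, V x)) (b : ∀ x, LinearMap.BilinForm ℝ (V x)) : Prop where
  symm : ∀ x v v', b x v v' = b x v' v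
  nondegenerate : ∀ x v, (∀ v', b x v v' = 0) → v = 0
  smooth : ∀ s ∈ Γ, ∀ t ∈ Γ, ContMDiff 𝓘(ℝ, G) 𝓘(ℝ, ℝ) ∞ (fun x => b x (s x) (t x))

namespace LagrangianInLeaf

variable {E F G : Type*}
  [NormedAddCommGroup E] [NormedSpace ℝ E]
  [NormedAddCommGroup F] [NormedSpace ℝ F]
  [NormedAddCommGroup G] [NormedSpace ℝ G]
  {Z : Type u} [TopologicalSpace Z] [ChartedSpace E Z]
  {S : Type*} [TopologicalSpace S] [ChartedSpace F S]
  {X : Type*} [TopologicalSpace X] [ChartedSpace G X]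

/-- The inclusion of `X` into `Z`. -/
def pt (D : LagrangianInLeaf E F G Z S X) (x : X) : Z := D.iS (D.iX x)

/-- `Ti_S : TS|_X → TZ|_X`. -/
def TS (D : LagrangianInLeaf E F G Z S X) (x : X) :
    TangentSpace 𝓘(ℝ, F) (D.iX x) →L[ℝ] TangentSpace 𝓘(ℝ, E) (D.pt x) :=
  mfderiv 𝓘(ℝ, F) 𝓘(ℝ, E) D.iS (D.iX x)

/-- `Ti_X : TX → TS|_X`. -/
def TX (D : LagrangianInLeaf E F G Z S X) (x : X) :
    TangentSpace 𝓘(ℝ, G) x →L[ℝ] TangentSpace 𝓘(ℝ, F) (D.iX x) :=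
  mfderiv 𝓘(ℝ, G) 𝓘(ℝ, F) D.iX x

/-- `TX → TZ|_X`. -/
def TXZ (D : LagrangianInLeaf E F G Z S X) (x : X) :
    TangentSpace 𝓘(ℝ, G) x →L[ℝ] TangentSpace 𝓘(ℝ, E) (D.pt x) :=
  (D.TS x).comp (D.TX x)

/-- `ω♭_X : TX → T*S|_X`, with values in the annihilator of `TX`. -/
def flatX (D : LagrangianInLeaf E F G Z S X) (x : X) (u : TangentSpace 𝓘(ℝ, G) x) :
    Cotan F (D.iX x) :=
  leafFlat D.P D.iS (D.iX x) (D.TX x u)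

/-- The Lie algebroid `E_X = (TX)⁰ ⊆ T*Z|_X`. -/
def EX (D : LagrangianInLeaf E F G Z S X) (x : X) : Submodule ℝ (Cotan E (D.pt x)) where
  carrier := {ξ | ∀ u, ξ (D.TXZ x u) = 0}
  add_mem' := fun {a b} ha hb u => by
    change a _ + b _ = 0
    rw [ha u, hb u, add_zero]
  zero_mem' := fun _ => rfl
  smul_mem' := fun c a ha u => by
    change c • a _ = 0
    rw [ha u, smul_zero]

/-- The Lie algebra bundle `L_X = (TS)⁰|_X ⊆ T*Z|_X`. -/
def LX (D : LagrangianInLeaf E F G Z S X) (x : X) : Submodule ℝ (Cotan E (D.pt x)) where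
  carrier := {ξ | ∀ y, ξ (D.TS x y) = 0}
  add_mem' := fun {a b} ha hb u => by
    change a _ + b _ = 0
    rw [ha u, hb u, add_zero]
  zero_mem' := fun _ => rfl
  smul_mem' := fun c a ha u => by
    change c • a _ = 0
    rw [ha u, smul_zero]

theorem LX_le_EX (D : LagrangianInLeaf E F G Z S X) (x : X) : D.LX x ≤ D.EX x :=
  fun _ h u => h (D.TX x u)

/-- The inclusion `L_X → E_X`. -/
def LtoE (D : LagrangianInLeaf E F G Z S X) (x : X) : D.LX x →ₗ[ℝ] D.EX x :=
  Submodule.inclusion (D.LX_le_EX x)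

/-- The annihilator of `TX` in `T*S|_X`. -/
def annS (D : LagrangianInLeaf E F G Z S X) (x : X) : Submodule ℝ (Cotan F (D.iX x)) where
  carrier := {ξ | ∀ u, ξ (D.TX x u) = 0}
  add_mem' := fun {a b} ha hb u => by
    change a _ + b _ = 0
    rw [ha u, hb u, add_zero]
  zero_mem' := fun _ => rfl
  smul_mem' := fun c a ha u => by
    change c • a _ = 0
    rw [ha u, smul_zero]

/-- `(Ti_S)* : E_X → (TX)⁰ ⊆ T*S|_X`. -/
def restrS (D : LagrangianInLeaf E F G Z S X) (x : X) : D.EX x →ₗ[ℝ] D.annS x where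
  toFun ξ := ⟨(ξ : Cotan E (D.pt x)).comp (D.TS x), fun u => ξ.2 u⟩
  map_add' _ _ := rfl
  map_smul' _ _ := rfl

/-- The dual bundle `E_X* = TZ|_X / TX`. -/
abbrev EStar (D : LagrangianInLeaf E F G Z S X) (x : X) : Type _ :=
  TangentSpace 𝓘(ℝ, E) (D.pt x) ⧸ LinearMap.range (D.TXZ x).toLinearMap

/-- The quotient `TS|_X / TX`. -/
abbrev QS (D : LagrangianInLeaf E F G Z S X) (x : X) : Type _ :=
  TangentSpace 𝓘(ℝ, F) (D.iX x) ⧸ LinearMap.range (D.TX x).toLinearMap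

/-- The class in `E_X*` of a tangent vector of `Z`. -/
def toEStar (D : LagrangianInLeaf E F G Z S X) (x : X) :
    TangentSpace 𝓘(ℝ, E) (D.pt x) →ₗ[ℝ] D.EStar x :=
  Submodule.mkQ _

/-- The map `TS|_X / TX → TZ|_X / TX` induced by `Ti_S`. -/
def QStoEStar (D : LagrangianInLeaf E F G Z S X) (x : X) : D.QS x →ₗ[ℝ] D.EStar x :=
  Submodule.mapQ _ _ (D.TS x).toLinearMap (by
    rintro _ ⟨u, rfl⟩
    exact ⟨u, rfl⟩)

/-- The duality pairing `⟨ξ, [v]⟩ = ξ(v)` of `E_X` and `E_X*`. -/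
def pairing (D : LagrangianInLeaf E F G Z S X) (x : X) (ξ : D.EX x) : D.EStar x →ₗ[ℝ] ℝ :=
  Submodule.liftQ _ (ξ : Cotan E (D.pt x)).toLinearMap (by
    rintro _ ⟨u, rfl⟩
    exact ξ.2 u)

variable [FiniteDimensional ℝ E]

/-- The bundle morphism `j♯ : E_X* → E_X`, `(j♯ q)(v) = j(q, [v])`, of a field `j` of bilinear
forms on the fibres of `E_X*`. -/
def sharp (D : LagrangianInLeaf E F G Z S X) (j : ∀ x, LinearMap.BilinForm ℝ (D.EStar x)) (x : X) :
    D.EStar x →ₗ[ℝ] D.EX x where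
  toFun q := ⟨toCotan (j x q ∘ₗ D.toEStar x), fun u => by
      change j x q (D.toEStar x (D.TXZ x u)) = 0
      have h : D.toEStar x (D.TXZ x u) = 0 :=
        (Submodule.Quotient.mk_eq_zero _).2 ⟨u, rfl⟩
      rw [h, map_zero]⟩
  map_add' q q' := by
    apply Subtype.ext
    ext v
    change j x (q + q') (D.toEStar x v) = j x q (D.toEStar x v) + j x q' (D.toEStar x v)
    rw [map_add, LinearMap.add_apply]
  map_smul' c q := by
    apply Subtype.ext
    ext v
    change j x (c • q) (D.toEStar x v) = c • j x q (D.toEStar x v)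
    rw [map_smul, LinearMap.smul_apply]

/-- `j♯₀ = (Ti_S)* ∘ j♯ ∘ Ti_S : TS|_X / TX → (TX)⁰ ⊆ T*S|_X`. -/
def sharp0 (D : LagrangianInLeaf E F G Z S X) (j : ∀ x, LinearMap.BilinForm ℝ (D.EStar x))
    (x : X) : D.QS x →ₗ[ℝ] D.annS x :=
  D.restrS x ∘ₗ D.sharp j x ∘ₗ D.QStoEStar x

/-- `η♭` is the inverse of `j♯`, i.e. `η(j♯ q, ξ) = ⟨ξ, q⟩`. -/
def IsInverse (D : LagrangianInLeaf E F G Z S X) (j : ∀ x, LinearMap.BilinForm ℝ (D.EStar x))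
    (η : ∀ x, LinearMap.BilinForm ℝ (D.EX x)) : Prop :=
  ∀ x q ξ, η x (D.sharp j x q) ξ = D.pairing x ξ q

/-- The restriction to `L_X` of a field of bilinear forms on `E_X`. -/
def restrictL (D : LagrangianInLeaf E F G Z S X) (η : ∀ x, LinearMap.BilinForm ℝ (D.EX x))
    (x : X) : LinearMap.BilinForm ℝ (D.LX x) :=
  (η x).compl₁₂ (D.LtoE x) (D.LtoE x)

/-- Triples consisting of a field of bilinear forms on `TX`, a bundle morphism `TX → E_X` and a
field of bilinear forms on `L_X`. -/
@[ext]
structure Triple (D : LagrangianInLeaf E F G Z S X) where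
  γ : ∀ x : X, LinearMap.BilinForm ℝ (TangentSpace 𝓘(ℝ, G) x)
  α : ∀ x : X, TangentSpace 𝓘(ℝ, G) x →ₗ[ℝ] D.EX x
  χ : ∀ x : X, LinearMap.BilinForm ℝ (D.LX x)

/-- The triple attached to `j` and its inverse `η`:
`γ♭ = (-ω♭_X)* ∘ (j♯₀)⁻¹ ∘ (-ω♭_X)`, `α♭ = j♯ ∘ Ti_S ∘ (j♯₀)⁻¹ ∘ (-ω♭_X)`, and `χ` is the
restriction of `η` to `L_X`. Here `[y] = (j♯₀)⁻¹(-ω♭_X u)`. -/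
structure IsTripleOf (D : LagrangianInLeaf E F G Z S X)
    (j : ∀ x, LinearMap.BilinForm ℝ (D.EStar x)) (η : ∀ x, LinearMap.BilinForm ℝ (D.EX x))
    (t : D.Triple) : Prop where
  invertible : ∀ x, Function.Bijective (D.sharp0 j x)
  metric : ∀ (x : X) (u : TangentSpace 𝓘(ℝ, G) x) (y : TangentSpace 𝓘(ℝ, F) (D.iX x)),
    (D.sharp0 j x (Submodule.Quotient.mk y) : Cotan F (D.iX x)) = -D.flatX x u →
      ∀ v, t.γ x u v = -(D.flatX x v y)
  connection : ∀ (x : X) (u : TangentSpace 𝓘(ℝ, G) x) (y : TangentSpace 𝓘(ℝ, F) (D.iX x)),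
    (D.sharp0 j x (Submodule.Quotient.mk y) : Cotan F (D.iX x)) = -D.flatX x u →
      t.α x u = D.sharp j x (D.toEStar x (D.TS x y))
  scalar : t.χ = D.restrictL η

/-- A field `η` of nondegenerate forms on `E_X` and a triple correspond to each other: the triple
is the one attached to `j` and `η`, where `j♯` is the inverse of `η♭`. -/
def Corresponds (D : LagrangianInLeaf E F G Z S X) (η : ∀ x, LinearMap.BilinForm ℝ (D.EX x))
    (t : D.Triple) : Prop :=
  ∃ j : ∀ x, LinearMap.BilinForm ℝ (D.EStar x), D.IsInverse j η ∧ D.IsTripleOf j η t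

/-! ### Smooth sections -/

section Smooth

variable [IsManifold 𝓘(ℝ, E) ∞ Z] [IsManifold 𝓘(ℝ, G) ∞ X]

/-- Smooth vector fields on `X`. -/
def ΓTX (_D : LagrangianInLeaf E F G Z S X) : Set (∀ x : X, TangentSpace 𝓘(ℝ, G) x) :=
  {V | ContMDiff 𝓘(ℝ, G) 𝓘(ℝ, G).tangent ∞ (fun x => (⟨x, V x⟩ : TangentBundle 𝓘(ℝ, G) X))}

/-- Smooth sections of `T*Z|_X` over a subset `U` of `X`. -/
def SmoothAlongOn (D : LagrangianInLeaf E F G Z S X) (U : Set X) (s : ∀ x : X, Cotan E (D.pt x)) :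
    Prop :=
  ContMDiffOn 𝓘(ℝ, G) (𝓘(ℝ, E).prod 𝓘(ℝ, E →L[ℝ] ℝ)) ∞ (fun x => cotPoint (D.pt x) (s x)) U

/-- Smooth sections of `E_X`. -/
def ΓEX (D : LagrangianInLeaf E F G Z S X) : Set (∀ x : X, D.EX x) :=
  {s | D.SmoothAlongOn univ (fun x => (s x : Cotan E (D.pt x)))}

/-- Smooth sections of `L_X`. -/
def ΓLX (D : LagrangianInLeaf E F G Z S X) : Set (∀ x : X, D.LX x) :=
  {s | D.SmoothAlongOn univ (fun x => (s x : Cotan E (D.pt x)))}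

/-- Smooth sections of `TZ|_X`. -/
def ΓTZ (D : LagrangianInLeaf E F G Z S X) : Set (∀ x : X, TangentSpace 𝓘(ℝ, E) (D.pt x)) :=
  {V | ContMDiff 𝓘(ℝ, G) 𝓘(ℝ, E).tangent ∞
    (fun x => (⟨D.pt x, V x⟩ : TangentBundle 𝓘(ℝ, E) Z))}

/-- Smooth sections of `S²(E_X)`, i.e. smooth fields of symmetric bilinear forms on `E_X*`. -/
structure IsSymmetricSection (D : LagrangianInLeaf E F G Z S X)
    (j : ∀ x, LinearMap.BilinForm ℝ (D.EStar x)) : Prop where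
  symm : ∀ x q q', j x q q' = j x q' q
  smooth : ∀ U ∈ D.ΓTZ, ∀ V ∈ D.ΓTZ, ContMDiff 𝓘(ℝ, G) 𝓘(ℝ, ℝ) ∞
    (fun x => j x (D.toEStar x (U x)) (D.toEStar x (V x)))

/-- `E_X`-connection forms: smooth splittings of `-w♯ : E_X → TX`. -/
structure IsConnectionForm (D : LagrangianInLeaf E F G Z S X)
    (α : ∀ x : X, TangentSpace 𝓘(ℝ, G) x →ₗ[ℝ] D.EX x) : Prop where
  splitting : ∀ x u, -(D.P.sharp (D.pt x) (α x u : Cotan E (D.pt x))) = D.TXZ x u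
  smooth : ∀ V ∈ D.ΓTX, (fun x => α x (V x)) ∈ D.ΓEX

/-- Triples `(γ, α, χ)` of a metric on `X`, an `E_X`-connection form, and a field of scalar
products on `L_X`. -/
structure Triple.IsAdmissible {D : LagrangianInLeaf E F G Z S X} (t : D.Triple) : Prop where
  metric : IsScalarProductField (G := G) D.ΓTX t.γ
  connection : D.IsConnectionForm t.α
  scalar : IsScalarProductField (G := G) D.ΓLX t.χ

/-! ### The vertical Hessian -/

/-- `j` is the vertical Hessian of `H` along `X` (where `dH` vanishes): for the section `dH` of
`T*Z`, `j♯[u]` is the second component of `T(dH) u` in the decomposition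
`T(T*Z) = TZ ⊕ T*Z` along the zero section `o`, that is, `T(dH) u = To(u) + (j♯[u])` with the
covector `j♯[u]` regarded as a vertical tangent vector at the zero covector. -/
def IsVerticalHessian (D : LagrangianInLeaf E F G Z S X) (H : Z → ℝ)
    (j : ∀ x, LinearMap.BilinForm ℝ (D.EStar x)) : Prop :=
  ∀ (x : X) (u : TangentSpace 𝓘(ℝ, E) (D.pt x)),
    let TdH : E × (E →L[ℝ] ℝ) :=
      mfderiv 𝓘(ℝ, E) (𝓘(ℝ, E).prod 𝓘(ℝ, E →L[ℝ] ℝ))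
        (fun z : Z => cotPoint z (dFun E H z)) (D.pt x) u
    let To : E × (E →L[ℝ] ℝ) :=
      mfderiv 𝓘(ℝ, E) (𝓘(ℝ, E).prod 𝓘(ℝ, E →L[ℝ] ℝ))
        (fun z : Z => cotPoint z (0 : Cotan E z)) (D.pt x) u
    let vert : E × (E →L[ℝ] ℝ) :=
      mfderiv 𝓘(ℝ, E →L[ℝ] ℝ) (𝓘(ℝ, E).prod 𝓘(ℝ, E →L[ℝ] ℝ))
        (fun ξ : E →L[ℝ] ℝ => cotPoint (D.pt x) (ξ : Cotan E (D.pt x))) 0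
        (D.sharp j x (D.toEStar x u) : Cotan E (D.pt x))
    TdH = To + vert

/-! ### The Lie frame bundle and its principal connections -/

variable (𝔤 : Type*) [LieRing 𝔤] [LieAlgebra ℝ 𝔤]

/-- `f` is a point over `x` of the Lie frame bundle `R_X`, that is, an isomorphism of Lie algebras
`𝔤 → (L_X)_x`. -/
structure IsLieFrame (D : LagrangianInLeaf E F G Z S X) (x : X)
    (f : 𝔤 →ₗ[ℝ] Cotan E (D.pt x)) : Prop where
  injective : Function.Injective f
  range_eq : LinearMap.range f = D.LX x
  map_lie : ∀ a b : 𝔤, f ⁅a, b⁆ = D.P.isotropyBracket (D.pt x) (f a) (f b)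

/-- Smooth local sections of the Lie frame bundle `R_X`. -/
structure LocalFrame (D : LagrangianInLeaf E F G Z S X) where
  dom : Set X
  isOpen_dom : IsOpen dom
  frame : ∀ x : X, 𝔤 →ₗ[ℝ] Cotan E (D.pt x)
  isLieFrame : ∀ x ∈ dom, D.IsLieFrame 𝔤 x (frame x)
  smooth : ∀ a : 𝔤, D.SmoothAlongOn dom (fun x => frame x a)

/-- A principal connection form on `R_X`, with structure group `Aut(𝔤)` and
`Lie(Aut(𝔤)) = Der(𝔤)`, given by its pull-backs `A_σ = σ*A` by all smooth local sections `σ` of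
`R_X`: these are smooth `Der(𝔤)`-valued one-forms on the domains of the sections, and if
`σ' = σ ∘ g` for an `Aut(𝔤)`-valued function `g`, then `A_σ' = Ad(g⁻¹) A_σ + g⁻¹ dg`. -/
structure IsPrincipalConnection (D : LagrangianInLeaf E F G Z S X)
    (A : D.LocalFrame 𝔤 → ∀ x : X, TangentSpace 𝓘(ℝ, G) x →ₗ[ℝ] LieDerivation ℝ 𝔤 𝔤) : Prop where
  smooth : ∀ (σ : D.LocalFrame 𝔤), ∀ V ∈ D.ΓTX, ∀ (a : 𝔤) (l : 𝔤 →ₗ[ℝ] ℝ),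
    ContMDiffOn 𝓘(ℝ, G) 𝓘(ℝ, ℝ) ∞ (fun x => l (A σ x (V x) a)) σ.dom
  gauge : ∀ (σ σ' : D.LocalFrame 𝔤) (g : X → 𝔤 →ₗ[ℝ] 𝔤) (x : X), x ∈ σ.dom → x ∈ σ'.dom →
    (∀ᶠ y in 𝓝 x, ∀ a, σ'.frame y a = σ.frame y (g y a)) →
    ∀ (v : TangentSpace 𝓘(ℝ, G) x) (a : 𝔤) (l : 𝔤 →ₗ[ℝ] ℝ),
      l (g x (A σ' x v a)) = l (A σ x v (g x a)) + dFun G (fun y => l (g y a)) x v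

/-- The principal connection `A` is the one determined by the `E_X`-connection form `α`, i.e. by
the covariant derivative `∇_V s = {α(V), s}` in `L_X`: in every local section `σ` of `R_X`,
`σ(A_σ(V) a) = {α(V), σ(a)}`. The bracket of sections of `E_X` is the bracket of one-forms on `Z`
that extend them locally. -/
def IsInducedBy (D : LagrangianInLeaf E F G Z S X)
    (α : ∀ x : X, TangentSpace 𝓘(ℝ, G) x →ₗ[ℝ] D.EX x)
    (A : D.LocalFrame 𝔤 → ∀ x : X, TangentSpace 𝓘(ℝ, G) x →ₗ[ℝ] LieDerivation ℝ 𝔤 𝔤) : Prop :=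
  ∀ (σ : D.LocalFrame 𝔤), ∀ x ∈ σ.dom, ∀ V ∈ D.ΓTX, ∀ (c : 𝔤) (a b : ∀ z : Z, Cotan E z),
    SmoothForm a → SmoothForm b →
    (∀ᶠ y in 𝓝 x, a (D.pt y) = (α y (V y) : Cotan E (D.pt y))) →
    (∀ᶠ y in 𝓝 x, b (D.pt y) = σ.frame y c) →
      σ.frame x (A σ x (V x) c) = D.P.formBracket a b (D.pt x)

end Smooth

end LagrangianInLeaf

end

/-! Everything rests on the anchor ρ = -ϖ♯ : E_X → TX. Skew-symmetry of ϖ makes the kernel of ϖ♯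
over the leaf the annihilator of TS, and since X is Lagrangian in S, ϖ♯ maps (TX)⁰ onto TX. Hence
there is an exact sequence 0 → L_X → E_X → TX → 0 (`rho_eq_zero_iff`, `rho_surjective`), and ρ ξ = u
means (Ti_S)* ξ = -ω♭_X u (`rho_eq_iff`), which explains the signs in the formulas for γ and α.

If η♭ inverts j♯, then η(j♯[Ti_S y], ζ) = ζ(Ti_S y), so j♯ carries TS/TX onto the η-orthogonal of
L_X. The kernel of j♯₀ is therefore L_X ∩ L_X^⊥, and j♯₀ is invertible exactly when η is
nondegenerate on L_X (`sharp0_bijective_iff`). In that case E_X = L_X ⊕ L_X^⊥, the form α is the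
lift of TX into L_X^⊥, and γ is the pull-back of η by α (`isTripleOf_iff`). Thus η = ρ*γ + p*χ,
where p is the projection to L_X along α (`eta_apply`). This one formula rebuilds η from a triple,
shows that η is unique, and gives the statement on positivity. Smoothness comes from local frames
and the smoothness of the solution of a linear system (`contMDiffAt_coeff`).

The vertical Hessian is the second derivative of H in a chart. It is symmetric, it kills TX because
dH vanishes along X, and a change of chart adds only a term proportional to dH, which is zero there.

For the connection, let π be the matrix of ϖ in a chart. For a section s of L_X and a = α(u), the
bracket of one-forms reads {a, s} = D_u s + a(dπ(·) s) (`covRep_formBracket`). Differentiating π s =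
0 and using the Jacobi identity shows that this lies in L_X; the derivative of the Jacobi identity,
taken at covectors in the kernel, shows that it is a derivation of the fibrewise bracket
(`covDerivRep_bracket`). In a Lie frame it is therefore given by a Der(𝔤)-valued form; the Leibniz
rule is the gauge rule. Uniqueness holds because sections along the immersed X extend locally to
one-forms on Z (`exists_smoothForm_of_immersion`). -/

noncomputable section

set_option linter.unusedSectionVars false

/-! ### Tangent vectors and covectors read in a chart -/

section Charts

/-- The differential at `z` of the chart centred at `z₀`. -/
def chartD (E : Type*) [NormedAddCommGroup E] [NormedSpace ℝ E]
    {Z : Type*} [TopologicalSpace Z] [ChartedSpace E Z] (z₀ z : Z) :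
    TangentSpace 𝓘(ℝ, E) z →L[ℝ] E :=
  mfderiv 𝓘(ℝ, E) 𝓘(ℝ, E) (extChartAt 𝓘(ℝ, E) z₀) z

/-- The differential of the inverse of the chart centred at `z₀`, at the image of `z`. -/
def chartI (E : Type*) [NormedAddCommGroup E] [NormedSpace ℝ E]
    {Z : Type*} [TopologicalSpace Z] [ChartedSpace E Z] (z₀ z : Z) :
    E →L[ℝ] TangentSpace 𝓘(ℝ, E) z :=
  mfderiv 𝓘(ℝ, E) 𝓘(ℝ, E) (extChartAt 𝓘(ℝ, E) z₀).symm (extChartAt 𝓘(ℝ, E) z₀ z)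

variable {E : Type*} [NormedAddCommGroup E] [NormedSpace ℝ E]
  {Z : Type*} [TopologicalSpace Z] [ChartedSpace E Z]

/-- The covector `ξ` at `z` read in the chart centred at `z₀`. -/
def covRep (z₀ : Z) {z : Z} (ξ : Cotan E z) : E →L[ℝ] ℝ :=
  ContinuousLinearMap.comp ξ (chartI E z₀ z)

theorem covRep_apply (z₀ : Z) {z : Z} (ξ : Cotan E z) (v : E) :
    covRep z₀ ξ v = ξ (chartI E z₀ z v) := rfl

variable [IsManifold 𝓘(ℝ, E) ∞ Z]

theorem chartD_chartI {z₀ z : Z} (hz : z ∈ (chartAt E z₀).source) (v : E) :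
    chartD E z₀ z (chartI E z₀ z v) = v := by
  have h := mfderiv_extChartAt_comp_mfderivWithin_extChartAt_symm' (I := 𝓘(ℝ, E)) (x := z₀)
    (y := z) (by rwa [extChartAt_source])
  have h2 := DFunLike.congr_fun h v
  simp only [modelWithCornersSelf_coe, range_id, mfderivWithin_univ] at h2
  exact h2

theorem chartI_chartD {z₀ z : Z} (hz : z ∈ (chartAt E z₀).source)
    (v : TangentSpace 𝓘(ℝ, E) z) : chartI E z₀ z (chartD E z₀ z v) = v := by
  have h := mfderivWithin_extChartAt_symm_comp_mfderiv_extChartAt' (I := 𝓘(ℝ, E)) (x := z₀)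
    (y := z) (by rwa [extChartAt_source])
  have h2 := DFunLike.congr_fun h v
  simp only [modelWithCornersSelf_coe, range_id, mfderivWithin_univ] at h2
  exact h2

theorem chartD_self (z : Z) (v : TangentSpace 𝓘(ℝ, E) z) : chartD E z z v = v := by
  have h := mfderiv_extChartAt_self (I := 𝓘(ℝ, E)) (x := z)
  exact DFunLike.congr_fun h v

theorem chartI_self (z : Z) (v : E) : chartI E z z v = v := by
  have h := chartI_chartD (mem_chart_source E z) (v : TangentSpace 𝓘(ℝ, E) z)
  exact (congrArg (chartI E z z) (chartD_self z v)).symm.trans h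

theorem covRep_self {z : Z} (ξ : Cotan E z) : covRep z ξ = ξ := by
  ext v
  rw [covRep_apply]
  exact congrArg ξ (chartI_self z v)

theorem covRep_chartD {z₀ z : Z} (hz : z ∈ (chartAt E z₀).source) (ξ : Cotan E z)
    (v : TangentSpace 𝓘(ℝ, E) z) : covRep z₀ ξ (chartD E z₀ z v) = ξ v := by
  rw [covRep_apply, chartI_chartD hz]

theorem trivializationAt_tangent {z₀ z : Z} (hz : z ∈ (chartAt E z₀).source)
    (v : TangentSpace 𝓘(ℝ, E) z) :
    (trivializationAt E (TangentSpace 𝓘(ℝ, E)) z₀ ⟨z, v⟩).2 = chartD E z₀ z v := by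
  have h := TangentBundle.continuousLinearMapAt_trivializationAt (I := 𝓘(ℝ, E)) hz
  have h2 := DFunLike.congr_fun h v
  rw [Trivialization.continuousLinearMapAt_apply, Trivialization.linearMapAt_apply] at h2
  rw [if_pos] at h2
  · exact h2
  · simpa using hz

/-- Together with `trivializationAt_tangent` this identifies the bundle trivialisations with the
coordinate maps `covRep` and `chartD`, so that smoothness of sections becomes smoothness of vector
valued functions. -/
theorem trivializationAt_cotan {z₀ z : Z} (hz : z ∈ (chartAt E z₀).source) (ξ : Cotan E z) :
    (trivializationAt (E →L[ℝ] ℝ) (fun z : Z => Cotan E z) z₀ (cotPoint z ξ)).2 =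
      covRep z₀ ξ := by
  have h := TangentBundle.symmL_trivializationAt (I := 𝓘(ℝ, E)) hz
  have h3 := hom_trivializationAt_apply (𝕜₁ := ℝ) (𝕜₂ := ℝ) (RingHom.id ℝ) (F₁ := E)
    (E₁ := fun z : Z => TangentSpace 𝓘(ℝ, E) z) (F₂ := ℝ)
    (E₂ := Bundle.Trivial Z ℝ) z₀ (cotPoint z ξ)
  refine (congrArg Prod.snd h3).trans ?_
  ext v
  have h2 := DFunLike.congr_fun h v
  simp only [modelWithCornersSelf_coe, range_id, mfderivWithin_univ] at h2
  refine (DFunLike.congr_fun (Bundle.Trivial.continuousLinearMapAt_trivialization ℝ Z ℝ z) _).trans ?_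
  exact congrArg ξ h2

end Charts

/-! ### Smooth coefficients with respect to a moving frame -/

section Coefficients

variable {G : Type*} [NormedAddCommGroup G] [NormedSpace ℝ G]
  {X : Type*} [TopologicalSpace X] [ChartedSpace G X]
  {W : Type*} [NormedAddCommGroup W] [NormedSpace ℝ W] [FiniteDimensional ℝ W]
  {ι : Type*} [Fintype ι]

/-- The coefficients of a smooth vector valued function with respect to smooth functions which are
linearly independent at a point are smooth at that point. -/
theorem contMDiffAt_coeff {S : ι → X → W} {c : ι → X → ℝ} {w : X → W} {x₀ : X}
    (hS : ∀ i, ContMDiffAt 𝓘(ℝ, G) 𝓘(ℝ, W) ∞ (S i) x₀)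
    (hli : LinearIndependent ℝ (fun i => S i x₀))
    (hw : ContMDiffAt 𝓘(ℝ, G) 𝓘(ℝ, W) ∞ w x₀)
    (h : ∀ᶠ x in 𝓝 x₀, ∑ i, c i x • S i x = w x) (i : ι) :
    ContMDiffAt 𝓘(ℝ, G) 𝓘(ℝ, ℝ) ∞ (c i) x₀ := by
  classical
  obtain ⟨l, hl⟩ := (Fintype.linearCombination ℝ (fun i => S i x₀)).exists_leftInverse_of_injective
    (LinearMap.ker_eq_bot.2 (linearIndependent_iff_injective_fintypeLinearCombination.1 hli))
  let L : W →L[ℝ] (ι → ℝ) := LinearMap.toContinuousLinearMap l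
  have hL : ∀ i, L (S i x₀) = Pi.single i 1 := fun i => by
    have := DFunLike.congr_fun hl (Pi.single i 1)
    simpa [L] using this
  -- `A x` sends a coefficient vector c to L(∑ c_i S_i(x)). It is the identity at x₀, hence
  -- invertible nearby, and the coefficients of w are A⁻¹(L w).
  let A : X → (ι → ℝ) →L[ℝ] (ι → ℝ) := fun x =>
    ∑ i, (ContinuousLinearMap.proj (R := ℝ) (φ := fun _ : ι => ℝ) i).smulRight (L (S i x))
  have hA : ContMDiffAt 𝓘(ℝ, G) 𝓘(ℝ, (ι → ℝ) →L[ℝ] (ι → ℝ)) ∞ A x₀ := by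
    refine ContMDiffAt.sum fun i _ => ?_
    exact (((ContinuousLinearMap.smulRightL ℝ (ι → ℝ) (ι → ℝ)
      (ContinuousLinearMap.proj (R := ℝ) (φ := fun _ : ι => ℝ) i)).comp L).contDiff.contDiffAt
      |>.contMDiffAt).comp x₀ (hS i)
  have hA0 : A x₀ = (ContinuousLinearEquiv.refl ℝ (ι → ℝ) : (ι → ℝ) →L[ℝ] (ι → ℝ)) := by
    ext v j
    simp [A, hL, Finset.sum_apply, Pi.single_apply]
  have hinv : ContMDiffAt 𝓘(ℝ, G) 𝓘(ℝ, (ι → ℝ) →L[ℝ] (ι → ℝ)) ∞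
      (fun x => ContinuousLinearMap.inverse (A x)) x₀ := by
    have h1 := contDiffAt_map_inverse (𝕜 := ℝ) (n := ∞) (ContinuousLinearEquiv.refl ℝ (ι → ℝ))
    rw [← hA0] at h1
    exact h1.contMDiffAt.comp x₀ hA
  have hfin : ContMDiffAt 𝓘(ℝ, G) 𝓘(ℝ, ℝ) ∞
      (fun x => ContinuousLinearMap.inverse (A x) (L (w x)) i) x₀ := by
    have h2 : ContMDiffAt 𝓘(ℝ, G) 𝓘(ℝ, ι → ℝ) ∞ (fun x => L (w x)) x₀ :=
      L.contDiff.contDiffAt.contMDiffAt.comp x₀ hw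
    have h3 := hinv.clm_apply h2
    exact (ContinuousLinearMap.proj (R := ℝ) (φ := fun _ : ι => ℝ) i).contDiff.contDiffAt
      |>.contMDiffAt.comp x₀ h3
  refine hfin.congr_of_eventuallyEq ?_
  have hunit : ∀ᶠ x in 𝓝 x₀, (A x).IsInvertible := by
    have := ContinuousLinearEquiv.nhds (ContinuousLinearEquiv.refl ℝ (ι → ℝ))
    rw [← hA0] at this
    exact hA.continuousAt this
  filter_upwards [h, hunit] with x hx hu
  have : L (w x) = A x (fun i => c i x) := by
    rw [← hx]
    simp [A]
  rw [this, hu.inverse_apply_eq.2 rfl]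

/-- Near a point where they are linearly independent, as many functions as the dimension form
a basis. -/
theorem eventually_exists_coeff {S : ι → X → W} {w : X → W} {x₀ : X}
    (hS : ∀ i, ContinuousAt (S i) x₀) (hli : LinearIndependent ℝ (fun i => S i x₀))
    (hcard : Fintype.card ι = Module.finrank ℝ W) :
    ∃ c : ι → X → ℝ, ∀ᶠ x in 𝓝 x₀, ∑ i, c i x • S i x = w x := by
  have hev : ∀ᶠ x in 𝓝 x₀, LinearIndependent ℝ (fun i => S i x) :=
    (tendsto_pi_nhds.2 hS).eventually hli.eventually
  have key : ∀ x, ∃ c : ι → ℝ, LinearIndependent ℝ (fun i => S i x) → ∑ i, c i • S i x = w x := by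
    intro x
    by_cases hx : LinearIndependent ℝ (fun i => S i x)
    · have h1 := hx.span_eq_top_of_card_eq_finrank' hcard
      have h2 : w x ∈ Submodule.span ℝ (range fun i => S i x) := by rw [h1]; trivial
      obtain ⟨c, hc⟩ := (Submodule.mem_span_range_iff_exists_fun ℝ).1 h2
      exact ⟨c, fun _ => hc⟩
    · exact ⟨0, fun h => absurd h hx⟩
  choose c hc using key
  exact ⟨fun i x => c x i, hev.mono fun x hx => hc x hx⟩

end Coefficients

/-! ### Smoothness of sections along a map, in a fixed chart -/

section SectionSmoothness

variable {E : Type*} [NormedAddCommGroup E] [NormedSpace ℝ E]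
  {Z : Type*} [TopologicalSpace Z] [ChartedSpace E Z] [IsManifold 𝓘(ℝ, E) ∞ Z]
  {G : Type*} [NormedAddCommGroup G] [NormedSpace ℝ G]
  {X : Type*} [TopologicalSpace X] [ChartedSpace G X]

theorem contMDiffAt_tangent_iff {f : X → Z} {V : ∀ x, TangentSpace 𝓘(ℝ, E) (f x)} {x : X} {z₀ : Z}
    (hf : ContMDiffAt 𝓘(ℝ, G) 𝓘(ℝ, E) ∞ f x) (hx : f x ∈ (chartAt E z₀).source) :
    ContMDiffAt 𝓘(ℝ, G) 𝓘(ℝ, E).tangent ∞ (fun x => (⟨f x, V x⟩ : TangentBundle 𝓘(ℝ, E) Z)) x ↔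
      ContMDiffAt 𝓘(ℝ, G) 𝓘(ℝ, E) ∞ (fun x => chartD E z₀ (f x) (V x)) x := by
  have h1 := Bundle.Trivialization.contMDiffAt_iff (IM := 𝓘(ℝ, G)) (IB := 𝓘(ℝ, E)) (n := ∞)
    (e := trivializationAt E (TangentSpace 𝓘(ℝ, E)) z₀)
    (f := fun x => (⟨f x, V x⟩ : TangentBundle 𝓘(ℝ, E) Z)) (x₀ := x)
    (by rw [Trivialization.mem_source]; simpa using hx)
  refine h1.trans ((and_iff_right hf).trans ?_)
  have hev : ∀ᶠ y in 𝓝 x, f y ∈ (chartAt E z₀).source :=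
    hf.continuousAt.eventually ((chartAt E z₀).open_source.mem_nhds hx)
  exact Filter.EventuallyEq.contMDiffAt_iff (hev.mono fun y hy => trivializationAt_tangent hy (V y))

/-- The centre `z₀` of the chart is independent of the point `x`, so one chart serves all points
near a given one. -/
theorem contMDiffAt_cotan_iff {f : X → Z} {s : ∀ x, Cotan E (f x)} {x : X} {z₀ : Z}
    (hf : ContMDiffAt 𝓘(ℝ, G) 𝓘(ℝ, E) ∞ f x) (hx : f x ∈ (chartAt E z₀).source) :
    ContMDiffAt 𝓘(ℝ, G) (𝓘(ℝ, E).prod 𝓘(ℝ, E →L[ℝ] ℝ)) ∞ (fun x => cotPoint (f x) (s x)) x ↔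
      ContMDiffAt 𝓘(ℝ, G) 𝓘(ℝ, E →L[ℝ] ℝ) ∞ (fun x => covRep z₀ (s x)) x := by
  have h1 := Bundle.Trivialization.contMDiffAt_iff (IM := 𝓘(ℝ, G)) (IB := 𝓘(ℝ, E)) (n := ∞)
    (e := trivializationAt (E →L[ℝ] ℝ) (fun z : Z => Cotan E z) z₀)
    (f := fun x => cotPoint (f x) (s x)) (x₀ := x)
    (by
      rw [Trivialization.mem_source]
      exact ⟨by simpa [cotPoint] using hx, trivial⟩)
  refine h1.trans ((and_iff_right hf).trans ?_)
  have hev : ∀ᶠ y in 𝓝 x, f y ∈ (chartAt E z₀).source :=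
    hf.continuousAt.eventually ((chartAt E z₀).open_source.mem_nhds hx)
  exact Filter.EventuallyEq.contMDiffAt_iff (hev.mono fun y hy => trivializationAt_cotan hy (s y))

end SectionSmoothness

/-! ### Cut-off functions and operations on sections along a map -/

section Bump

variable {E : Type*} [NormedAddCommGroup E] [NormedSpace ℝ E]
  {Z : Type*} [TopologicalSpace Z] [ChartedSpace E Z]
  {G : Type*} [NormedAddCommGroup G] [NormedSpace ℝ G]
  {X : Type*} [TopologicalSpace X] [ChartedSpace G X]

theorem exists_smooth_bump [FiniteDimensional ℝ G] [IsManifold 𝓘(ℝ, G) ∞ X] [T2Space X]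
    {x₀ : X} {N : Set X} (hN : N ∈ 𝓝 x₀) :
    ∃ φ : X → ℝ, ContMDiff 𝓘(ℝ, G) 𝓘(ℝ, ℝ) ∞ φ ∧ (∀ᶠ x in 𝓝 x₀, φ x = 1) ∧ tsupport φ ⊆ N := by
  obtain ⟨φ, -, hφ⟩ := (SmoothBumpFunction.nhds_basis_tsupport (I := 𝓘(ℝ, G)) x₀).mem_iff.1 hN
  exact ⟨φ, φ.contMDiff, φ.eventuallyEq_one, hφ⟩

/-- A function which is smooth near a point agrees near that point with a smooth function. -/
theorem exists_smooth_extension [FiniteDimensional ℝ G] [IsManifold 𝓘(ℝ, G) ∞ X] [T2Space X]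
    {W : Type*} [NormedAddCommGroup W] [NormedSpace ℝ W] {f : X → W} {x₀ : X}
    (hf : ∀ᶠ x in 𝓝 x₀, ContMDiffAt 𝓘(ℝ, G) 𝓘(ℝ, W) ∞ f x) :
    ∃ g : X → W, ContMDiff 𝓘(ℝ, G) 𝓘(ℝ, W) ∞ g ∧ g =ᶠ[𝓝 x₀] f := by
  obtain ⟨φ, h1, h2, h3⟩ := exists_smooth_bump (G := G) hf
  refine ⟨fun x => φ x • f x, contMDiff_of_tsupport fun x hx => ?_, h2.mono fun x hx => by
    simp [hx]⟩
  exact h1.contMDiffAt.smul (h3 (tsupport_smul_subset_left φ f hx))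

variable [IsManifold 𝓘(ℝ, E) ∞ Z]

theorem contMDiffAt_zero_tangent {f : X → Z} {x : X}
    (hf : ContMDiffAt 𝓘(ℝ, G) 𝓘(ℝ, E) ∞ f x) :
    ContMDiffAt 𝓘(ℝ, G) 𝓘(ℝ, E).tangent ∞
      (fun x => (⟨f x, 0⟩ : TangentBundle 𝓘(ℝ, E) Z)) x := by
  rw [contMDiffAt_tangent_iff hf (mem_chart_source E (f x))]
  simp only [map_zero]
  exact contMDiffAt_const

theorem contMDiffAt_zero_cotan {f : X → Z} {x : X}
    (hf : ContMDiffAt 𝓘(ℝ, G) 𝓘(ℝ, E) ∞ f x) :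
    ContMDiffAt 𝓘(ℝ, G) (𝓘(ℝ, E).prod 𝓘(ℝ, E →L[ℝ] ℝ)) ∞
      (fun x => cotPoint (f x) (0 : Cotan E (f x))) x := by
  rw [contMDiffAt_cotan_iff hf (mem_chart_source E (f x))]
  exact contMDiffAt_const (c := (0 : E →L[ℝ] ℝ))

theorem contMDiffAt_smul_tangent {f : X → Z} {φ : X → ℝ} {V : ∀ x, TangentSpace 𝓘(ℝ, E) (f x)}
    {x : X} (hf : ContMDiffAt 𝓘(ℝ, G) 𝓘(ℝ, E) ∞ f x)
    (hφ : ContMDiffAt 𝓘(ℝ, G) 𝓘(ℝ, ℝ) ∞ φ x)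
    (hV : ContMDiffAt 𝓘(ℝ, G) 𝓘(ℝ, E).tangent ∞
      (fun x => (⟨f x, V x⟩ : TangentBundle 𝓘(ℝ, E) Z)) x) :
    ContMDiffAt 𝓘(ℝ, G) 𝓘(ℝ, E).tangent ∞
      (fun x => (⟨f x, φ x • V x⟩ : TangentBundle 𝓘(ℝ, E) Z)) x := by
  rw [contMDiffAt_tangent_iff hf (mem_chart_source E (f x))] at hV ⊢
  simp only [map_smul]
  exact hφ.smul hV

theorem contMDiffAt_smul_cotan {f : X → Z} {φ : X → ℝ} {s : ∀ x, Cotan E (f x)}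
    {x : X} (hf : ContMDiffAt 𝓘(ℝ, G) 𝓘(ℝ, E) ∞ f x)
    (hφ : ContMDiffAt 𝓘(ℝ, G) 𝓘(ℝ, ℝ) ∞ φ x)
    (hs : ContMDiffAt 𝓘(ℝ, G) (𝓘(ℝ, E).prod 𝓘(ℝ, E →L[ℝ] ℝ)) ∞
      (fun x => cotPoint (f x) (s x)) x) :
    ContMDiffAt 𝓘(ℝ, G) (𝓘(ℝ, E).prod 𝓘(ℝ, E →L[ℝ] ℝ)) ∞
      (fun x => cotPoint (f x) (φ x • s x)) x := by
  rw [contMDiffAt_cotan_iff hf (mem_chart_source E (f x))] at hs ⊢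
  exact hφ.smul hs

/-- Off the support of φ the product is locally the zero section, so V has to be smooth only on the
support. This turns local sections into global ones. -/
theorem contMDiff_bump_smul_tangent {f : X → Z} {φ : X → ℝ}
    {V : ∀ x, TangentSpace 𝓘(ℝ, E) (f x)} (hf : ContMDiff 𝓘(ℝ, G) 𝓘(ℝ, E) ∞ f)
    (hφ : ContMDiff 𝓘(ℝ, G) 𝓘(ℝ, ℝ) ∞ φ)
    (hV : ∀ x ∈ tsupport φ, ContMDiffAt 𝓘(ℝ, G) 𝓘(ℝ, E).tangent ∞
      (fun x => (⟨f x, V x⟩ : TangentBundle 𝓘(ℝ, E) Z)) x) :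
    ContMDiff 𝓘(ℝ, G) 𝓘(ℝ, E).tangent ∞
      (fun x => (⟨f x, φ x • V x⟩ : TangentBundle 𝓘(ℝ, E) Z)) := by
  intro x
  by_cases hx : x ∈ tsupport φ
  · exact contMDiffAt_smul_tangent hf.contMDiffAt hφ.contMDiffAt (hV x hx)
  · refine (contMDiffAt_zero_tangent hf.contMDiffAt).congr_of_eventuallyEq ?_
    filter_upwards [notMem_tsupport_iff_eventuallyEq.1 hx] with y hy
    rw [hy, Pi.zero_apply, zero_smul]

theorem contMDiff_bump_smul_cotan {f : X → Z} {φ : X → ℝ}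
    {s : ∀ x, Cotan E (f x)} (hf : ContMDiff 𝓘(ℝ, G) 𝓘(ℝ, E) ∞ f)
    (hφ : ContMDiff 𝓘(ℝ, G) 𝓘(ℝ, ℝ) ∞ φ)
    (hs : ∀ x ∈ tsupport φ, ContMDiffAt 𝓘(ℝ, G) (𝓘(ℝ, E).prod 𝓘(ℝ, E →L[ℝ] ℝ)) ∞
      (fun x => cotPoint (f x) (s x)) x) :
    ContMDiff 𝓘(ℝ, G) (𝓘(ℝ, E).prod 𝓘(ℝ, E →L[ℝ] ℝ)) ∞
      (fun x => cotPoint (f x) (φ x • s x)) := by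
  intro x
  by_cases hx : x ∈ tsupport φ
  · exact contMDiffAt_smul_cotan hf.contMDiffAt hφ.contMDiffAt (hs x hx)
  · refine (contMDiffAt_zero_cotan hf.contMDiffAt).congr_of_eventuallyEq ?_
    filter_upwards [notMem_tsupport_iff_eventuallyEq.1 hx] with y hy
    rw [hy, Pi.zero_apply, zero_smul]

/-- The vector fields which are constant in a chart are smooth. -/
theorem contMDiffAt_chartI {f : X → Z} {x : X} {z₀ : Z} (e : E)
    (hf : ContMDiffAt 𝓘(ℝ, G) 𝓘(ℝ, E) ∞ f x) (hx : f x ∈ (chartAt E z₀).source) :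
    ContMDiffAt 𝓘(ℝ, G) 𝓘(ℝ, E).tangent ∞
      (fun x => (⟨f x, chartI E z₀ (f x) e⟩ : TangentBundle 𝓘(ℝ, E) Z)) x := by
  rw [contMDiffAt_tangent_iff hf hx]
  have hev : ∀ᶠ y in 𝓝 x, f y ∈ (chartAt E z₀).source :=
    hf.continuousAt.eventually ((chartAt E z₀).open_source.mem_nhds hx)
  exact (contMDiffAt_const (c := e)).congr_of_eventuallyEq
    (hev.mono fun y hy => chartD_chartI hy e)

theorem covRep_comp_chartD {z₀ z : Z} (hz : z ∈ (chartAt E z₀).source) (ξ : E →L[ℝ] ℝ) :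
    covRep z₀ (ξ.comp (chartD E z₀ z) : Cotan E z) = ξ := by
  ext v
  exact congrArg ξ (chartD_chartI hz v)

theorem comp_chartD_covRep {z₀ z : Z} (hz : z ∈ (chartAt E z₀).source) (ξ : Cotan E z) :
    (covRep z₀ ξ).comp (chartD E z₀ z) = ξ := by
  ext v
  exact covRep_chartD hz ξ v

/-- Covectors of smooth coordinates in a chart are smooth. -/
theorem contMDiffAt_comp_chartD {f : X → Z} {x : X} {z₀ : Z} {ξ : X → E →L[ℝ] ℝ}
    (hf : ContMDiffAt 𝓘(ℝ, G) 𝓘(ℝ, E) ∞ f x) (hx : f x ∈ (chartAt E z₀).source)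
    (hξ : ContMDiffAt 𝓘(ℝ, G) 𝓘(ℝ, E →L[ℝ] ℝ) ∞ ξ x) :
    ContMDiffAt 𝓘(ℝ, G) (𝓘(ℝ, E).prod 𝓘(ℝ, E →L[ℝ] ℝ)) ∞
      (fun x => cotPoint (f x) ((ξ x).comp (chartD E z₀ (f x)))) x := by
  rw [contMDiffAt_cotan_iff hf hx]
  have hev : ∀ᶠ y in 𝓝 x, f y ∈ (chartAt E z₀).source :=
    hf.continuousAt.eventually ((chartAt E z₀).open_source.mem_nhds hx)
  exact hξ.congr_of_eventuallyEq (hev.mono fun y hy => covRep_comp_chartD hy (ξ y))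

theorem contMDiffAt_pairing {f : X → Z} {s : ∀ x, Cotan E (f x)}
    {V : ∀ x, TangentSpace 𝓘(ℝ, E) (f x)} {x : X} (hf : ContMDiffAt 𝓘(ℝ, G) 𝓘(ℝ, E) ∞ f x)
    (hs : ContMDiffAt 𝓘(ℝ, G) (𝓘(ℝ, E).prod 𝓘(ℝ, E →L[ℝ] ℝ)) ∞
      (fun x => cotPoint (f x) (s x)) x)
    (hV : ContMDiffAt 𝓘(ℝ, G) 𝓘(ℝ, E).tangent ∞
      (fun x => (⟨f x, V x⟩ : TangentBundle 𝓘(ℝ, E) Z)) x) :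
    ContMDiffAt 𝓘(ℝ, G) 𝓘(ℝ, ℝ) ∞ (fun x => s x (V x)) x := by
  have hx := mem_chart_source E (f x)
  rw [contMDiffAt_cotan_iff hf hx] at hs
  rw [contMDiffAt_tangent_iff hf hx] at hV
  have hev : ∀ᶠ y in 𝓝 x, f y ∈ (chartAt E (f x)).source :=
    hf.continuousAt.eventually ((chartAt E (f x)).open_source.mem_nhds hx)
  exact (hs.clm_apply hV).congr_of_eventuallyEq
    (hev.mono fun y hy => (covRep_chartD hy (s y) (V y)).symm)

/-- In a basis of the finite-dimensional source, A is the sum of the coordinate forms tensored with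
the values A(b_i). -/
theorem contMDiffAt_clm_of_apply [FiniteDimensional ℝ E] {W : Type*} [NormedAddCommGroup W]
    [NormedSpace ℝ W] {A : X → E →L[ℝ] W} {x : X}
    (h : ∀ e, ContMDiffAt 𝓘(ℝ, G) 𝓘(ℝ, W) ∞ (fun x => A x e) x) :
    ContMDiffAt 𝓘(ℝ, G) 𝓘(ℝ, E →L[ℝ] W) ∞ A x := by
  let b := Module.finBasis ℝ E
  have hA : A = fun x => ∑ i, ContinuousLinearMap.smulRightL ℝ E W
      (LinearMap.toContinuousLinearMap (b.coord i)) (A x (b i)) := by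
    funext x
    ext v
    conv_lhs => rw [← b.sum_repr v]
    simp only [map_sum, map_smul, FunLike.coe_sum, Finset.sum_apply]
    rfl
  rw [hA]
  exact ContMDiffAt.sum fun i _ =>
    (ContinuousLinearMap.contDiff _).contDiffAt.contMDiffAt.comp x (h (b i))

/-- A covector field along a map is smooth if its values on vector fields which are constant in a
chart are smooth. -/
theorem contMDiffAt_cotan_of_apply [FiniteDimensional ℝ E] {f : X → Z} {s : ∀ x, Cotan E (f x)}
    {x : X} (hf : ContMDiffAt 𝓘(ℝ, G) 𝓘(ℝ, E) ∞ f x)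
    (h : ∀ e : E, ContMDiffAt 𝓘(ℝ, G) 𝓘(ℝ, ℝ) ∞ (fun y => s y (chartI E (f x) (f y) e)) x) :
    ContMDiffAt 𝓘(ℝ, G) (𝓘(ℝ, E).prod 𝓘(ℝ, E →L[ℝ] ℝ)) ∞ (fun x => cotPoint (f x) (s x)) x := by
  rw [contMDiffAt_cotan_iff hf (mem_chart_source E (f x))]
  exact contMDiffAt_clm_of_apply h

/-- The image of a smooth vector field along a map under the differential of a smooth map. -/
theorem contMDiffAt_mfderiv_apply {F : Type*} [NormedAddCommGroup F] [NormedSpace ℝ F]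
    {S : Type*} [TopologicalSpace S] [ChartedSpace F S] [IsManifold 𝓘(ℝ, F) ∞ S]
    {κ : S → Z} (hκ : ContMDiff 𝓘(ℝ, F) 𝓘(ℝ, E) ∞ κ) {f : X → S}
    {V : ∀ x, TangentSpace 𝓘(ℝ, F) (f x)} {x : X}
    (hV : ContMDiffAt 𝓘(ℝ, G) 𝓘(ℝ, F).tangent ∞
      (fun x => (⟨f x, V x⟩ : TangentBundle 𝓘(ℝ, F) S)) x) :
    ContMDiffAt 𝓘(ℝ, G) 𝓘(ℝ, E).tangent ∞
      (fun x => (⟨κ (f x), mfderiv 𝓘(ℝ, F) 𝓘(ℝ, E) κ (f x) (V x)⟩ :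
        TangentBundle 𝓘(ℝ, E) Z)) x :=
  ((hκ.contMDiff_tangentMap (m := ∞) (by rfl)).contMDiffAt).comp x hV

end Bump

/-! ### The kernel of ϖ♯ and the symplectic form of a leaf -/

section LeafForm

variable {E : Type*} [NormedAddCommGroup E] [NormedSpace ℝ E]
  {F : Type*} [NormedAddCommGroup F] [NormedSpace ℝ F]
  {Z : Type*} [TopologicalSpace Z] [ChartedSpace E Z]
  {S : Type*} [TopologicalSpace S] [ChartedSpace F S]

instance [FiniteDimensional ℝ E] (z : Z) : FiniteDimensional ℝ (TangentSpace 𝓘(ℝ, E) z) :=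
  inferInstanceAs (FiniteDimensional ℝ E)

instance [FiniteDimensional ℝ E] (z : Z) : FiniteDimensional ℝ (Cotan E z) :=
  inferInstanceAs (FiniteDimensional ℝ (E →L[ℝ] ℝ))

/-- A tangent vector outside a subspace is detected by a covector vanishing on the subspace. -/
theorem exists_cotan_of_notMem [FiniteDimensional ℝ E] {z : Z}
    {p : Submodule ℝ (TangentSpace 𝓘(ℝ, E) z)} {v : TangentSpace 𝓘(ℝ, E) z} (hv : v ∉ p) :
    ∃ ξ : Cotan E z, (∀ w ∈ p, ξ w = 0) ∧ ξ v ≠ 0 := by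
  obtain ⟨l, h1, h2⟩ := Submodule.exists_le_ker_of_notMem hv
  exact ⟨toCotan l, fun w hw => h2 hw, h1⟩

variable {P : PoissonStructure E Z} {ι : S → Z}

/-- By skew-symmetry the kernel of ϖ♯ is the annihilator of its image, and the image is the tangent
space of the leaf. -/
theorem IsIntegralManifold.sharp_eq_zero_iff (h : IsIntegralManifold (F := F) P ι) {s : S}
    {ξ : Cotan E (ι s)} :
    P.sharp (ι s) ξ = 0 ↔ ∀ y, ξ (mfderiv 𝓘(ℝ, F) 𝓘(ℝ, E) ι s y) = 0 := by
  constructor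
  · intro h0 y
    have hy : mfderiv 𝓘(ℝ, F) 𝓘(ℝ, E) ι s y ∈ LinearMap.range (P.sharp (ι s)).toLinearMap := by
      rw [← h.range_eq s]
      exact ⟨y, rfl⟩
    obtain ⟨ζ, hζ⟩ := hy
    have h1 := P.skew (ι s) ξ ζ
    rw [h0, map_zero, neg_zero] at h1
    exact (congrArg ξ hζ).symm.trans h1
  · intro h0
    by_contra hne
    obtain ⟨ζ, hζ⟩ : ∃ ζ : Cotan E (ι s), ζ (P.sharp (ι s) ξ) ≠ 0 := by
      let w : E := P.sharp (ι s) ξ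
      have hw : w ≠ 0 := hne
      obtain ⟨g, hg⟩ := SeparatingDual.exists_ne_zero (R := ℝ) hw
      exact ⟨g, hg⟩
    apply hζ
    have hy : P.sharp (ι s) ζ ∈ LinearMap.range (mfderiv 𝓘(ℝ, F) 𝓘(ℝ, E) ι s).toLinearMap := by
      rw [h.range_eq s]
      exact ⟨ζ, rfl⟩
    obtain ⟨y, hy⟩ := hy
    have h1 := P.skew (ι s) ξ ζ
    rw [← hy] at h1
    have h2 := h0 y
    exact neg_eq_zero.1 (h1.symm.trans h2)

theorem IsIntegralManifold.exists_sharp_eq (h : IsIntegralManifold (F := F) P ι) {s : S}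
    (u : TangentSpace 𝓘(ℝ, F) s) :
    ∃ ξ : Cotan E (ι s), P.sharp (ι s) ξ = mfderiv 𝓘(ℝ, F) 𝓘(ℝ, E) ι s u := by
  have hy : mfderiv 𝓘(ℝ, F) 𝓘(ℝ, E) ι s u ∈ LinearMap.range (P.sharp (ι s)).toLinearMap := by
    rw [← h.range_eq s]
    exact ⟨u, rfl⟩
  exact hy

/-- Frees `leafFlat` from the choice made in its definition: two covectors with the same image under
ϖ♯ differ by an element of the kernel, which annihilates the leaf. -/
theorem IsIntegralManifold.leafFlat_apply (h : IsIntegralManifold (F := F) P ι) {s : S}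
    {u : TangentSpace 𝓘(ℝ, F) s} {ξ : Cotan E (ι s)}
    (hξ : P.sharp (ι s) ξ = mfderiv 𝓘(ℝ, F) 𝓘(ℝ, E) ι s u) (y : TangentSpace 𝓘(ℝ, F) s) :
    leafFlat P ι s u y = ξ (mfderiv 𝓘(ℝ, F) 𝓘(ℝ, E) ι s y) := by
  have h1 := Classical.epsilon_spec (h.exists_sharp_eq u)
  set ξ' := Classical.epsilon fun ξ : Cotan E (ι s) =>
    P.sharp (ι s) ξ = mfderiv 𝓘(ℝ, F) 𝓘(ℝ, E) ι s u
  have h2 : P.sharp (ι s) (ξ' - ξ) = 0 := by rw [map_sub, h1, hξ, sub_self]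
  have h3 := h.sharp_eq_zero_iff.1 h2 y
  exact sub_eq_zero.1 h3

theorem IsIntegralManifold.exists_tangent_eq (h : IsIntegralManifold (F := F) P ι) {s : S}
    (ξ : Cotan E (ι s)) :
    ∃ u, mfderiv 𝓘(ℝ, F) 𝓘(ℝ, E) ι s u = P.sharp (ι s) ξ := by
  have hy : P.sharp (ι s) ξ ∈ LinearMap.range (mfderiv 𝓘(ℝ, F) 𝓘(ℝ, E) ι s).toLinearMap := by
    rw [h.range_eq s]
    exact ⟨ξ, rfl⟩
  exact hy

end LeafForm

/-! ### The exact sequence L_X → E_X → TX and the duality of E_X and E_X* -/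

namespace LagrangianInLeaf

variable {E F G : Type*}
  [NormedAddCommGroup E] [NormedSpace ℝ E]
  [NormedAddCommGroup F] [NormedSpace ℝ F]
  [NormedAddCommGroup G] [NormedSpace ℝ G]
  {Z : Type u} [TopologicalSpace Z] [ChartedSpace E Z]
  {S : Type*} [TopologicalSpace S] [ChartedSpace F S]
  {X : Type*} [TopologicalSpace X] [ChartedSpace G X]
  (D : LagrangianInLeaf E F G Z S X)

theorem TS_injective (x : X) : Function.Injective (D.TS x) := D.leaf.immersion _

theorem TXZ_injective (x : X) : Function.Injective (D.TXZ x) :=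
  (D.TS_injective x).comp (D.immersion x)

theorem mem_LX_iff_sharp {x : X} {ξ : Cotan E (D.pt x)} :
    ξ ∈ D.LX x ↔ D.P.sharp (D.pt x) ξ = 0 :=
  (D.leaf.toIsIntegralManifold.sharp_eq_zero_iff (s := D.iX x)).symm

/-- Write ϖ♯ξ = Ti_S y. Then ω♭ y = ξ ∘ Ti_S vanishes on TX, so y lies in TX because TX contains its
own orthogonal. -/
theorem exists_TXZ_eq {x : X} (ξ : D.EX x) :
    ∃ u, D.TXZ x u = -D.P.sharp (D.pt x) (ξ : Cotan E (D.pt x)) := by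
  obtain ⟨y, hy⟩ := D.leaf.toIsIntegralManifold.exists_tangent_eq (s := D.iX x)
    (ξ : Cotan E (D.pt x))
  obtain ⟨u, hu⟩ := (D.lagrangian x y).2 fun v =>
    (D.leaf.toIsIntegralManifold.leafFlat_apply hy.symm _).trans (ξ.2 v)
  refine ⟨-u, ?_⟩
  rw [map_neg, neg_inj]
  exact (congrArg (D.TS x) hu).trans hy

/-- The anchor `-w♯ : E_X → TX`. -/
def rho (x : X) : D.EX x →ₗ[ℝ] TangentSpace 𝓘(ℝ, G) x where
  toFun ξ := (D.exists_TXZ_eq ξ).choose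
  map_add' ξ ζ := D.TXZ_injective x (by
    rw [map_add, (D.exists_TXZ_eq ξ).choose_spec, (D.exists_TXZ_eq ζ).choose_spec,
      (D.exists_TXZ_eq (ξ + ζ)).choose_spec, Submodule.coe_add, map_add, neg_add])
  map_smul' c ξ := D.TXZ_injective x (by
    rw [map_smul, (D.exists_TXZ_eq ξ).choose_spec, (D.exists_TXZ_eq (c • ξ)).choose_spec,
      Submodule.coe_smul, map_smul, RingHom.id_apply, smul_neg])

theorem TXZ_rho {x : X} (ξ : D.EX x) :
    D.TXZ x (D.rho x ξ) = -D.P.sharp (D.pt x) (ξ : Cotan E (D.pt x)) :=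
  (D.exists_TXZ_eq ξ).choose_spec

theorem rho_eq_zero_iff {x : X} {ξ : D.EX x} :
    D.rho x ξ = 0 ↔ (ξ : Cotan E (D.pt x)) ∈ D.LX x := by
  rw [D.mem_LX_iff_sharp, ← (D.TXZ_injective x).eq_iff, map_zero, D.TXZ_rho, neg_eq_zero]

theorem rho_LtoE {x : X} (ξ : D.LX x) : D.rho x (D.LtoE x ξ) = 0 :=
  D.rho_eq_zero_iff.2 ξ.2

theorem flatX_rho {x : X} (ξ : D.EX x) (y : TangentSpace 𝓘(ℝ, F) (D.iX x)) :
    D.flatX x (D.rho x ξ) y = -(ξ : Cotan E (D.pt x)) (D.TS x y) := by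
  have h := D.leaf.toIsIntegralManifold.leafFlat_apply (s := D.iX x)
    (u := D.TX x (D.rho x ξ)) (ξ := -(ξ : Cotan E (D.pt x)))
    ((map_neg _ _).trans (D.TXZ_rho ξ).symm) y
  exact h

/-- Here the other half of the Lagrangian condition is used: TX is isotropic, so any ξ with ϖ♯ξ = u
annihilates TX and belongs to E_X. -/
theorem rho_surjective (x : X) : Function.Surjective (D.rho x) := by
  intro u
  obtain ⟨ξ, hξ⟩ := D.leaf.toIsIntegralManifold.exists_sharp_eq (s := D.iX x) (D.TX x u)
  have h0 : ∀ v, ξ (D.TXZ x v) = 0 := fun v =>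
    (D.leaf.toIsIntegralManifold.leafFlat_apply hξ (D.TX x v)).symm.trans
      ((D.lagrangian x (D.TX x u)).1 ⟨u, rfl⟩ v)
  refine ⟨-⟨ξ, h0⟩, D.TXZ_injective x ?_⟩
  rw [D.TXZ_rho, Submodule.coe_neg, map_neg, neg_neg]
  exact hξ

/-- Translates the occurrences of -ω♭_X in the formulas into the anchor: the class [y] =
(j♯₀)⁻¹(-ω♭_X u) is characterised by ρ(j♯[Ti_S y]) = u. -/
theorem rho_eq_iff {x : X} {ξ : D.EX x} {u : TangentSpace 𝓘(ℝ, G) x} :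
    D.rho x ξ = u ↔ (D.restrS x ξ : Cotan F (D.iX x)) = -D.flatX x u := by
  constructor
  · rintro rfl
    ext y
    change (ξ : Cotan E (D.pt x)) (D.TS x y) = -D.flatX x (D.rho x ξ) y
    rw [D.flatX_rho, neg_neg]
  · intro h
    obtain ⟨ζ, rfl⟩ := D.rho_surjective x u
    rw [← sub_eq_zero, ← map_sub, D.rho_eq_zero_iff]
    intro y
    have h1 : (ξ : Cotan E (D.pt x)) (D.TS x y) = -D.flatX x (D.rho x ζ) y :=
      DFunLike.congr_fun h y
    rw [D.flatX_rho, neg_neg] at h1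
    exact sub_eq_zero.2 h1

theorem neg_flatX_mem_annS (x : X) (u : TangentSpace 𝓘(ℝ, G) x) : -D.flatX x u ∈ D.annS x := by
  obtain ⟨ξ, rfl⟩ := D.rho_surjective x u
  rw [← D.rho_eq_iff.1 rfl]
  exact (D.restrS x ξ).2

theorem restrS_eq_zero_iff {x : X} {ξ : D.EX x} :
    D.restrS x ξ = 0 ↔ (ξ : Cotan E (D.pt x)) ∈ D.LX x := by
  constructor
  · intro h y
    exact DFunLike.congr_fun (congrArg Subtype.val h) y
  · intro h
    apply Subtype.ext
    ext y
    exact h y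

theorem pairing_toEStar {x : X} (ξ : D.EX x) (v : TangentSpace 𝓘(ℝ, E) (D.pt x)) :
    D.pairing x ξ (D.toEStar x v) = (ξ : Cotan E (D.pt x)) v := rfl

theorem toEStar_surjective (x : X) : Function.Surjective (D.toEStar x) :=
  Submodule.mkQ_surjective _

theorem toEStar_eq_zero_iff {x : X} {v : TangentSpace 𝓘(ℝ, E) (D.pt x)} :
    D.toEStar x v = 0 ↔ ∃ u, D.TXZ x u = v :=
  Submodule.Quotient.mk_eq_zero _

variable [FiniteDimensional ℝ E]

theorem sharp_apply (j : ∀ x, LinearMap.BilinForm ℝ (D.EStar x)) {x : X} (q : D.EStar x)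
    (v : TangentSpace 𝓘(ℝ, E) (D.pt x)) :
    (D.sharp j x q : Cotan E (D.pt x)) v = j x q (D.toEStar x v) := rfl

theorem pairing_sharp (j : ∀ x, LinearMap.BilinForm ℝ (D.EStar x)) {x : X} (q q' : D.EStar x) :
    D.pairing x (D.sharp j x q) q' = j x q q' := by
  obtain ⟨v, rfl⟩ := D.toEStar_surjective x q'
  rfl

/-- `E_X` is the dual of `E_X*`. -/
def pairingEquiv (x : X) : D.EX x ≃ₗ[ℝ] Module.Dual ℝ (D.EStar x) where
  toFun := D.pairing x
  map_add' ξ ζ := by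
    ext v
    rfl
  map_smul' c ξ := by
    ext v
    rfl
  invFun l := ⟨toCotan (l ∘ₗ D.toEStar x), fun u => by
    change l (D.toEStar x (D.TXZ x u)) = 0
    rw [D.toEStar_eq_zero_iff.2 ⟨u, rfl⟩, map_zero]⟩
  left_inv ξ := by
    apply Subtype.ext
    ext v
    rfl
  right_inv l := by
    ext v
    rfl

theorem pairingEquiv_apply {x : X} (ξ : D.EX x) : D.pairingEquiv x ξ = D.pairing x ξ := rfl

instance (x : X) : FiniteDimensional ℝ (D.EStar x) :=
  inferInstanceAs (FiniteDimensional ℝ (TangentSpace 𝓘(ℝ, E) (D.pt x) ⧸ _))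

theorem finrank_EStar (x : X) : Module.finrank ℝ (D.EStar x) = Module.finrank ℝ (D.EX x) := by
  rw [(D.pairingEquiv x).finrank_eq, Subspace.dual_finrank_eq]

theorem EStar_eq_zero {x : X} {q : D.EStar x} (h : ∀ ξ, D.pairing x ξ q = 0) : q = 0 := by
  rw [← Module.forall_dual_apply_eq_zero_iff ℝ]
  intro l
  obtain ⟨ξ, rfl⟩ := (D.pairingEquiv x).surjective l
  exact h ξ

/-- Finite-dimensional biduality: a vector outside TS would be detected by a covector in L_X. -/
theorem exists_TS_eq {x : X} {v : TangentSpace 𝓘(ℝ, E) (D.pt x)}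
    (h : ∀ ζ ∈ D.LX x, ζ v = 0) : ∃ y, D.TS x y = v := by
  by_contra hv
  obtain ⟨ξ, h1, h2⟩ := exists_cotan_of_notMem
    (p := LinearMap.range (D.TS x).toLinearMap) (v := v) hv
  exact h2 (h ξ fun y => h1 _ ⟨y, rfl⟩)

/-- A linear left inverse of the injective map Ti_S extends covectors of S to covectors of Z. -/
theorem exists_restrS_eq {x : X} (τ : D.annS x) : ∃ ξ, D.restrS x ξ = τ := by
  obtain ⟨g, hg⟩ := (D.TS x).toLinearMap.exists_leftInverse_of_injective
    (LinearMap.ker_eq_bot.2 (D.TS_injective x))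
  have hg' : ∀ y, g (D.TS x y) = y := fun y => DFunLike.congr_fun hg y
  have key : ∀ y, toCotan ((τ : Cotan F (D.iX x)).toLinearMap ∘ₗ g) (D.TS x y) =
      (τ : Cotan F (D.iX x)) y := fun y => congrArg (τ : Cotan F (D.iX x)) (hg' y)
  refine ⟨⟨toCotan ((τ : Cotan F (D.iX x)).toLinearMap ∘ₗ g), fun u => ?_⟩, ?_⟩
  · exact (key _).trans (τ.2 u)
  · apply Subtype.ext
    ext y
    exact key y

end LagrangianInLeaf

/-! ### Linear algebra of the η-orthogonal splitting of E_X -/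

namespace LagrangianInLeaf

section Algebra

variable {E F G : Type*}
  [NormedAddCommGroup E] [NormedSpace ℝ E]
  [NormedAddCommGroup F] [NormedSpace ℝ F]
  [NormedAddCommGroup G] [NormedSpace ℝ G]
  {Z : Type u} [TopologicalSpace Z] [ChartedSpace E Z]
  {S : Type*} [TopologicalSpace S] [ChartedSpace F S]
  {X : Type*} [TopologicalSpace X] [ChartedSpace G X]
  (D : LagrangianInLeaf E F G Z S X) {η : ∀ x, LinearMap.BilinForm ℝ (D.EX x)}

theorem EX_map_sub {x : X} {M : Type*} [AddCommGroup M] [Module ℝ M] (f : D.EX x →ₗ[ℝ] M)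
    (ξ ζ : D.EX x) : f (ξ - ζ) = f ξ - f ζ := map_sub f ξ ζ

theorem EX_sub_zero {x : X} (ξ : D.EX x) : ξ - 0 = ξ := sub_zero ξ

theorem EX_sub_self {x : X} (ξ : D.EX x) : ξ - ξ = 0 := sub_self ξ

theorem EX_sub_add_cancel {x : X} (ξ ζ : D.EX x) : ξ - ζ + ζ = ξ := sub_add_cancel ξ ζ

theorem eta_sub_left {x : X} (ξ ζ θ : D.EX x) : η x (ξ - ζ) θ = η x ξ θ - η x ζ θ :=
  DFunLike.congr_fun (map_sub (η x) ξ ζ) θ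

theorem restrictL_apply {x : X} (ξ ζ : D.LX x) :
    D.restrictL η x ξ ζ = η x (D.LtoE x ξ) (D.LtoE x ζ) := rfl

/-- Two elements with the same anchor differ by an element of L_X; if they also have the same
products with L_X, this difference is orthogonal to L_X and vanishes by nondegeneracy there. All
later uniqueness and linearity statements for lifts come from this. -/
theorem eq_of_rho_eq_of_eq {D : LagrangianInLeaf E F G Z S X} {η : ∀ x, LinearMap.BilinForm ℝ (D.EX x)}
    {x : X} (hL : ∀ ξ, (∀ ζ, D.restrictL η x ξ ζ = 0) → ξ = 0)
    {w w' : D.EX x} (hw : ∀ ζ, η x w (D.LtoE x ζ) = η x w' (D.LtoE x ζ))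
    (h : D.rho x w = D.rho x w') : w = w' := by
  rw [← sub_eq_zero, ← map_sub, D.rho_eq_zero_iff] at h
  have h1 := hL ⟨_, h⟩ fun ζ => by
    change η x (w - w') (D.LtoE x ζ) = 0
    rw [eta_sub_left, hw, sub_self]
  have h2 : w - w' = 0 := Subtype.ext (congrArg (fun l : D.LX x => (l : Cotan E (D.pt x))) h1)
  exact sub_eq_zero.1 h2

theorem eq_of_rho_eq {D : LagrangianInLeaf E F G Z S X} {η : ∀ x, LinearMap.BilinForm ℝ (D.EX x)}
    {x : X} (hL : ∀ ξ, (∀ ζ, D.restrictL η x ξ ζ = 0) → ξ = 0)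
    {w w' : D.EX x} (hw : ∀ ζ, η x w (D.LtoE x ζ) = 0) (hw' : ∀ ζ, η x w' (D.LtoE x ζ) = 0)
    (h : D.rho x w = D.rho x w') : w = w' :=
  eq_of_rho_eq_of_eq hL (fun ζ => (hw ζ).trans (hw' ζ).symm) h

variable [FiniteDimensional ℝ E] {j : ∀ x, LinearMap.BilinForm ℝ (D.EStar x)}

theorem sharp0_mk {x : X} (y : TangentSpace 𝓘(ℝ, F) (D.iX x)) :
    D.sharp0 j x (Submodule.Quotient.mk y) = D.restrS x (D.sharp j x (D.toEStar x (D.TS x y))) :=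
  rfl

theorem IsInverse.sharp_injective {D : LagrangianInLeaf E F G Z S X}
    {j : ∀ x, LinearMap.BilinForm ℝ (D.EStar x)} {η : ∀ x, LinearMap.BilinForm ℝ (D.EX x)}
    (h : D.IsInverse j η) (x : X) : Function.Injective (D.sharp j x) := by
  rw [injective_iff_map_eq_zero]
  intro q hq
  refine D.EStar_eq_zero fun ξ => ?_
  rw [← h x q ξ, hq, map_zero, LinearMap.zero_apply]

/-- The condition `IsInverse` gives injectivity of j♯ directly; surjectivity follows since E_X and
E_X* have equal dimension. -/
theorem IsInverse.sharp_bijective {D : LagrangianInLeaf E F G Z S X}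
    {j : ∀ x, LinearMap.BilinForm ℝ (D.EStar x)} {η : ∀ x, LinearMap.BilinForm ℝ (D.EX x)}
    (h : D.IsInverse j η) (x : X) : Function.Bijective (D.sharp j x) :=
  ⟨h.sharp_injective x, (LinearMap.injective_iff_surjective_of_finrank_eq_finrank
    (K := ℝ) (V := D.EStar x) (V₂ := D.EX x) (D.finrank_EStar x)).1 (h.sharp_injective x)⟩

variable {D}

/-- With `exists_sharp_TS_eq` this shows that j♯ maps the image of TS in E_X* exactly onto the
η-orthogonal of L_X. -/
theorem IsInverse.sharp_TS_orthogonal (h : D.IsInverse j η) {x : X}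
    (y : TangentSpace 𝓘(ℝ, F) (D.iX x)) (ζ : D.LX x) :
    η x (D.sharp j x (D.toEStar x (D.TS x y))) (D.LtoE x ζ) = 0 := by
  rw [h, D.pairing_toEStar]
  exact ζ.2 y

theorem IsInverse.exists_sharp_TS_eq (h : D.IsInverse j η) {x : X} {w : D.EX x}
    (hw : ∀ ζ, η x w (D.LtoE x ζ) = 0) : ∃ y, D.sharp j x (D.toEStar x (D.TS x y)) = w := by
  obtain ⟨q, rfl⟩ := (h.sharp_bijective x).2 w
  obtain ⟨v, rfl⟩ := D.toEStar_surjective x q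
  obtain ⟨y, rfl⟩ := D.exists_TS_eq (x := x) (v := v) fun ζ hζ => by
    have := hw ⟨ζ, hζ⟩
    rw [h] at this
    exact this
  exact ⟨y, rfl⟩

/-- If the restriction of `η` to `L_X` is nondegenerate, then `E_X` is the sum of `L_X` and its
orthogonal. -/
theorem exists_orthogonal {x : X} (hL : ∀ ξ, (∀ ζ, D.restrictL η x ξ ζ = 0) → ξ = 0)
    (w : D.EX x) : ∃ l, ∀ ζ, η x (w - D.LtoE x l) (D.LtoE x ζ) = 0 := by
  have hinj : Function.Injective (D.restrictL η x) := by
    rw [injective_iff_map_eq_zero]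
    exact fun ξ hξ => hL ξ fun ζ => by rw [hξ, LinearMap.zero_apply]
  -- Nondegeneracy identifies L_X with its dual, and `l` represents the functional η(w, ·) on L_X.
  obtain ⟨l, hl⟩ := (LinearMap.injective_iff_surjective_of_finrank_eq_finrank
    (K := ℝ) (V := D.LX x) (V₂ := Module.Dual ℝ (D.LX x)) (Subspace.dual_finrank_eq (K := ℝ) (V := D.LX x)).symm).1 hinj (η x w ∘ₗ D.LtoE x)
  refine ⟨l, fun ζ => ?_⟩
  have h1 : η x (D.LtoE x l) (D.LtoE x ζ) = η x w (D.LtoE x ζ) := DFunLike.congr_fun hl ζ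
  rw [eta_sub_left, h1, sub_self]

/-- The map j♯₀ is j♯ on TS/TX, an injection onto L_X^⊥, followed by the restriction to TS, whose
kernel is L_X. Its kernel is thus L_X ∩ L_X^⊥; if this is zero, any lift of a covector of S can be
moved into L_X^⊥ by subtracting an element of L_X. -/
theorem IsInverse.sharp0_bijective_iff (h : D.IsInverse j η) (x : X) :
    Function.Bijective (D.sharp0 j x) ↔ ∀ ξ, (∀ ζ, D.restrictL η x ξ ζ = 0) → ξ = 0 := by
  constructor
  · intro hb ξ hξ
    obtain ⟨y, hy⟩ := h.exists_sharp_TS_eq (w := D.LtoE x ξ) hξ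
    have h0 : D.sharp0 j x (Submodule.Quotient.mk y) = 0 := by
      rw [D.sharp0_mk, hy]
      exact D.restrS_eq_zero_iff.2 ξ.2
    have h1 : (Submodule.Quotient.mk y : D.QS x) = 0 := hb.1 (h0.trans (map_zero _).symm)
    rw [Submodule.Quotient.mk_eq_zero] at h1
    obtain ⟨u, hu⟩ := h1
    have h2 : D.toEStar x (D.TS x y) = 0 :=
      D.toEStar_eq_zero_iff.2 ⟨u, congrArg (D.TS x) hu⟩
    rw [h2, map_zero] at hy
    exact Subtype.ext (congrArg (fun l : D.EX x => (l : Cotan E (D.pt x))) hy.symm)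
  · intro hL
    constructor
    · rw [injective_iff_map_eq_zero]
      intro q hq
      obtain ⟨y, rfl⟩ := Submodule.Quotient.mk_surjective _ q
      rw [D.sharp0_mk, D.restrS_eq_zero_iff, ← D.rho_eq_zero_iff] at hq
      have h1 := eq_of_rho_eq hL (h.sharp_TS_orthogonal y) (w' := 0)
        (fun ζ => by rw [map_zero, LinearMap.zero_apply]) (hq.trans (map_zero _).symm)
      have h2 := h.sharp_injective x (h1.trans (map_zero _).symm)
      obtain ⟨u, hu⟩ := D.toEStar_eq_zero_iff.1 h2
      rw [Submodule.Quotient.mk_eq_zero]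
      exact ⟨u, D.TS_injective x hu⟩
    · intro τ
      obtain ⟨w, hw⟩ := D.exists_restrS_eq τ
      obtain ⟨l, hl⟩ := exists_orthogonal hL w
      obtain ⟨y, hy⟩ := h.exists_sharp_TS_eq hl
      refine ⟨Submodule.Quotient.mk y, ?_⟩
      have h1 : D.restrS x (w - D.LtoE x l) = D.restrS x w - D.restrS x (D.LtoE x l) :=
        map_sub (D.restrS x) w (D.LtoE x l)
      have h2 : D.restrS x (D.LtoE x l) = 0 := D.restrS_eq_zero_iff.2 l.2
      rw [D.sharp0_mk, hy, h1, hw, h2]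
      exact sub_zero τ

variable (D) in
/-- The triple `t` is the one obtained from the `η`-orthogonal splitting of `E_X`. -/
structure IsOrthogonalTriple (η : ∀ x, LinearMap.BilinForm ℝ (D.EX x)) (t : D.Triple) : Prop where
  rho_connection : ∀ x u, D.rho x (t.α x u) = u
  orthogonal : ∀ x u ζ, η x (t.α x u) (D.LtoE x ζ) = 0
  metric : ∀ x u v, t.γ x u v = η x (t.α x u) (t.α x v)
  scalar : t.χ = D.restrictL η

/-- The condition on y says that j♯[Ti_S y] has anchor u, and this element is orthogonal to L_X, so
it is the unique orthogonal lift of u. For the metric, -ω♭_X(v)(y) = α(v)(Ti_S y), which is η(α(u),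
α(v)) because η♭ inverts j♯. -/
theorem IsInverse.isTripleOf_iff (h : D.IsInverse j η)
    (hL : ∀ x ξ, (∀ ζ, D.restrictL η x ξ ζ = 0) → ξ = 0) {t : D.Triple} :
    D.IsTripleOf j η t ↔ D.IsOrthogonalTriple η t := by
  have hb := fun x => (h.sharp0_bijective_iff x).2 (hL x)
  have hex : ∀ x u, ∃ y, D.sharp0 j x (Submodule.Quotient.mk y) =
      ⟨-D.flatX x u, D.neg_flatX_mem_annS x u⟩ := fun x u => by
    obtain ⟨q, hq⟩ := (hb x).2 ⟨-D.flatX x u, D.neg_flatX_mem_annS x u⟩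
    obtain ⟨y, rfl⟩ := Submodule.Quotient.mk_surjective _ q
    exact ⟨y, hq⟩
  constructor
  · intro ht
    have hrho : ∀ x u, D.rho x (t.α x u) = u := fun x u => by
      obtain ⟨y, hy⟩ := hex x u
      have hy := congrArg Subtype.val hy
      rw [D.rho_eq_iff, ht.connection x u y hy]
      exact hy
    refine ⟨hrho, fun x u ζ => ?_, fun x u v => ?_, ht.scalar⟩
    · obtain ⟨y, hy⟩ := hex x u
      rw [ht.connection x u y (congrArg Subtype.val hy), h.sharp_TS_orthogonal]
    · obtain ⟨y, hy⟩ := hex x u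
      have hy := congrArg Subtype.val hy
      rw [ht.metric x u y hy, ht.connection x u y hy, h, D.pairing_toEStar]
      have h1 := D.flatX_rho (t.α x v) y
      rw [hrho] at h1
      rw [h1, neg_neg]
  · intro ht
    have key : ∀ (x : X) (u : TangentSpace 𝓘(ℝ, G) x) (y : TangentSpace 𝓘(ℝ, F) (D.iX x)),
        (D.sharp0 j x (Submodule.Quotient.mk y) : Cotan F (D.iX x)) = -D.flatX x u →
        t.α x u = D.sharp j x (D.toEStar x (D.TS x y)) := fun x u y hy =>
      eq_of_rho_eq (hL x) (ht.orthogonal x u) (h.sharp_TS_orthogonal y)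
        ((ht.rho_connection x u).trans (D.rho_eq_iff.2 hy).symm)
    refine ⟨hb, fun x u y hy v => ?_, key, ht.scalar⟩
    rw [ht.metric, key x u y hy, h, D.pairing_toEStar]
    have h1 := D.flatX_rho (t.α x v) y
    rw [ht.rho_connection] at h1
    rw [h1, neg_neg]

theorem exists_isOrthogonalTriple (hL : ∀ x ξ, (∀ ζ, D.restrictL η x ξ ζ = 0) → ξ = 0) :
    ∃ t, D.IsOrthogonalTriple η t := by
  have hex : ∀ x u, ∃ w, D.rho x w = u ∧ ∀ ζ, η x w (D.LtoE x ζ) = 0 := fun x u => by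
    obtain ⟨w, rfl⟩ := D.rho_surjective x u
    obtain ⟨l, hl⟩ := exists_orthogonal (hL x) w
    exact ⟨w - D.LtoE x l, by rw [D.EX_map_sub, D.rho_LtoE, sub_zero], hl⟩
  choose a ha using hex
  -- The orthogonal lift is linear because it is unique: sums and multiples of lifts are again
  -- orthogonal lifts.
  let α : ∀ x, TangentSpace 𝓘(ℝ, G) x →ₗ[ℝ] D.EX x := fun x =>
    { toFun := a x
      map_add' := fun u v => eq_of_rho_eq (hL x) (ha x _).2
        (fun ζ => by rw [map_add, LinearMap.add_apply, (ha x u).2, (ha x v).2, add_zero])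
        (by rw [map_add, (ha x _).1, (ha x _).1, (ha x _).1])
      map_smul' := fun c u => eq_of_rho_eq (hL x) (ha x _).2
        (fun ζ => by rw [map_smul, LinearMap.smul_apply, RingHom.id_apply, (ha x u).2, smul_zero])
        (by rw [map_smul, (ha x _).1, (ha x _).1, RingHom.id_apply]) }
  exact ⟨⟨fun x => (η x).compl₁₂ (α x) (α x), α, D.restrictL η⟩, fun x u => (ha x u).1,
    fun x u => (ha x u).2, fun _ _ _ => rfl, rfl⟩

theorem IsOrthogonalTriple.unique (hL : ∀ x ξ, (∀ ζ, D.restrictL η x ξ ζ = 0) → ξ = 0)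
    {t t' : D.Triple} (h : D.IsOrthogonalTriple η t) (h' : D.IsOrthogonalTriple η t') :
    t = t' := by
  have hα : t.α = t'.α := by
    funext x
    ext1 u
    exact eq_of_rho_eq (hL x) (h.orthogonal x u) (h'.orthogonal x u)
      ((h.rho_connection x u).trans (h'.rho_connection x u).symm)
  refine Triple.ext ?_ hα (h.scalar.trans h'.scalar.symm)
  funext x
  ext u v
  rw [h.metric, h'.metric, hα]

variable (D) in
/-- The projection of `E_X` to `L_X` defined by a splitting of the anchor. -/
def projL {α : ∀ x, TangentSpace 𝓘(ℝ, G) x →ₗ[ℝ] D.EX x} (hα : ∀ x u, D.rho x (α x u) = u)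
    (x : X) : D.EX x →ₗ[ℝ] D.LX x where
  toFun ξ := ⟨(ξ - α x (D.rho x ξ) : D.EX x), D.rho_eq_zero_iff.1 (by
    rw [D.EX_map_sub, hα, sub_self])⟩
  map_add' ξ ζ := by
    apply Subtype.ext
    simp only [map_add, Submodule.coe_sub, Submodule.coe_add]
    abel
  map_smul' c ξ := by
    apply Subtype.ext
    simp only [map_smul, Submodule.coe_sub, Submodule.coe_smul, RingHom.id_apply, smul_sub]

theorem LtoE_projL {α : ∀ x, TangentSpace 𝓘(ℝ, G) x →ₗ[ℝ] D.EX x}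
    (hα : ∀ x u, D.rho x (α x u) = u) {x : X} (ξ : D.EX x) :
    D.LtoE x (D.projL hα x ξ) = ξ - α x (D.rho x ξ) := rfl

theorem projL_LtoE {α : ∀ x, TangentSpace 𝓘(ℝ, G) x →ₗ[ℝ] D.EX x}
    (hα : ∀ x u, D.rho x (α x u) = u) {x : X} (ξ : D.LX x) :
    D.projL hα x (D.LtoE x ξ) = ξ := by
  apply Submodule.inclusion_injective (D.LX_le_EX x)
  change D.LtoE x _ = D.LtoE x _
  rw [LtoE_projL, D.rho_LtoE, map_zero, D.EX_sub_zero]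

theorem projL_splitting {α : ∀ x, TangentSpace 𝓘(ℝ, G) x →ₗ[ℝ] D.EX x}
    (hα : ∀ x u, D.rho x (α x u) = u) {x : X} (u : TangentSpace 𝓘(ℝ, G) x) :
    D.projL hα x (α x u) = 0 := by
  apply Submodule.inclusion_injective (D.LX_le_EX x)
  change D.LtoE x _ = D.LtoE x _
  rw [LtoE_projL, hα, D.EX_sub_self, map_zero]

/-- In terms of its orthogonal triple, `η` is the sum of the pull-backs of `γ` and `χ`. -/
theorem IsOrthogonalTriple.eta_apply {t : D.Triple} (h : D.IsOrthogonalTriple η t)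
    (hsymm : ∀ x ξ ζ, η x ξ ζ = η x ζ ξ) {x : X} (ξ ζ : D.EX x) :
    η x ξ ζ = t.γ x (D.rho x ξ) (D.rho x ζ) +
      t.χ x (D.projL h.rho_connection x ξ) (D.projL h.rho_connection x ζ) := by
  -- In the decomposition of E_X as α(TX) ⊕ L_X the mixed terms vanish, one by orthogonality and the
  -- other by symmetry as well.
  have e : ∀ ξ : D.EX x, ξ = t.α x (D.rho x ξ) + D.LtoE x (D.projL h.rho_connection x ξ) :=
    fun ξ => by rw [LtoE_projL, add_comm, D.EX_sub_add_cancel]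
  rw [h.metric, h.scalar, restrictL_apply]
  conv_lhs => rw [e ξ, e ζ]
  simp only [map_add, LinearMap.add_apply, h.orthogonal]
  rw [hsymm x (D.LtoE x _) (t.α x _), h.orthogonal]
  ring

/-- One direction restricts η to the two summands. For the other, η is the sum of γ and χ evaluated
on the components of ξ, at least one of which is nonzero. -/
theorem IsOrthogonalTriple.posDef_iff {t : D.Triple} (h : D.IsOrthogonalTriple η t)
    (hsymm : ∀ x ξ ζ, η x ξ ζ = η x ζ ξ) (x : X) :
    (∀ ξ, ξ ≠ 0 → 0 < η x ξ ξ) ↔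
      (∀ u, u ≠ 0 → 0 < t.γ x u u) ∧ ∀ ξ, ξ ≠ 0 → 0 < t.χ x ξ ξ := by
  constructor
  · intro hp
    refine ⟨fun u hu => ?_, fun ξ hξ => ?_⟩
    · rw [h.metric]
      refine hp _ fun h0 => hu ?_
      rw [← h.rho_connection x u, h0, map_zero]
    · rw [h.scalar]
      exact hp _ fun h0 => hξ (Subtype.ext
        (congrArg (fun l : D.EX x => (l : Cotan E (D.pt x))) h0))
  · rintro ⟨h1, h2⟩ ξ hξ
    rw [h.eta_apply hsymm]
    by_cases hr : D.rho x ξ = 0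
    · rw [hr, map_zero, zero_add]
      refine h2 _ fun h0 => hξ ?_
      have := LtoE_projL h.rho_connection ξ
      rw [h0, hr, map_zero, map_zero, D.EX_sub_zero] at this
      exact this.symm
    · by_cases hl : D.projL h.rho_connection x ξ = 0
      · rw [hl, map_zero, add_zero]
        exact h1 _ hr
      · exact add_pos (h1 _ hr) (h2 _ hl)

/-- A nondegenerate field of forms on `E_X` has an inverse. -/
theorem exists_isInverse (hη : ∀ x ξ, (∀ ζ, η x ξ ζ = 0) → ξ = 0) :
    ∃ j, D.IsInverse j η := by
  have hinj : ∀ x, Function.Injective (η x) := fun x => by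
    rw [injective_iff_map_eq_zero]
    exact fun ξ hξ => hη x ξ fun ζ => by rw [hξ, LinearMap.zero_apply]
  let e : ∀ x, D.EX x ≃ₗ[ℝ] Module.Dual ℝ (D.EX x) := fun x =>
    LinearEquiv.ofBijective (η x) ⟨hinj x, (LinearMap.injective_iff_surjective_of_finrank_eq_finrank
      (K := ℝ) (V := D.EX x) (V₂ := Module.Dual ℝ (D.EX x)) (Subspace.dual_finrank_eq (K := ℝ) (V := D.EX x)).symm).1 (hinj x)⟩
  let j : ∀ x, LinearMap.BilinForm ℝ (D.EStar x) := fun x =>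
    (D.pairingEquiv x).toLinearMap ∘ₗ (e x).symm.toLinearMap ∘ₗ
      (D.pairingEquiv x).toLinearMap.flip
  refine ⟨j, fun x q ξ => ?_⟩
  have h1 : D.sharp j x q = (e x).symm ((D.pairingEquiv x).toLinearMap.flip q) := by
    apply (D.pairingEquiv x).injective
    refine LinearMap.ext fun q' => ?_
    rw [D.pairingEquiv_apply, D.pairing_sharp]
    rfl
  rw [h1]
  exact DFunLike.congr_fun ((e x).apply_symm_apply ((D.pairingEquiv x).toLinearMap.flip q)) ξ

theorem IsInverse.unique_right {η' : ∀ x, LinearMap.BilinForm ℝ (D.EX x)}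
    (h : D.IsInverse j η) (h' : D.IsInverse j η') : η' = η := by
  funext x
  refine LinearMap.ext fun ξ => ?_
  obtain ⟨q, rfl⟩ := (h.sharp_bijective x).2 ξ
  refine LinearMap.ext fun ζ => ?_
  rw [h, h']

/-- The inverse of an invertible `j♯`. -/
theorem exists_inverse_of_bijective (hj : ∀ x, Function.Bijective (D.sharp j x)) :
    ∃ η, D.IsInverse j η := by
  let e := fun x => LinearEquiv.ofBijective (D.sharp j x) (hj x)
  refine ⟨fun x => ((D.pairingEquiv x).toLinearMap.flip) ∘ₗ (e x).symm.toLinearMap,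
    fun x q ξ => ?_⟩
  have h1 : (e x).symm (D.sharp j x q) = q := (e x).symm_apply_apply q
  change D.pairing x ξ ((e x).symm (D.sharp j x q)) = _
  rw [h1]

theorem IsInverse.symm (h : D.IsInverse j η) (hj : ∀ x q q', j x q q' = j x q' q) (x : X)
    (ξ ζ : D.EX x) : η x ξ ζ = η x ζ ξ := by
  obtain ⟨q, rfl⟩ := (h.sharp_bijective x).2 ξ
  obtain ⟨q', rfl⟩ := (h.sharp_bijective x).2 ζ
  rw [h, h, D.pairing_sharp, D.pairing_sharp, hj]

theorem IsInverse.nondegenerate (h : D.IsInverse j η) (x : X)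
    (ξ : D.EX x) (hξ : ∀ ζ, η x ξ ζ = 0) : ξ = 0 := by
  obtain ⟨q, rfl⟩ := (h.sharp_bijective x).2 ξ
  have hq : q = 0 := D.EStar_eq_zero fun ζ => by rw [← h]; exact hξ ζ
  rw [hq, map_zero]

/-- Eliminates j. The nondegeneracy of η on L_X is hidden in `Corresponds` as the invertibility of
j♯₀. -/
theorem corresponds_iff (hη : ∀ x ξ, (∀ ζ, η x ξ ζ = 0) → ξ = 0) {t : D.Triple} :
    D.Corresponds η t ↔ (∀ x ξ, (∀ ζ, D.restrictL η x ξ ζ = 0) → ξ = 0) ∧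
      D.IsOrthogonalTriple η t := by
  constructor
  · rintro ⟨j, hj, ht⟩
    have hL := fun x => (hj.sharp0_bijective_iff x).1 (ht.invertible x)
    exact ⟨hL, (hj.isTripleOf_iff hL).1 ht⟩
  · rintro ⟨hL, ht⟩
    obtain ⟨j, hj⟩ := exists_isInverse hη
    exact ⟨j, hj, (hj.isTripleOf_iff hL).2 ht⟩

end Algebra

end LagrangianInLeaf

/-! ### The Poisson tensor in a chart and its smoothness -/

section PoissonRep

variable {E : Type*} [NormedAddCommGroup E] [NormedSpace ℝ E]
  {Z : Type*} [TopologicalSpace Z] [ChartedSpace E Z]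
  {G : Type*} [NormedAddCommGroup G] [NormedSpace ℝ G]
  {X : Type*} [TopologicalSpace X] [ChartedSpace G X]

/-- The bundle map of a Poisson structure read in the chart centred at `z₀`. -/
def PoissonStructure.rep (P : PoissonStructure E Z) (z₀ z : Z) : (E →L[ℝ] ℝ) →L[ℝ] E :=
  (chartD E z₀ z).comp ((P.sharp z).comp ((ContinuousLinearMap.compL ℝ E E ℝ).flip (chartD E z₀ z)))

theorem PoissonStructure.rep_apply (P : PoissonStructure E Z) (z₀ z : Z) (ξ : E →L[ℝ] ℝ) :
    P.rep z₀ z ξ = chartD E z₀ z (P.sharp z (ξ.comp (chartD E z₀ z))) := rfl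

theorem PoissonStructure.skew_rep (P : PoissonStructure E Z) (z₀ z : Z) (ξ ζ : E →L[ℝ] ℝ) :
    ξ (P.rep z₀ z ζ) = -ζ (P.rep z₀ z ξ) :=
  P.skew z (ξ.comp (chartD E z₀ z)) (ζ.comp (chartD E z₀ z))

variable [IsManifold 𝓘(ℝ, E) ∞ Z]

theorem PoissonStructure.rep_covRep (P : PoissonStructure E Z) {z₀ z : Z}
    (hz : z ∈ (chartAt E z₀).source) (ξ : Cotan E z) :
    P.rep z₀ z (covRep z₀ ξ) = chartD E z₀ z (P.sharp z ξ) := by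
  rw [P.rep_apply, comp_chartD_covRep hz]

theorem contMDiffAt_extChartAt_of_mem {z₀ z : Z} (hz : z ∈ (chartAt E z₀).source) :
    ContMDiffAt 𝓘(ℝ, E) 𝓘(ℝ, E) ∞ (extChartAt 𝓘(ℝ, E) z₀) z :=
  contMDiffAt_extChartAt' hz

/-- The differential of a function of the coordinates. -/
theorem mfderiv_comp_extChartAt {W : Type*} [NormedAddCommGroup W] [NormedSpace ℝ W]
    {h : E → W} {z₀ z : Z}
    (hz : z ∈ (chartAt E z₀).source) (hh : DifferentiableAt ℝ h (extChartAt 𝓘(ℝ, E) z₀ z)) :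
    (mfderiv 𝓘(ℝ, E) 𝓘(ℝ, W) (fun y => h (extChartAt 𝓘(ℝ, E) z₀ y)) z :
      TangentSpace 𝓘(ℝ, E) z →L[ℝ] W) =
      (fderiv ℝ h (extChartAt 𝓘(ℝ, E) z₀ z)).comp (chartD E z₀ z) := by
  have h1 := mfderiv_comp z hh.mdifferentiableAt
    ((contMDiffAt_extChartAt_of_mem hz).mdifferentiableAt (by decide))
  rw [mfderiv_eq_fderiv] at h1
  exact h1

theorem dFun_comp_extChartAt {h : E → ℝ} {z₀ z : Z}
    (hz : z ∈ (chartAt E z₀).source) (hh : DifferentiableAt ℝ h (extChartAt 𝓘(ℝ, E) z₀ z)) :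
    dFun E (fun y => h (extChartAt 𝓘(ℝ, E) z₀ y)) z =
      (fderiv ℝ h (extChartAt 𝓘(ℝ, E) z₀ z)).comp (chartD E z₀ z) :=
  mfderiv_comp_extChartAt hz hh

theorem dFun_congr {f g : Z → ℝ} {z : Z} (h : f =ᶠ[𝓝 z] g) : dFun E f z = dFun E g z :=
  h.mfderiv_eq

variable [FiniteDimensional ℝ E] [T2Space Z]

/-- Smooth functions with prescribed linear expression in a chart near a point. -/
theorem exists_linear_coordinate {z₀ z : Z} (hz : z ∈ (chartAt E z₀).source) (ξ : E →L[ℝ] ℝ) :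
    ∃ g : Z → ℝ, ContMDiff 𝓘(ℝ, E) 𝓘(ℝ, ℝ) ∞ g ∧
      ∀ᶠ y in 𝓝 z, dFun E g y = ξ.comp (chartD E z₀ y) := by
  have hev := (chartAt E z₀).open_source.mem_nhds hz
  obtain ⟨g, hg, hg'⟩ := exists_smooth_extension (G := E) (x₀ := z)
    (f := fun y => ξ (extChartAt 𝓘(ℝ, E) z₀ y)) (by
      filter_upwards [hev] with y hy
      exact ξ.contDiff.contDiffAt.contMDiffAt.comp y (contMDiffAt_extChartAt_of_mem hy))
  refine ⟨g, hg, ?_⟩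
  filter_upwards [hev, eventually_eventually_nhds.2 hg'] with y hy hy'
  rw [dFun_congr hy', dFun_comp_extChartAt hy ξ.differentiableAt, ξ.fderiv]

theorem contMDiffAt_of_dual {W : Type*} [NormedAddCommGroup W] [NormedSpace ℝ W]
    [FiniteDimensional ℝ W] {A : X → W} {x : X}
    (h : ∀ ξ : W →L[ℝ] ℝ, ContMDiffAt 𝓘(ℝ, G) 𝓘(ℝ, ℝ) ∞ (fun y => ξ (A y)) x) :
    ContMDiffAt 𝓘(ℝ, G) 𝓘(ℝ, W) ∞ A x := by
  let b := Module.finBasis ℝ W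
  have hA : A = fun y => ∑ i, LinearMap.toContinuousLinearMap (b.coord i) (A y) • b i := by
    funext y
    exact (b.sum_repr (A y)).symm
  rw [hA]
  exact ContMDiffAt.sum fun i _ => (h _).smul contMDiffAt_const

/-- Smoothness is only given for brackets of global functions. The matrix entries of ϖ♯ in a chart
are locally brackets of linear coordinates, cut off to global smooth functions. -/
theorem PoissonStructure.contMDiffAt_rep (P : PoissonStructure E Z) {z₀ z : Z}
    (hz : z ∈ (chartAt E z₀).source) :
    ContMDiffAt 𝓘(ℝ, E) 𝓘(ℝ, (E →L[ℝ] ℝ) →L[ℝ] E) ∞ (P.rep z₀) z := by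
  refine contMDiffAt_clm_of_apply fun ζ => contMDiffAt_of_dual fun ξ => ?_
  obtain ⟨g, hg, hg'⟩ := exists_linear_coordinate hz ξ
  obtain ⟨k, hk, hk'⟩ := exists_linear_coordinate hz ζ
  refine (P.smooth g k hg hk).contMDiffAt.congr_of_eventuallyEq ?_
  filter_upwards [hg', hk'] with y hy hy'
  rw [hy, hy']
  rfl

/-- The image of a smooth covector field along a map under the bundle map of a Poisson structure
is smooth. -/
theorem PoissonStructure.contMDiffAt_sharp (P : PoissonStructure E Z) {f : X → Z}
    {s : ∀ x, Cotan E (f x)} {x : X} (hf : ContMDiffAt 𝓘(ℝ, G) 𝓘(ℝ, E) ∞ f x)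
    (hs : ContMDiffAt 𝓘(ℝ, G) (𝓘(ℝ, E).prod 𝓘(ℝ, E →L[ℝ] ℝ)) ∞
      (fun x => cotPoint (f x) (s x)) x) :
    ContMDiffAt 𝓘(ℝ, G) 𝓘(ℝ, E).tangent ∞
      (fun x => (⟨f x, P.sharp (f x) (s x)⟩ : TangentBundle 𝓘(ℝ, E) Z)) x := by
  have hx := mem_chart_source E (f x)
  rw [contMDiffAt_cotan_iff hf hx] at hs
  rw [contMDiffAt_tangent_iff hf hx]
  have hev : ∀ᶠ y in 𝓝 x, f y ∈ (chartAt E (f x)).source :=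
    hf.continuousAt.eventually ((chartAt E (f x)).open_source.mem_nhds hx)
  exact (((P.contMDiffAt_rep hx).comp x hf).clm_apply hs).congr_of_eventuallyEq
    (hev.mono fun y hy => (P.rep_covRep hy (s y)).symm)

end PoissonRep

/-! ### Local sections and frames of annihilator bundles -/

section Subbundles

variable {E : Type*} [NormedAddCommGroup E] [NormedSpace ℝ E]
  {Z : Type*} [TopologicalSpace Z] [ChartedSpace E Z] [IsManifold 𝓘(ℝ, E) ∞ Z]
  {G : Type*} [NormedAddCommGroup G] [NormedSpace ℝ G]
  {X : Type*} [TopologicalSpace X] [ChartedSpace G X]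
  {ι : Type*} [Fintype ι]

theorem chartD_injective {z₀ z : Z} (hz : z ∈ (chartAt E z₀).source) :
    Function.Injective (chartD E z₀ z) :=
  Function.LeftInverse.injective (g := chartI E z₀ z) fun v => chartI_chartD hz v

variable [FiniteDimensional ℝ E]

/-- A covector annihilating independent vectors at a point extends to a smooth family of covectors
annihilating a smooth family of vectors. -/
theorem exists_annihilator {W : ι → X → E} {x₀ : X}
    (hW : ∀ i, ∀ᶠ x in 𝓝 x₀, ContMDiffAt 𝓘(ℝ, G) 𝓘(ℝ, E) ∞ (W i) x)
    (hli : LinearIndependent ℝ fun i => W i x₀) (ξ₀ : E →L[ℝ] ℝ) (hξ₀ : ∀ i, ξ₀ (W i x₀) = 0) :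
    ∃ ξ : X → E →L[ℝ] ℝ, ξ x₀ = ξ₀ ∧ ∀ᶠ x in 𝓝 x₀,
      ContMDiffAt 𝓘(ℝ, G) 𝓘(ℝ, E →L[ℝ] ℝ) ∞ ξ x ∧ ∀ i, ξ x (W i x) = 0 := by
  classical
  obtain ⟨l, hl⟩ := (Fintype.linearCombination ℝ (fun i => W i x₀)).exists_leftInverse_of_injective
    (LinearMap.ker_eq_bot.2 (linearIndependent_iff_injective_fintypeLinearCombination.1 hli))
  let L : E →L[ℝ] (ι → ℝ) := LinearMap.toContinuousLinearMap l
  have hL : ∀ i, L (W i x₀) = Pi.single i 1 := fun i => by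
    have := DFunLike.congr_fun hl (Pi.single i 1)
    simpa [L] using this
  -- The extension is sought as ξ₀ + ∑ c_j L_j. Annihilating all W_i is the linear system with
  -- columns S_j and right-hand side w; at x₀ its matrix is the identity and w = 0, so c vanishes
  -- there.
  let S : ι → X → ι → ℝ := fun j x i => L (W i x) j
  let w : X → ι → ℝ := fun x i => -ξ₀ (W i x)
  have hS : ∀ j, ∀ᶠ x in 𝓝 x₀, ContMDiffAt 𝓘(ℝ, G) 𝓘(ℝ, ι → ℝ) ∞ (S j) x := fun j => by
    filter_upwards [Filter.eventually_all.2 hW] with x hx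
    refine contMDiffAt_pi_space.2 fun i => ?_
    exact ((ContinuousLinearMap.proj (R := ℝ) (φ := fun _ : ι => ℝ) j).comp L).contDiff.contDiffAt
      |>.contMDiffAt.comp x (hx i)
  have hw : ∀ᶠ x in 𝓝 x₀, ContMDiffAt 𝓘(ℝ, G) 𝓘(ℝ, ι → ℝ) ∞ w x := by
    filter_upwards [Filter.eventually_all.2 hW] with x hx
    refine contMDiffAt_pi_space.2 fun i => ?_
    exact (-ξ₀).contDiff.contDiffAt.contMDiffAt.comp x (hx i)
  have hSc : ∀ j, ContinuousAt (S j) x₀ := fun j => (hS j).self_of_nhds.continuousAt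
  have hS0 : ∀ j, S j x₀ = Pi.single j 1 := fun j => by
    funext i
    simp only [S, hL, Pi.single_apply, eq_comm]
  have hSli : LinearIndependent ℝ fun j => S j x₀ := by
    simp only [hS0]
    exact Pi.linearIndependent_single_one ι ℝ
  obtain ⟨c, hc⟩ := eventually_exists_coeff hSc hSli (w := w) (by simp)
  have hev : ∀ᶠ x in 𝓝 x₀, LinearIndependent ℝ (fun i => S i x) :=
    (tendsto_pi_nhds.2 hSc).eventually hSli.eventually
  let pr : ι → E →L[ℝ] ℝ := fun j =>
    (ContinuousLinearMap.proj (R := ℝ) (φ := fun _ : ι => ℝ) j).comp L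
  refine ⟨fun x => ξ₀ + ∑ j, c j x • pr j, ?_, ?_⟩
  · have h0 := hc.self_of_nhds
    have h1 : ∀ j, c j x₀ = 0 := fun j => by
      have h2 := congrFun h0 j
      simpa [hS0, w, hξ₀, Finset.sum_apply, Pi.single_apply] using h2
    simp [h1]
  · filter_upwards [hev, Filter.eventually_all.2 hS, hw, eventually_eventually_nhds.2 hc]
      with x h1 h2 h3 h4
    refine ⟨?_, fun i => ?_⟩
    · have h5 := contMDiffAt_coeff h2 h1 h3 h4
      exact contMDiffAt_const.add (ContMDiffAt.sum fun j _ => (h5 j).smul contMDiffAt_const)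
    · have h5 := congrFun h4.self_of_nhds i
      simp only [Finset.sum_apply, Pi.smul_apply, smul_eq_mul, S, w] at h5
      simp only [_root_.add_apply, FunLike.coe_sum, Finset.sum_apply, FunLike.coe_smul,
        Pi.smul_apply, smul_eq_mul, pr, ContinuousLinearMap.comp_apply, ContinuousLinearMap.proj_apply]
      rw [h5]
      ring

theorem linearIndependent_chartD {z₀ z : Z} (hz : z ∈ (chartAt E z₀).source)
    {v : ι → TangentSpace 𝓘(ℝ, E) z} (hv : LinearIndependent ℝ v) :
    LinearIndependent ℝ fun i => chartD E z₀ z (v i) :=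
  hv.map' (chartD E z₀ z).toLinearMap (LinearMap.ker_eq_bot.2 (chartD_injective hz))

/-- Sections through a given point of a bundle of covectors which annihilate a smooth family of
independent vectors. -/
theorem exists_section_of_annihilator [FiniteDimensional ℝ G] [IsManifold 𝓘(ℝ, G) ∞ X] [T2Space X]
    {f : X → Z} (hf : ContMDiff 𝓘(ℝ, G) 𝓘(ℝ, E) ∞ f)
    {K : ∀ x, Submodule ℝ (Cotan E (f x))} {U : ι → ∀ x, TangentSpace 𝓘(ℝ, E) (f x)} {x₀ : X}
    (hU : ∀ i, ∀ᶠ x in 𝓝 x₀, ContMDiffAt 𝓘(ℝ, G) 𝓘(ℝ, E).tangent ∞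
      (fun x => (⟨f x, U i x⟩ : TangentBundle 𝓘(ℝ, E) Z)) x)
    (hli : LinearIndependent ℝ fun i => U i x₀)
    (hK : ∀ᶠ x in 𝓝 x₀, ∀ ξ, ξ ∈ K x ↔ ∀ i, ξ (U i x) = 0) {ξ₀ : Cotan E (f x₀)}
    (hξ₀ : ξ₀ ∈ K x₀) :
    ∃ s : ∀ x, Cotan E (f x), ContMDiff 𝓘(ℝ, G) (𝓘(ℝ, E).prod 𝓘(ℝ, E →L[ℝ] ℝ)) ∞
      (fun x => cotPoint (f x) (s x)) ∧ (∀ x, s x ∈ K x) ∧ s x₀ = ξ₀ := by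
  have hx₀ := mem_chart_source E (f x₀)
  have hev : ∀ᶠ y in 𝓝 x₀, f y ∈ (chartAt E (f x₀)).source :=
    hf.continuous.continuousAt.eventually ((chartAt E (f x₀)).open_source.mem_nhds hx₀)
  obtain ⟨ξ, hξ, hξ'⟩ := exists_annihilator (W := fun i x => chartD E (f x₀) (f x) (U i x)) (x₀ := x₀)
    (fun i => by
      filter_upwards [hev, hU i] with x hx hUx
      exact (contMDiffAt_tangent_iff hf.contMDiffAt hx).1 hUx)
    (linearIndependent_chartD hx₀ hli) (covRep (f x₀) ξ₀) (fun i => by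
      rw [covRep_chartD hx₀]
      exact (hK.self_of_nhds ξ₀).1 hξ₀ i)
  obtain ⟨φ, h1, h2, h3⟩ := exists_smooth_bump (G := G) (hev.and (hξ'.and hK))
  refine ⟨fun x => φ x • ((ξ x).comp (chartD E (f x₀) (f x))), ?_, fun x => ?_, ?_⟩
  · exact contMDiff_bump_smul_cotan (s := fun x => ((ξ x).comp (chartD E (f x₀) (f x)))) hf h1
      fun x hx => contMDiffAt_comp_chartD hf.contMDiffAt (h3 hx).1 (h3 hx).2.1.1
  · change φ x • ((ξ x).comp (chartD E (f x₀) (f x)) : Cotan E (f x)) ∈ K x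
    by_cases hx : x ∈ tsupport φ
    -- On the support of the cut-off the bundle K is the annihilator of the U_i; elsewhere the
    -- section is zero.
    · refine (K x).smul_mem _ (((h3 hx).2.2 _).2 fun i => ?_)
      exact (h3 hx).2.1.2 i
    · rw [image_eq_zero_of_notMem_tsupport hx, zero_smul]
      exact (K x).zero_mem
  · change φ x₀ • ((ξ x₀).comp (chartD E (f x₀) (f x₀))) = ξ₀
    rw [h2.self_of_nhds, one_smul, hξ]
    exact comp_chartD_covRep hx₀ ξ₀

/-- Reading covectors in a chart, as a linear map. -/
def covRepₗ (z₀ z : Z) : Cotan E z →ₗ[ℝ] (E →L[ℝ] ℝ) where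
  toFun ξ := covRep z₀ ξ
  map_add' _ _ := rfl
  map_smul' _ _ := rfl

theorem covRepₗ_injective {z₀ z : Z} (hz : z ∈ (chartAt E z₀).source) :
    Function.Injective (covRepₗ (E := E) z₀ z) := fun ξ ζ h => by
  have h1 : covRep z₀ ξ = covRep z₀ ζ := h
  rw [← comp_chartD_covRep hz ξ, h1, comp_chartD_covRep hz]

theorem exists_coeff_of_linearIndependent {V W : Type*} [AddCommGroup V] [Module ℝ V]
    [FiniteDimensional ℝ V] [AddCommGroup W] [Module ℝ W] (R : V →ₗ[ℝ] W) {K : Submodule ℝ V}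
    (hcard : Fintype.card ι = Module.finrank ℝ K) {s : ι → K}
    (hs : LinearIndependent ℝ fun i => R (s i)) (w : K) : ∃ c : ι → ℝ, ∑ i, c i • s i = w := by
  have h0 : LinearIndependent ℝ s := LinearIndependent.of_comp (R ∘ₗ K.subtype) hs
  have h1 := h0.span_eq_top_of_card_eq_finrank' hcard
  have h2 : w ∈ Submodule.span ℝ (range s) := by rw [h1]; trivial
  exact (Submodule.mem_span_range_iff_exists_fun ℝ).1 h2

/-- Coefficients with respect to a smooth frame of a bundle of covectors. -/
theorem exists_frame_coeff {f : X → Z} {K : ∀ x, Submodule ℝ (Cotan E (f x))} {x₀ : X}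
    (hf : ContMDiffAt 𝓘(ℝ, G) 𝓘(ℝ, E) ∞ f x₀) {s : ι → ∀ x, K x}
    (hs : ∀ i, ContMDiffAt 𝓘(ℝ, G) (𝓘(ℝ, E).prod 𝓘(ℝ, E →L[ℝ] ℝ)) ∞
      (fun x => cotPoint (f x) (s i x : Cotan E (f x))) x₀)
    (hli : LinearIndependent ℝ fun i => (s i x₀ : Cotan E (f x₀)))
    (hcard : ∀ x, Fintype.card ι = Module.finrank ℝ (K x)) (w : ∀ x, K x) :
    ∃ c : ι → X → ℝ, (∀ᶠ x in 𝓝 x₀, ∑ i, c i x • s i x = w x) ∧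
      (ContMDiffAt 𝓘(ℝ, G) (𝓘(ℝ, E).prod 𝓘(ℝ, E →L[ℝ] ℝ)) ∞
        (fun x => cotPoint (f x) (w x : Cotan E (f x))) x₀ →
        ∀ i, ContMDiffAt 𝓘(ℝ, G) 𝓘(ℝ, ℝ) ∞ (c i) x₀) := by
  have hx₀ := mem_chart_source E (f x₀)
  let S : ι → X → (E →L[ℝ] ℝ) := fun i x => covRepₗ (f x₀) (f x) (s i x : Cotan E (f x))
  have hS : ∀ i, ContMDiffAt 𝓘(ℝ, G) 𝓘(ℝ, E →L[ℝ] ℝ) ∞ (S i) x₀ := fun i =>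
    (contMDiffAt_cotan_iff hf hx₀).1 (hs i)
  have hSli : LinearIndependent ℝ fun i => S i x₀ :=
    hli.map' (covRepₗ (f x₀) (f x₀)) (LinearMap.ker_eq_bot.2 (covRepₗ_injective hx₀))
  have hev : ∀ᶠ x in 𝓝 x₀, LinearIndependent ℝ (fun i => S i x) :=
    (tendsto_pi_nhds.2 fun i => (hS i).continuousAt).eventually hSli.eventually
  have key : ∀ x, ∃ c : ι → ℝ, LinearIndependent ℝ (fun i => S i x) →
      ∑ i, c i • s i x = w x := by
    intro x
    by_cases hx : LinearIndependent ℝ (fun i => S i x)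
    · obtain ⟨c, hc⟩ := exists_coeff_of_linearIndependent (covRepₗ (f x₀) (f x)) (hcard x) hx (w x)
      exact ⟨c, fun _ => hc⟩
    -- Away from the neighbourhood where the frame is independent the coefficients are irrelevant
    -- and set to zero.
    · exact ⟨0, fun h => absurd h hx⟩
  choose c hc using key
  refine ⟨fun i x => c x i, hev.mono fun x hx => hc x hx, fun hw => ?_⟩
  refine contMDiffAt_coeff hS hSli ((contMDiffAt_cotan_iff hf hx₀).1 hw) ?_
  filter_upwards [hev] with x hx
  have h1 := congrArg (covRepₗ (f x₀) (f x) ∘ₗ (K x).subtype) (hc x hx)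
  refine Eq.trans ?_ h1
  refine Eq.trans ?_ (map_sum _ _ _).symm
  exact Finset.sum_congr rfl fun i _ => rfl

end Subbundles

/-! ### Smoothness of the anchor and existence of sections through given points -/

namespace LagrangianInLeaf

section SmoothTriples

variable {E F G : Type*}
  [NormedAddCommGroup E] [NormedSpace ℝ E]
  [NormedAddCommGroup F] [NormedSpace ℝ F]
  [NormedAddCommGroup G] [NormedSpace ℝ G]
  {Z : Type u} [TopologicalSpace Z] [ChartedSpace E Z]
  {S : Type*} [TopologicalSpace S] [ChartedSpace F S]
  {X : Type*} [TopologicalSpace X] [ChartedSpace G X]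
  (D : LagrangianInLeaf E F G Z S X)

theorem contMDiff_pt : ContMDiff 𝓘(ℝ, G) 𝓘(ℝ, E) ∞ D.pt := D.leaf.smooth.comp D.smooth

/-- X injects continuously into the Hausdorff space Z. This is what permits cut-off functions on X.
-/
theorem t2Space [T2Space Z] (D : LagrangianInLeaf E F G Z S X) : T2Space X :=
  T2Space.of_injective_continuous (f := D.pt) (D.leaf.injective.comp D.injective)
    D.contMDiff_pt.continuous

theorem mfderiv_pt (x : X) :
    mfderiv 𝓘(ℝ, G) 𝓘(ℝ, E) D.pt x = D.TXZ x :=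
  mfderiv_comp x (D.leaf.smooth.mdifferentiable (by decide) _)
    (D.smooth.mdifferentiable (by decide) _)

variable [IsManifold 𝓘(ℝ, E) ∞ Z] [IsManifold 𝓘(ℝ, G) ∞ X]

theorem contMDiffAt_TXZ {V : ∀ x, TangentSpace 𝓘(ℝ, G) x} {x : X}
    (hV : ContMDiffAt 𝓘(ℝ, G) 𝓘(ℝ, G).tangent ∞
      (fun x => (⟨x, V x⟩ : TangentBundle 𝓘(ℝ, G) X)) x) :
    ContMDiffAt 𝓘(ℝ, G) 𝓘(ℝ, E).tangent ∞
      (fun x => (⟨D.pt x, D.TXZ x (V x)⟩ : TangentBundle 𝓘(ℝ, E) Z)) x := by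
  have h := contMDiffAt_mfderiv_apply D.contMDiff_pt (f := fun x : X => x) hV
  simp only [D.mfderiv_pt] at h
  exact h

theorem contMDiffAt_TS [IsManifold 𝓘(ℝ, F) ∞ S] {V : ∀ x, TangentSpace 𝓘(ℝ, F) (D.iX x)} {x : X}
    (hV : ContMDiffAt 𝓘(ℝ, G) 𝓘(ℝ, F).tangent ∞
      (fun x => (⟨D.iX x, V x⟩ : TangentBundle 𝓘(ℝ, F) S)) x) :
    ContMDiffAt 𝓘(ℝ, G) 𝓘(ℝ, E).tangent ∞
      (fun x => (⟨D.pt x, D.TS x (V x)⟩ : TangentBundle 𝓘(ℝ, E) Z)) x :=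
  contMDiffAt_mfderiv_apply D.leaf.smooth (f := D.iX) hV

theorem mem_ΓEX_iff {s : ∀ x, D.EX x} : s ∈ D.ΓEX ↔
    ∀ x, ContMDiffAt 𝓘(ℝ, G) (𝓘(ℝ, E).prod 𝓘(ℝ, E →L[ℝ] ℝ)) ∞
      (fun x => cotPoint (D.pt x) (s x : Cotan E (D.pt x))) x :=
  contMDiffOn_univ

theorem mem_ΓLX_iff {s : ∀ x, D.LX x} : s ∈ D.ΓLX ↔
    ∀ x, ContMDiffAt 𝓘(ℝ, G) (𝓘(ℝ, E).prod 𝓘(ℝ, E →L[ℝ] ℝ)) ∞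
      (fun x => cotPoint (D.pt x) (s x : Cotan E (D.pt x))) x :=
  contMDiffOn_univ

theorem contMDiffAt_chartD_of_mem_ΓTX {V : ∀ x, TangentSpace 𝓘(ℝ, G) x} (hV : V ∈ D.ΓTX) (x₀ : X) :
    ContMDiffAt 𝓘(ℝ, G) 𝓘(ℝ, G) ∞ (fun x => chartD G x₀ x (V x)) x₀ :=
  (contMDiffAt_tangent_iff (f := fun x : X => x) contMDiffAt_id (mem_chart_source G x₀)).1
    (hV.contMDiffAt)

theorem chartI_injective {z₀ z : X} (hz : z ∈ (chartAt G z₀).source) :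
    Function.Injective (chartI G z₀ z) :=
  Function.LeftInverse.injective (g := chartD G z₀ z) fun v => chartD_chartI hz v

variable [FiniteDimensional ℝ E] [FiniteDimensional ℝ F] [FiniteDimensional ℝ G] [T2Space Z]

/-- The anchor is smooth. -/
theorem contMDiffAt_chartD_rho {s : ∀ x, D.EX x} {x₀ : X}
    (hs : ContMDiffAt 𝓘(ℝ, G) (𝓘(ℝ, E).prod 𝓘(ℝ, E →L[ℝ] ℝ)) ∞
      (fun x => cotPoint (D.pt x) (s x : Cotan E (D.pt x))) x₀) :
    ContMDiffAt 𝓘(ℝ, G) 𝓘(ℝ, G) ∞ (fun x => chartD G x₀ x (D.rho x (s x))) x₀ := by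
  have hf := D.contMDiff_pt.contMDiffAt (x := x₀)
  have hz := mem_chart_source E (D.pt x₀)
  have hx := mem_chart_source G x₀
  let b := Module.finBasis ℝ G
  have hS : ∀ i, ContMDiffAt 𝓘(ℝ, G) 𝓘(ℝ, E) ∞
      (fun x => chartD E (D.pt x₀) (D.pt x) (D.TXZ x (chartI G x₀ x (b i)))) x₀ := fun i =>
    (contMDiffAt_tangent_iff hf hz).1 (D.contMDiffAt_TXZ
      (contMDiffAt_chartI (f := fun x : X => x) (b i) contMDiffAt_id hx))
  have hli : LinearIndependent ℝ fun i =>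
      chartD E (D.pt x₀) (D.pt x₀) (D.TXZ x₀ (chartI G x₀ x₀ (b i))) := by
    have h1 := (b.linearIndependent.map' (chartI G x₀ x₀).toLinearMap
      (LinearMap.ker_eq_bot.2 (chartI_injective hx))).map' (D.TXZ x₀).toLinearMap
      (LinearMap.ker_eq_bot.2 (D.TXZ_injective x₀))
    exact linearIndependent_chartD hz h1
  have hw := (contMDiffAt_tangent_iff hf hz).1 (D.P.contMDiffAt_sharp hf hs)
  -- The coordinates of ρ(s) on X are, up to sign, the coefficients of ϖ♯s in the independent
  -- vectors TXZ(∂_i). These are smooth because X is immersed in Z.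
  have hc := contMDiffAt_coeff (c := fun i x => -b.coord i (chartD G x₀ x (D.rho x (s x)))) hS hli hw
    (by
      filter_upwards [(chartAt G x₀).open_source.mem_nhds hx] with x hx'
      have h1 : (∑ i, b.coord i (chartD G x₀ x (D.rho x (s x))) • b i) =
        chartD G x₀ x (D.rho x (s x)) := b.sum_repr _
      have h2 := congrArg (fun e => chartD E (D.pt x₀) (D.pt x) (D.TXZ x (chartI G x₀ x e))) h1
      simp only [chartI_chartD hx', D.TXZ_rho, map_sum, map_smul, map_neg] at h2
      simp only [neg_smul, Finset.sum_neg_distrib]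
      rw [h2, neg_neg])
  have hA : (fun x => chartD G x₀ x (D.rho x (s x))) = fun x =>
      ∑ i, (-(-b.coord i (chartD G x₀ x (D.rho x (s x))))) • b i := by
    funext x
    simp only [neg_neg]
    exact (b.sum_repr _).symm
  rw [hA]
  exact ContMDiffAt.sum fun i _ => (hc i).neg.smul contMDiffAt_const

theorem rho_mem_ΓTX {s : ∀ x, D.EX x} (hs : s ∈ D.ΓEX) : (fun x => D.rho x (s x)) ∈ D.ΓTX :=
  fun x₀ => (contMDiffAt_tangent_iff (f := fun x : X => x) contMDiffAt_id
    (mem_chart_source G x₀)).2 (D.contMDiffAt_chartD_rho (D.mem_ΓEX_iff.1 hs x₀))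

/-- The rank of E_X does not depend on the point, so a frame at one point is a frame nearby. -/
theorem finrank_EX (x : X) :
    Module.finrank ℝ (D.EX x) + Module.finrank ℝ G = Module.finrank ℝ E := by
  have h1 := Submodule.finrank_quotient_add_finrank (LinearMap.range (D.TXZ x).toLinearMap)
  have h2 : Module.finrank ℝ (LinearMap.range (D.TXZ x).toLinearMap) = Module.finrank ℝ G :=
    LinearMap.finrank_range_of_inj (f := (D.TXZ x).toLinearMap) (D.TXZ_injective x)
  rw [h2] at h1
  rw [← D.finrank_EStar x]
  exact h1

theorem exists_ΓEX {x₀ : X} (ξ : D.EX x₀) : ∃ s ∈ D.ΓEX, s x₀ = ξ := by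
  have := D.t2Space
  have hx := mem_chart_source G x₀
  let b := Module.finBasis ℝ G
  have hev := (chartAt G x₀).open_source.mem_nhds hx
  obtain ⟨s, h1, h2, h3⟩ := exists_section_of_annihilator (K := D.EX) (x₀ := x₀)
    (U := fun i x => D.TXZ x (chartI G x₀ x (b i)))
    D.contMDiff_pt (fun i => by
      filter_upwards [hev] with x hx'
      exact D.contMDiffAt_TXZ (contMDiffAt_chartI (f := fun x : X => x) (b i) contMDiffAt_id hx'))
    ((b.linearIndependent.map' (chartI G x₀ x₀).toLinearMap
      (LinearMap.ker_eq_bot.2 (chartI_injective hx))).map' (D.TXZ x₀).toLinearMap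
      (LinearMap.ker_eq_bot.2 (D.TXZ_injective x₀)))
    (by
      -- Near x₀ the images of the coordinate fields span TX, so annihilating them is the same as
      -- lying in E_X.
      filter_upwards [hev] with x hx' ζ
      refine ⟨fun h i => h _, fun h u => ?_⟩
      have e1 : (∑ i, b.coord i (chartD G x₀ x u) • b i) = chartD G x₀ x u := b.sum_repr _
      have e2 := congrArg (fun e => ζ (D.TXZ x (chartI G x₀ x e))) e1
      simp only [chartI_chartD hx', map_sum, map_smul] at e2
      rw [← e2]
      exact Finset.sum_eq_zero fun i _ => by rw [h i, smul_zero])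
    ξ.2
  exact ⟨fun x => ⟨s x, h2 x⟩, D.mem_ΓEX_iff.2 fun x => h1 x, Subtype.ext h3⟩

theorem exists_ΓLX [IsManifold 𝓘(ℝ, F) ∞ S] {x₀ : X} (ξ : D.LX x₀) : ∃ s ∈ D.ΓLX, s x₀ = ξ := by
  have := D.t2Space
  have hx := mem_chart_source F (D.iX x₀)
  let b := Module.finBasis ℝ F
  have hev : ∀ᶠ x in 𝓝 x₀, D.iX x ∈ (chartAt F (D.iX x₀)).source :=
    D.smooth.continuous.continuousAt.eventually ((chartAt F (D.iX x₀)).open_source.mem_nhds hx)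
  have hinj : Function.Injective (chartI F (D.iX x₀) (D.iX x₀)) :=
    Function.LeftInverse.injective (g := chartD F (D.iX x₀) (D.iX x₀)) fun v => chartD_chartI hx v
  obtain ⟨s, h1, h2, h3⟩ := exists_section_of_annihilator (K := D.LX) (x₀ := x₀)
    (U := fun i x => D.TS x (chartI F (D.iX x₀) (D.iX x) (b i)))
    D.contMDiff_pt (fun i => by
      filter_upwards [hev] with x hx'
      exact D.contMDiffAt_TS (contMDiffAt_chartI (b i) D.smooth.contMDiffAt hx'))
    ((b.linearIndependent.map' (chartI F (D.iX x₀) (D.iX x₀)).toLinearMap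
      (LinearMap.ker_eq_bot.2 hinj)).map' (D.TS x₀).toLinearMap
      (LinearMap.ker_eq_bot.2 (D.TS_injective x₀)))
    (by
      filter_upwards [hev] with x hx' ζ
      refine ⟨fun h i => h _, fun h u => ?_⟩
      have e1 : (∑ i, b.coord i (chartD F (D.iX x₀) (D.iX x) u) • b i) =
        chartD F (D.iX x₀) (D.iX x) u := b.sum_repr _
      have e2 := congrArg (fun e => ζ (D.TS x (chartI F (D.iX x₀) (D.iX x) e))) e1
      simp only [chartI_chartD hx', map_sum, map_smul] at e2
      rw [← e2]
      exact Finset.sum_eq_zero fun i _ => by rw [h i, smul_zero])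
    ξ.2
  exact ⟨fun x => ⟨s x, h2 x⟩, D.mem_ΓLX_iff.2 fun x => h1 x, Subtype.ext h3⟩

/-- A vector of the model space extends, with constant coefficients near a point, to a smooth
section of `TZ|_X`. -/
theorem exists_ΓTZ_eventually_eq (x₀ : X) (e : E) :
    ∃ U ∈ D.ΓTZ, ∀ᶠ x in 𝓝 x₀, U x = chartI E (D.pt x₀) (D.pt x) e := by
  have := D.t2Space
  have hev : ∀ᶠ x in 𝓝 x₀, D.pt x ∈ (chartAt E (D.pt x₀)).source :=
    D.contMDiff_pt.continuous.continuousAt.eventually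
      ((chartAt E (D.pt x₀)).open_source.mem_nhds (mem_chart_source E (D.pt x₀)))
  obtain ⟨φ, h1, h2, h3⟩ := exists_smooth_bump (G := G) hev
  refine ⟨fun x => φ x • chartI E (D.pt x₀) (D.pt x) e,
    contMDiff_bump_smul_tangent D.contMDiff_pt h1 fun x hx' =>
      contMDiffAt_chartI _ D.contMDiff_pt.contMDiffAt (h3 hx'), ?_⟩
  filter_upwards [h2] with x hx
  rw [hx, one_smul]

theorem exists_ΓTZ {x₀ : X} (v : TangentSpace 𝓘(ℝ, E) (D.pt x₀)) : ∃ U ∈ D.ΓTZ, U x₀ = v := by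
  obtain ⟨U, hU, h⟩ := D.exists_ΓTZ_eventually_eq x₀ (chartD E (D.pt x₀) (D.pt x₀) v)
  exact ⟨U, hU, h.self_of_nhds.trans (chartI_chartD (mem_chart_source E (D.pt x₀)) v)⟩

/-- The field is the anchor of a section of E_X through a preimage of v. -/
theorem exists_ΓTX {x₀ : X} (v : TangentSpace 𝓘(ℝ, G) x₀) : ∃ V ∈ D.ΓTX, V x₀ = v := by
  obtain ⟨ξ, rfl⟩ := D.rho_surjective x₀ v
  obtain ⟨s, hs, rfl⟩ := D.exists_ΓEX ξ
  exact ⟨_, D.rho_mem_ΓTX hs, rfl⟩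

theorem isConnectionForm_iff {α : ∀ x : X, TangentSpace 𝓘(ℝ, G) x →ₗ[ℝ] D.EX x} :
    D.IsConnectionForm α ↔
      (∀ x u, D.rho x (α x u) = u) ∧ ∀ V ∈ D.ΓTX, (fun x => α x (V x)) ∈ D.ΓEX := by
  have h : ∀ x u, D.rho x (α x u) = u ↔
      -(D.P.sharp (D.pt x) (α x u : Cotan E (D.pt x))) = D.TXZ x u := fun x u => by
    rw [← (D.TXZ_injective x).eq_iff, D.TXZ_rho]
  exact ⟨fun ⟨h1, h2⟩ => ⟨fun x u => (h x u).2 (h1 x u), h2⟩,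
    fun ⟨h1, h2⟩ => ⟨fun x u => (h x u).1 (h1 x u), h2⟩⟩

end SmoothTriples

end LagrangianInLeaf

/-! ### Smoothness of the correspondence between η and triples -/

namespace LagrangianInLeaf

section SmoothTriples

theorem linearIndependent_coe_map {ι V W : Type*} [AddCommGroup V] [Module ℝ V]
    [AddCommGroup W] [Module ℝ W] (K : Submodule ℝ V) {b : ι → W} (hb : LinearIndependent ℝ b)
    (T : W →ₗ[ℝ] K) (hT : Function.Injective T) : LinearIndependent ℝ fun i => (T (b i) : V) :=
  (hb.map' T (LinearMap.ker_eq_bot.2 hT)).map' K.subtype K.ker_subtype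

theorem linearIndependent_coe {ι V : Type*} [AddCommGroup V] [Module ℝ V]
    (K : Submodule ℝ V) {b : ι → K} (hb : LinearIndependent ℝ b) :
    LinearIndependent ℝ fun i => (b i : V) :=
  hb.map' K.subtype K.ker_subtype

theorem exists_basis_submodule {V : Type*} [AddCommGroup V] [Module ℝ V] [FiniteDimensional ℝ V]
    (K : Submodule ℝ V) : ∃ b : Fin (Module.finrank ℝ K) → K,
      LinearIndependent ℝ b ∧ Submodule.span ℝ (range b) = ⊤ :=
  ⟨Module.finBasis ℝ K, (Module.finBasis ℝ K).linearIndependent, (Module.finBasis ℝ K).span_eq⟩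

/-- The maps T need be injective only at x₀ and need no smoothness of their own: it suffices that
the frame and w become smooth after applying T. This permits coordinates in which w is visibly
smooth. -/
theorem contMDiffAt_coeff_of_map {ι G X W : Type*} [Fintype ι] [NormedAddCommGroup G]
    [NormedSpace ℝ G] [TopologicalSpace X] [ChartedSpace G X] [NormedAddCommGroup W]
    [NormedSpace ℝ W] [FiniteDimensional ℝ W] {K : X → Type*} [∀ x, AddCommMonoid (K x)]
    [∀ x, Module ℝ (K x)] (T : ∀ x, K x →ₗ[ℝ] W) {s : ι → ∀ x, K x} {w : ∀ x, K x} {x₀ : X}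
    (hs : ∀ i, ContMDiffAt 𝓘(ℝ, G) 𝓘(ℝ, W) ∞ (fun x => T x (s i x)) x₀)
    (hli : LinearIndependent ℝ fun i => s i x₀) (hT : Function.Injective (T x₀))
    (hw : ContMDiffAt 𝓘(ℝ, G) 𝓘(ℝ, W) ∞ (fun x => T x (w x)) x₀) {c : ι → X → ℝ}
    (h : ∀ᶠ x in 𝓝 x₀, ∑ i, c i x • s i x = w x) (i : ι) :
    ContMDiffAt 𝓘(ℝ, G) 𝓘(ℝ, ℝ) ∞ (c i) x₀ := by
  refine contMDiffAt_coeff hs (hli.map_injOn (T x₀) hT.injOn) hw ?_ i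
  filter_upwards [h] with x hx
  rw [← hx, map_sum]
  simp only [map_smul]

variable {E F G : Type*}
  [NormedAddCommGroup E] [NormedSpace ℝ E]
  [NormedAddCommGroup F] [NormedSpace ℝ F]
  [NormedAddCommGroup G] [NormedSpace ℝ G]
  {Z : Type u} [TopologicalSpace Z] [ChartedSpace E Z]
  {S : Type*} [TopologicalSpace S] [ChartedSpace F S]
  {X : Type*} [TopologicalSpace X] [ChartedSpace G X]
  [IsManifold 𝓘(ℝ, E) ∞ Z] [IsManifold 𝓘(ℝ, G) ∞ X]
  [FiniteDimensional ℝ E] [FiniteDimensional ℝ F] [FiniteDimensional ℝ G] [T2Space Z]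

variable {D : LagrangianInLeaf E F G Z S X}
  {j : ∀ x, LinearMap.BilinForm ℝ (D.EStar x)} {η : ∀ x, LinearMap.BilinForm ℝ (D.EX x)}

theorem exists_coeff_EX {n : ℕ} {x₀ : X} (hn : n = Module.finrank ℝ (D.EX x₀))
    {s : Fin n → ∀ x, D.EX x} (hs : ∀ i, s i ∈ D.ΓEX)
    (hli : LinearIndependent ℝ fun i => (s i x₀ : Cotan E (D.pt x₀))) (w : ∀ x, D.EX x) :
    ∃ c : Fin n → X → ℝ, (∀ᶠ x in 𝓝 x₀, ∑ i, c i x • s i x = w x) ∧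
      (w ∈ D.ΓEX → ∀ i, ContMDiffAt 𝓘(ℝ, G) 𝓘(ℝ, ℝ) ∞ (c i) x₀) := by
  obtain ⟨c, h1, h2⟩ := exists_frame_coeff (K := D.EX) (D.contMDiff_pt.contMDiffAt (x := x₀))
    (fun i => D.mem_ΓEX_iff.1 (hs i) x₀) hli
    (fun x => by
      rw [Fintype.card_fin, hn]
      exact Nat.add_right_cancel ((D.finrank_EX x₀).trans (D.finrank_EX x).symm)) w
  exact ⟨c, h1, fun hw => h2 (D.mem_ΓEX_iff.1 hw x₀)⟩

theorem contMDiffAt_EX_of_coeff {n : ℕ} {x₀ : X} {s : Fin n → ∀ x, D.EX x} (hs : ∀ i, s i ∈ D.ΓEX)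
    {c : Fin n → X → ℝ} (hc : ∀ i, ContMDiffAt 𝓘(ℝ, G) 𝓘(ℝ, ℝ) ∞ (c i) x₀)
    {w : ∀ x, D.EX x} (hw : ∀ᶠ x in 𝓝 x₀, ∑ i, c i x • s i x = w x) :
    ContMDiffAt 𝓘(ℝ, G) (𝓘(ℝ, E).prod 𝓘(ℝ, E →L[ℝ] ℝ)) ∞
      (fun x => cotPoint (D.pt x) (w x : Cotan E (D.pt x))) x₀ := by
  have hf := D.contMDiff_pt.contMDiffAt (x := x₀)
  rw [contMDiffAt_cotan_iff hf (mem_chart_source E (D.pt x₀))]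
  have hsum : ContMDiffAt 𝓘(ℝ, G) 𝓘(ℝ, E →L[ℝ] ℝ) ∞
      (fun x => ∑ i, c i x • covRep (D.pt x₀) (s i x : Cotan E (D.pt x))) x₀ :=
    ContMDiffAt.sum fun i _ => (hc i).smul
      ((contMDiffAt_cotan_iff hf (mem_chart_source E (D.pt x₀))).1
        (D.mem_ΓEX_iff.1 (hs i) x₀))
  refine hsum.congr_of_eventuallyEq ?_
  filter_upwards [hw] with x hx
  have h1 := congrArg (covRepₗ (D.pt x₀) (D.pt x) ∘ₗ (D.EX x).subtype) hx
  refine Eq.trans h1.symm ?_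
  refine Eq.trans (map_sum _ _ _) ?_
  exact Finset.sum_congr rfl fun i _ => rfl

theorem exists_frame_EX (x₀ : X) : ∃ s : Fin (Module.finrank ℝ (D.EX x₀)) → ∀ x, D.EX x,
    (∀ i, s i ∈ D.ΓEX) ∧ LinearIndependent ℝ fun i => s i x₀ := by
  obtain ⟨b, hb, -⟩ := exists_basis_submodule (D.EX x₀)
  choose s hs hs0 using fun i => D.exists_ΓEX (b i)
  refine ⟨s, hs, ?_⟩
  simp only [hs0]
  exact hb

theorem exists_frame_LX [IsManifold 𝓘(ℝ, F) ∞ S] (x₀ : X) :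
    ∃ s : Fin (Module.finrank ℝ (D.LX x₀)) → ∀ x, D.LX x,
    (∀ i, s i ∈ D.ΓLX) ∧ Submodule.span ℝ (range fun i => s i x₀) = ⊤ := by
  obtain ⟨b, -, hb⟩ := exists_basis_submodule (D.LX x₀)
  choose s hs hs0 using fun i => D.exists_ΓLX (b i)
  refine ⟨s, hs, ?_⟩
  simp only [hs0]
  exact hb

/-- A covector field is tested on vector fields constant in a chart, where its values are values of
j. -/
theorem IsSymmetricSection.sharp_mem_ΓEX (hj : D.IsSymmetricSection j)
    {U : ∀ x, TangentSpace 𝓘(ℝ, E) (D.pt x)} (hU : U ∈ D.ΓTZ) :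
    (fun x => D.sharp j x (D.toEStar x (U x))) ∈ D.ΓEX := by
  rw [D.mem_ΓEX_iff]
  intro x₀
  refine contMDiffAt_cotan_of_apply (D.contMDiff_pt.contMDiffAt (x := x₀)) fun e => ?_
  obtain ⟨V, hV, hV'⟩ := D.exists_ΓTZ_eventually_eq x₀ e
  refine (hj.smooth U hU V hV).contMDiffAt.congr_of_eventuallyEq ?_
  filter_upwards [hV'] with x hx
  rw [D.sharp_apply, hx]

theorem IsInverse.exists_frame (h : D.IsInverse j η) (x₀ : X) :
    ∃ U : Fin (Module.finrank ℝ (D.EStar x₀)) → ∀ x, TangentSpace 𝓘(ℝ, E) (D.pt x),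
      (∀ i, U i ∈ D.ΓTZ) ∧ LinearIndependent ℝ fun i =>
        (D.sharp j x₀ (D.toEStar x₀ (U i x₀)) : Cotan E (D.pt x₀)) := by
  let b := Module.finBasis ℝ (D.EStar x₀)
  have hU : ∀ i, ∃ U ∈ D.ΓTZ, D.toEStar x₀ (U x₀) = b i := fun i => by
    obtain ⟨v, hv⟩ := D.toEStar_surjective x₀ (b i)
    obtain ⟨U, hU, rfl⟩ := D.exists_ΓTZ v
    exact ⟨U, hU, hv⟩
  choose U hU hU0 using hU
  refine ⟨U, hU, ?_⟩
  simp only [hU0]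
  exact linearIndependent_coe_map (D.EX x₀) b.linearIndependent (D.sharp j x₀)
    (h.sharp_injective x₀)

/-- For smoothness, expand s in a frame of the form j♯[U_i]; then η(j♯[U_i], t) = t(U_i) is a smooth
pairing in which η no longer occurs. -/
theorem IsInverse.isScalarProductField (h : D.IsInverse j η) (hj : D.IsSymmetricSection j) :
    IsScalarProductField (G := G) D.ΓEX η := by
  refine ⟨h.symm hj.symm, h.nondegenerate, fun s hs t ht x₀ => ?_⟩
  have hf := D.contMDiff_pt.contMDiffAt (x := x₀)
  obtain ⟨U, hU, hli⟩ := h.exists_frame x₀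
  obtain ⟨c, hc, hc'⟩ := exists_coeff_EX (D.finrank_EStar x₀)
    (s := fun i x => D.sharp j x (D.toEStar x (U i x))) (fun i => hj.sharp_mem_ΓEX (hU i)) hli s
  have hsum : ContMDiffAt 𝓘(ℝ, G) 𝓘(ℝ, ℝ) ∞
      (fun x => ∑ i, c i x * (t x : Cotan E (D.pt x)) (U i x)) x₀ :=
    ContMDiffAt.sum fun i _ => (hc' hs i).mul
      (contMDiffAt_pairing hf (D.mem_ΓEX_iff.1 ht x₀) (hU i x₀))
  refine hsum.congr_of_eventuallyEq ?_
  filter_upwards [hc] with x hx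
  rw [← hx, map_sum, LinearMap.sum_apply]
  refine Finset.sum_congr rfl fun i _ => ?_
  rw [map_smul, LinearMap.smul_apply, h, D.pairing_toEStar, smul_eq_mul]

variable [IsManifold 𝓘(ℝ, F) ∞ S]

/-- The coordinates of `w ∈ E_X` given by its anchor and its products with sections of `L_X`. -/
def splitCoord (η : ∀ x, LinearMap.BilinForm ℝ (D.EX x)) {m : ℕ} (x₀ : X)
    (l : Fin m → ∀ x, D.LX x) (x : X) : D.EX x →ₗ[ℝ] G × (Fin m → ℝ) :=
  ((chartD G x₀ x).toLinearMap ∘ₗ D.rho x).prod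
    (LinearMap.pi fun k => (η x).flip (D.LtoE x (l k x)))

theorem splitCoord_apply {m : ℕ} (x₀ : X) (l : Fin m → ∀ x, D.LX x) (x : X) (w : D.EX x) :
    splitCoord η x₀ l x w = (chartD G x₀ x (D.rho x w), fun k => η x w (D.LtoE x (l k x))) := rfl

theorem splitCoord_injective {m : ℕ} {x₀ : X} {l : Fin m → ∀ x, D.LX x}
    (hl : Submodule.span ℝ (range fun i => l i x₀) = ⊤)
    (hL : ∀ ξ, (∀ ζ, D.restrictL η x₀ ξ ζ = 0) → ξ = 0) :
    Function.Injective (splitCoord η x₀ l x₀) := by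
  intro w w' hw
  rw [splitCoord_apply, splitCoord_apply] at hw
  have h1 : D.rho x₀ w = D.rho x₀ w' :=
    chartD_injective (mem_chart_source G x₀) (congrArg Prod.fst hw)
  have h2 : ∀ k, η x₀ w (D.LtoE x₀ (l k x₀)) = η x₀ w' (D.LtoE x₀ (l k x₀)) :=
    fun k => congrFun (congrArg Prod.snd hw) k
  have h3 : η x₀ w ∘ₗ D.LtoE x₀ = η x₀ w' ∘ₗ D.LtoE x₀ := LinearMap.ext_on_range hl h2
  exact eq_of_rho_eq_of_eq hL (fun ζ => DFunLike.congr_fun h3 ζ) h1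

theorem contMDiffAt_splitCoord (hη : IsScalarProductField (G := G) D.ΓEX η) {m : ℕ} {x₀ : X}
    {l : Fin m → ∀ x, D.LX x} (hl : ∀ k, l k ∈ D.ΓLX) {s : ∀ x, D.EX x} (hs : s ∈ D.ΓEX) :
    ContMDiffAt 𝓘(ℝ, G) 𝓘(ℝ, G × (Fin m → ℝ)) ∞ (fun x => splitCoord η x₀ l x (s x)) x₀ := by
  have h1 := D.contMDiffAt_chartD_rho (D.mem_ΓEX_iff.1 hs x₀)
  have h2 : ContMDiffAt 𝓘(ℝ, G) 𝓘(ℝ, Fin m → ℝ) ∞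
      (fun x k => η x (s x) (D.LtoE x (l k x))) x₀ :=
    contMDiffAt_pi_space.2 fun k =>
      (hη.smooth _ hs (fun x => D.LtoE x (l k x)) (hl k)).contMDiffAt
  exact h1.prodMk_space h2

/-- In these coordinates α(V) is (V, 0), which is smooth before anything is known about α. -/
theorem IsOrthogonalTriple.contMDiffAt_splitCoord_connection {t : D.Triple}
    (h : D.IsOrthogonalTriple η t) {V : ∀ x, TangentSpace 𝓘(ℝ, G) x} (hV : V ∈ D.ΓTX) (x₀ : X)
    {m : ℕ} (l : Fin m → ∀ x, D.LX x) :
    ContMDiffAt 𝓘(ℝ, G) 𝓘(ℝ, G × (Fin m → ℝ)) ∞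
      (fun x => splitCoord η x₀ l x (t.α x (V x))) x₀ := by
  have hw : ContMDiffAt 𝓘(ℝ, G) 𝓘(ℝ, G × (Fin m → ℝ)) ∞
      (fun x => (chartD G x₀ x (V x), (0 : Fin m → ℝ))) x₀ :=
    (D.contMDiffAt_chartD_of_mem_ΓTX hV x₀).prodMk_space contMDiffAt_const
  refine hw.congr_of_eventuallyEq (Filter.Eventually.of_forall fun x => ?_)
  refine (splitCoord_apply x₀ l x (t.α x (V x))).trans (Prod.ext ?_ ?_)
  · exact congrArg (chartD G x₀ x) (h.rho_connection x (V x))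
  · exact funext fun k => h.orthogonal x (V x) (l k x)

/-- The complement of `L_X` orthogonal for a smooth field of forms is smooth. -/
theorem IsOrthogonalTriple.smooth {t : D.Triple} (h : D.IsOrthogonalTriple η t)
    (hη : IsScalarProductField (G := G) D.ΓEX η)
    (hL : ∀ x ξ, (∀ ζ, D.restrictL η x ξ ζ = 0) → ξ = 0) {V : ∀ x, TangentSpace 𝓘(ℝ, G) x}
    (hV : V ∈ D.ΓTX) : (fun x => t.α x (V x)) ∈ D.ΓEX := by
  rw [D.mem_ΓEX_iff]
  intro x₀
  obtain ⟨s, hs, hli⟩ := exists_frame_EX (D := D) x₀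
  obtain ⟨l, hl, hspan⟩ := exists_frame_LX (D := D) x₀
  -- The smoothness of `c` offered here is discarded, as it presupposes that of α(V); it is obtained
  -- below from `splitCoord` instead.
  obtain ⟨c, hc, -⟩ := exists_coeff_EX rfl hs (linearIndependent_coe (D.EX x₀) hli)
    (fun x => t.α x (V x))
  refine contMDiffAt_EX_of_coeff hs (fun i => ?_) hc
  exact contMDiffAt_coeff_of_map (splitCoord η x₀ l)
    (fun i => contMDiffAt_splitCoord hη hl (hs i)) hli (splitCoord_injective hspan (hL x₀))
    (h.contMDiffAt_splitCoord_connection hV x₀ l) hc i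

theorem IsOrthogonalTriple.isAdmissible {t : D.Triple} (h : D.IsOrthogonalTriple η t)
    (hη : IsScalarProductField (G := G) D.ΓEX η)
    (hL : ∀ x ξ, (∀ ζ, D.restrictL η x ξ ζ = 0) → ξ = 0) : t.IsAdmissible := by
  have hα : ∀ V ∈ D.ΓTX, (fun x => t.α x (V x)) ∈ D.ΓEX := fun V hV => h.smooth hη hL hV
  refine ⟨⟨fun x u v => ?_, fun x u hu => ?_, fun U hU V hV => ?_⟩,
    D.isConnectionForm_iff.2 ⟨h.rho_connection, hα⟩, ⟨fun x ξ ζ => ?_, fun x ξ hξ => ?_,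
      fun s hs s' hs' => ?_⟩⟩
  · rw [h.metric, h.metric, hη.symm]
  -- If γ(u, ·) = 0, then α(u), having no component in L_X, is η-orthogonal to all of E_X.
  · have h0 : t.α x u = 0 := hη.nondegenerate x _ fun ζ => by
      rw [h.eta_apply hη.symm, projL_splitting, map_zero, LinearMap.zero_apply, add_zero,
        h.rho_connection, hu]
    rw [← h.rho_connection x u, h0, map_zero]
  · simp only [h.metric]
    exact hη.smooth _ (hα U hU) _ (hα V hV)
  · rw [h.scalar, restrictL_apply, restrictL_apply, hη.symm]
  · rw [h.scalar] at hξ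
    exact hL x ξ hξ
  · rw [h.scalar]
    exact hη.smooth (fun x => D.LtoE x (s x)) hs (fun x => D.LtoE x (s' x)) hs'

/-- The witness is η = ρ*γ + p*χ, with p the projection to L_X along α. Testing it against α(TX) and
against L_X separates the two summands and gives nondegeneracy. -/
theorem Triple.IsAdmissible.exists_eta {t : D.Triple} (ht : t.IsAdmissible) :
    ∃ η, IsScalarProductField (G := G) D.ΓEX η ∧ D.IsOrthogonalTriple η t := by
  obtain ⟨hα, hα'⟩ := D.isConnectionForm_iff.1 ht.connection
  let p := fun x => D.projL hα x
  let η : ∀ x, LinearMap.BilinForm ℝ (D.EX x) := fun x =>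
    (t.γ x).compl₁₂ (D.rho x) (D.rho x) + (t.χ x).compl₁₂ (p x) (p x)
  have hη : ∀ x ξ ζ, η x ξ ζ = t.γ x (D.rho x ξ) (D.rho x ζ) + t.χ x (p x ξ) (p x ζ) :=
    fun _ _ _ => rfl
  have hp : ∀ s ∈ D.ΓEX, (fun x => p x (s x)) ∈ D.ΓLX := by
    intro s hs
    rw [D.mem_ΓLX_iff]
    intro x₀
    have hf := D.contMDiff_pt.contMDiffAt (x := x₀)
    have hz := mem_chart_source E (D.pt x₀)
    have h1 := D.mem_ΓEX_iff.1 hs x₀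
    have h2 := D.mem_ΓEX_iff.1 (hα' _ (D.rho_mem_ΓTX hs)) x₀
    rw [contMDiffAt_cotan_iff hf hz] at h1 h2 ⊢
    exact h1.sub h2
  refine ⟨η, ⟨fun x ξ ζ => ?_, fun x ξ hξ => ?_, fun s hs s' hs' => ?_⟩,
    ⟨hα, fun x u ζ => ?_, fun x u v => ?_, ?_⟩⟩
  · rw [hη, hη, ht.metric.symm, ht.scalar.symm]
  · have h1 : D.rho x ξ = 0 := ht.metric.nondegenerate x _ fun u => by
      have h3 := hξ (t.α x u)
      simp only [hη, p] at h3
      rwa [projL_splitting, map_zero, add_zero, hα] at h3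
    have h2 : p x ξ = 0 := ht.scalar.nondegenerate x _ fun ζ => by
      have h3 := hξ (D.LtoE x ζ)
      simp only [hη, p] at h3
      rwa [projL_LtoE, D.rho_LtoE, map_zero, zero_add] at h3
    have h3 := LtoE_projL hα ξ
    have h4 : D.projL hα x ξ = 0 := h2
    rw [h4, h1, map_zero, map_zero, D.EX_sub_zero] at h3
    exact h3.symm
  · simp only [hη]
    exact (ht.metric.smooth _ (D.rho_mem_ΓTX hs) _ (D.rho_mem_ΓTX hs')).add
      (ht.scalar.smooth _ (hp s hs) _ (hp s' hs'))
  · simp only [hη, p]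
    rw [projL_splitting, D.rho_LtoE, map_zero, map_zero, LinearMap.zero_apply, add_zero]
  · simp only [hη, p]
    rw [projL_splitting, hα, hα, map_zero, LinearMap.zero_apply, add_zero]
  · funext x
    refine LinearMap.ext fun ξ => LinearMap.ext fun ζ => ?_
    rw [restrictL_apply, hη]
    simp only [p]
    rw [projL_LtoE, projL_LtoE, D.rho_LtoE, map_zero, LinearMap.zero_apply, zero_add]

end SmoothTriples

end LagrangianInLeaf

/-! ### Differentials of vector valued functions: product and chain rules -/

section DirectionalDerivative

variable {G : Type*} [NormedAddCommGroup G] [NormedSpace ℝ G]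
  {X : Type*} [TopologicalSpace X] [ChartedSpace G X]
  {W W₁ W₂ W₃ : Type*} [NormedAddCommGroup W] [NormedSpace ℝ W]
  [NormedAddCommGroup W₁] [NormedSpace ℝ W₁]
  [NormedAddCommGroup W₂] [NormedSpace ℝ W₂]
  [NormedAddCommGroup W₃] [NormedSpace ℝ W₃]

/-- The differential of a vector valued function on a manifold modelled on `G`. -/
def vdiff (G : Type*) [NormedAddCommGroup G] [NormedSpace ℝ G]
    {X : Type*} [TopologicalSpace X] [ChartedSpace G X]
    {W : Type*} [NormedAddCommGroup W] [NormedSpace ℝ W] (f : X → W) (x : X) :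
    TangentSpace 𝓘(ℝ, G) x →L[ℝ] W :=
  mfderiv 𝓘(ℝ, G) 𝓘(ℝ, W) f x

theorem vdiff_congr {f g : X → W} {x : X} (h : f =ᶠ[𝓝 x] g) : vdiff G f x = vdiff G g x :=
  h.mfderiv_eq

theorem vdiff_const (c : W) (x : X) : vdiff G (fun _ : X => c) x = 0 :=
  mfderiv_const

theorem hasMFDerivAt_vdiff {f : X → W} {x : X} (h : ContMDiffAt 𝓘(ℝ, G) 𝓘(ℝ, W) ∞ f x) :
    HasMFDerivAt 𝓘(ℝ, G) 𝓘(ℝ, W) f x (vdiff G f x) :=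
  (h.mdifferentiableAt (by decide)).hasMFDerivAt

theorem vdiff_clm (L : W₁ →L[ℝ] W₂) {f : X → W₁} {x : X}
    (h : ContMDiffAt 𝓘(ℝ, G) 𝓘(ℝ, W₁) ∞ f x) (v : TangentSpace 𝓘(ℝ, G) x) :
    vdiff G (fun y => L (f y)) x v = L (vdiff G f x v) :=
  DFunLike.congr_fun ((L.hasFDerivAt (x := f x)).hasMFDerivAt.comp x (hasMFDerivAt_vdiff h)).mfderiv
    v

theorem vdiff_bilinear (B : W₁ →L[ℝ] W₂ →L[ℝ] W₃) {f : X → W₁} {g : X → W₂} {x : X}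
    (hf : ContMDiffAt 𝓘(ℝ, G) 𝓘(ℝ, W₁) ∞ f x) (hg : ContMDiffAt 𝓘(ℝ, G) 𝓘(ℝ, W₂) ∞ g x)
    (v : TangentSpace 𝓘(ℝ, G) x) :
    vdiff G (fun y => B (f y) (g y)) x v = B (f x) (vdiff G g x v) + B (vdiff G f x v) (g x) := by
  have h1 := B.isBoundedBilinearMap.hasFDerivAt (f x, g x)
  have h2 : HasMFDerivAt 𝓘(ℝ, G) 𝓘(ℝ, W₁ × W₂) (fun y => (f y, g y)) x
      ((vdiff G f x).prod (vdiff G g x)) := by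
    rw [modelWithCornersSelf_prod, ← chartedSpaceSelf_prod]
    exact (hasMFDerivAt_vdiff hf).prodMk (hasMFDerivAt_vdiff hg)
  exact DFunLike.congr_fun (h1.hasMFDerivAt.comp x h2).mfderiv v

theorem vdiff_clm_apply {f : X → W₁ →L[ℝ] W₂} {g : X → W₁} {x : X}
    (hf : ContMDiffAt 𝓘(ℝ, G) 𝓘(ℝ, W₁ →L[ℝ] W₂) ∞ f x) (hg : ContMDiffAt 𝓘(ℝ, G) 𝓘(ℝ, W₁) ∞ g x)
    (v : TangentSpace 𝓘(ℝ, G) x) :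
    vdiff G (fun y => f y (g y)) x v = f x (vdiff G g x v) + vdiff G f x v (g x) :=
  vdiff_bilinear (ContinuousLinearMap.id ℝ (W₁ →L[ℝ] W₂)) hf hg v

theorem vdiff_clm_comp {f : X → W₂ →L[ℝ] W₃} {g : X → W₁ →L[ℝ] W₂} {x : X}
    (hf : ContMDiffAt 𝓘(ℝ, G) 𝓘(ℝ, W₂ →L[ℝ] W₃) ∞ f x)
    (hg : ContMDiffAt 𝓘(ℝ, G) 𝓘(ℝ, W₁ →L[ℝ] W₂) ∞ g x) (v : TangentSpace 𝓘(ℝ, G) x) :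
    vdiff G (fun y => (f y).comp (g y)) x v =
      (f x).comp (vdiff G g x v) + (vdiff G f x v).comp (g x) :=
  vdiff_bilinear (ContinuousLinearMap.compL ℝ W₁ W₂ W₃) hf hg v

theorem vdiff_comp {E Z : Type*} [NormedAddCommGroup E] [NormedSpace ℝ E] [TopologicalSpace Z]
    [ChartedSpace E Z] {p : X → Z} {f : Z → W} {x : X}
    (hf : ContMDiffAt 𝓘(ℝ, E) 𝓘(ℝ, W) ∞ f (p x)) (hp : ContMDiffAt 𝓘(ℝ, G) 𝓘(ℝ, E) ∞ p x)
    (v : TangentSpace 𝓘(ℝ, G) x) :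
    vdiff G (fun y => f (p y)) x v = vdiff E f (p x) (mfderiv 𝓘(ℝ, G) 𝓘(ℝ, E) p x v) :=
  DFunLike.congr_fun (((hasMFDerivAt_vdiff hf).comp x
    (hp.mdifferentiableAt (by decide)).hasMFDerivAt).mfderiv) v

end DirectionalDerivative

/-! ### One-forms and their exterior derivative in an arbitrary chart -/

section Forms

variable {E : Type*} [NormedAddCommGroup E] [NormedSpace ℝ E]
  {Z : Type*} [TopologicalSpace Z] [ChartedSpace E Z] [IsManifold 𝓘(ℝ, E) ∞ Z]

theorem vdiff_comp_extChartAt {W : Type*} [NormedAddCommGroup W] [NormedSpace ℝ W]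
    {h : E → W} {z₀ z : Z} (hz : z ∈ (chartAt E z₀).source)
    (hh : DifferentiableAt ℝ h (extChartAt 𝓘(ℝ, E) z₀ z)) (u : TangentSpace 𝓘(ℝ, E) z) :
    vdiff E (fun y => h (extChartAt 𝓘(ℝ, E) z₀ y)) z u =
      fderiv ℝ h (extChartAt 𝓘(ℝ, E) z₀ z) (chartD E z₀ z u) :=
  DFunLike.congr_fun (mfderiv_comp_extChartAt hz hh) u

theorem contDiffAt_comp_extChartAt_symm {W : Type*} [NormedAddCommGroup W] [NormedSpace ℝ W]
    {f : Z → W} {z₀ z : Z} (hz : z ∈ (chartAt E z₀).source)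
    (hf : ContMDiffAt 𝓘(ℝ, E) 𝓘(ℝ, W) ∞ f z) :
    ContDiffAt ℝ ∞ (fun e => f ((extChartAt 𝓘(ℝ, E) z₀).symm e)) (extChartAt 𝓘(ℝ, E) z₀ z) := by
  have hz' : z ∈ (extChartAt 𝓘(ℝ, E) z₀).source := by rwa [extChartAt_source]
  have h1 : ContMDiffAt 𝓘(ℝ, E) 𝓘(ℝ, E) ∞ (extChartAt 𝓘(ℝ, E) z₀).symm
      (extChartAt 𝓘(ℝ, E) z₀ z) :=
    (contMDiffOn_extChartAt_symm z₀).contMDiffAt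
      (extChartAt_target_mem_nhds' ((extChartAt 𝓘(ℝ, E) z₀).map_source hz'))
  rw [← contMDiffAt_iff_contDiffAt]
  refine ContMDiffAt.comp _ ?_ h1
  rwa [(extChartAt 𝓘(ℝ, E) z₀).left_inv hz']

theorem eventually_extChartAt_symm {z₀ z : Z} (hz : z ∈ (chartAt E z₀).source) :
    ∀ᶠ y in 𝓝 z, y ∈ (chartAt E z₀).source ∧
      (extChartAt 𝓘(ℝ, E) z₀).symm (extChartAt 𝓘(ℝ, E) z₀ y) = y := by
  filter_upwards [(chartAt E z₀).open_source.mem_nhds hz] with y hy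
  exact ⟨hy, (extChartAt 𝓘(ℝ, E) z₀).left_inv (by rwa [extChartAt_source])⟩

/-- The differential of a vector valued function, read in a chart. -/
theorem vdiff_eq_fderiv {W : Type*} [NormedAddCommGroup W] [NormedSpace ℝ W]
    {f : Z → W} {z₀ z : Z} (hz : z ∈ (chartAt E z₀).source)
    (hf : ContMDiffAt 𝓘(ℝ, E) 𝓘(ℝ, W) ∞ f z) (u : TangentSpace 𝓘(ℝ, E) z) :
    vdiff E f z u = fderiv ℝ (fun e => f ((extChartAt 𝓘(ℝ, E) z₀).symm e))
      (extChartAt 𝓘(ℝ, E) z₀ z) (chartD E z₀ z u) := by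
  rw [← vdiff_comp_extChartAt hz ((contDiffAt_comp_extChartAt_symm hz hf).differentiableAt
    (by decide)) u]
  refine DFunLike.congr_fun (vdiff_congr ?_) u
  filter_upwards [eventually_extChartAt_symm hz] with y hy
  exact (congrArg f hy.2).symm

theorem contMDiffAt_covRep {a : ∀ z : Z, Cotan E z} (ha : SmoothForm a) {z₀ z : Z}
    (hz : z ∈ (chartAt E z₀).source) :
    ContMDiffAt 𝓘(ℝ, E) 𝓘(ℝ, E →L[ℝ] ℝ) ∞ (fun y => covRep z₀ (a y)) z :=
  (contMDiffAt_cotan_iff (f := fun y : Z => y) contMDiffAt_id hz).1 (ha z)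

theorem formInChart_eq (a : ∀ z : Z, Cotan E z) {z : Z} {e : E}
    (he : e ∈ (extChartAt 𝓘(ℝ, E) z).target) :
    formInChart a z e = covRep z (a ((extChartAt 𝓘(ℝ, E) z).symm e)) := by
  have h := (extChartAt 𝓘(ℝ, E) z).right_inv he
  unfold formInChart covRep chartI
  rw [h]

theorem fderiv_formInChart {a : ∀ z : Z, Cotan E z} (ha : SmoothForm a) (z : Z)
    (u : TangentSpace 𝓘(ℝ, E) z) :
    fderiv ℝ (formInChart a z) (extChartAt 𝓘(ℝ, E) z z) u =
      vdiff E (fun y => covRep z (a y)) z u := by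
  have hz := mem_chart_source E z
  have h1 := vdiff_eq_fderiv hz (contMDiffAt_covRep ha hz) u
  rw [h1, chartD_self]
  refine DFunLike.congr_fun (Filter.EventuallyEq.fderiv_eq ?_) u
  filter_upwards [extChartAt_target_mem_nhds (I := 𝓘(ℝ, E)) z] with e he
  exact formInChart_eq a he

/-- The differential of the change of charts, at a point. -/
def chartChange (E : Type*) [NormedAddCommGroup E] [NormedSpace ℝ E]
    {Z : Type*} [TopologicalSpace Z] [ChartedSpace E Z] (z₀ z₁ z : Z) : E →L[ℝ] E :=
  (chartD E z₀ z).comp (chartI E z₁ z)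

theorem chartChange_eventuallyEq {z₀ z₁ z : Z} (hz : z ∈ (chartAt E z₀).source)
    (hz' : z ∈ (chartAt E z₁).source) :
    chartChange E z₀ z₁ =ᶠ[𝓝 z] fun y => fderiv ℝ
      (fun e => extChartAt 𝓘(ℝ, E) z₀ ((extChartAt 𝓘(ℝ, E) z₁).symm e))
        (extChartAt 𝓘(ℝ, E) z₁ y) := by
  filter_upwards [(chartAt E z₀).open_source.mem_nhds hz,
    (chartAt E z₁).open_source.mem_nhds hz'] with y hy hy'
  ext v
  have h := vdiff_eq_fderiv hy' (contMDiffAt_extChartAt_of_mem hy) (chartI E z₁ y v)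
  rw [chartD_chartI hy'] at h
  exact h

theorem contDiffAt_chartTransition {z₀ z₁ z : Z} (hz : z ∈ (chartAt E z₀).source)
    (hz' : z ∈ (chartAt E z₁).source) :
    ContDiffAt ℝ ∞ (fun e => extChartAt 𝓘(ℝ, E) z₀ ((extChartAt 𝓘(ℝ, E) z₁).symm e))
      (extChartAt 𝓘(ℝ, E) z₁ z) :=
  contDiffAt_comp_extChartAt_symm hz' (contMDiffAt_extChartAt_of_mem hz)

theorem contMDiffAt_chartChange {z₀ z₁ z : Z} (hz : z ∈ (chartAt E z₀).source)
    (hz' : z ∈ (chartAt E z₁).source) :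
    ContMDiffAt 𝓘(ℝ, E) 𝓘(ℝ, E →L[ℝ] E) ∞ (chartChange E z₀ z₁) z := by
  refine ContMDiffAt.congr_of_eventuallyEq ?_ (chartChange_eventuallyEq hz hz')
  exact ((contDiffAt_chartTransition hz hz').fderiv_right (m := ∞) (by decide)).contMDiffAt.comp z
    (contMDiffAt_extChartAt_of_mem hz')

/-- This is the second derivative of a transition map. Its symmetry makes the formula for the
exterior derivative independent of the chart. -/
theorem vdiff_chartChange_symm {z₀ z : Z} (hz : z ∈ (chartAt E z₀).source)
    (u v : TangentSpace 𝓘(ℝ, E) z) :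
    vdiff E (chartChange E z₀ z) z u v = vdiff E (chartChange E z₀ z) z v u := by
  have hz' := mem_chart_source E z
  have hc := contDiffAt_chartTransition hz hz'
  have h2 := hc.isSymmSndFDerivAt (by
    rw [minSmoothness_of_isRCLikeNormedField]; decide)
  have h1 : ∀ u v : TangentSpace 𝓘(ℝ, E) z, vdiff E (chartChange E z₀ z) z u v = fderiv ℝ (fderiv ℝ
      (fun e => extChartAt 𝓘(ℝ, E) z₀ ((extChartAt 𝓘(ℝ, E) z).symm e)))
        (extChartAt 𝓘(ℝ, E) z z) u v := fun u v => by
    rw [vdiff_congr (chartChange_eventuallyEq hz hz')]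
    have h3 := vdiff_comp_extChartAt hz'
      ((hc.fderiv_right (m := ∞) (by decide)).differentiableAt (by decide)) u
    rw [chartD_self] at h3
    exact DFunLike.congr_fun h3 v
  rw [h1, h1]
  exact h2 u v

theorem covRep_comp_chartChange {z₀ z₁ z : Z} (hz : z ∈ (chartAt E z₀).source) (ξ : Cotan E z) :
    (covRep z₀ ξ).comp (chartChange E z₀ z₁ z) = covRep z₁ ξ := by
  ext v
  exact covRep_chartD hz ξ (chartI E z₁ z v)

/-- The differential of a one-form in two charts. -/
theorem vdiff_covRep_self {a : ∀ z : Z, Cotan E z} (ha : SmoothForm a) {z₀ z : Z}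
    (hz : z ∈ (chartAt E z₀).source) (u v : TangentSpace 𝓘(ℝ, E) z) :
    vdiff E (fun y => covRep z (a y)) z u v =
      covRep z₀ (a z) (vdiff E (chartChange E z₀ z) z u v) +
        vdiff E (fun y => covRep z₀ (a y)) z u (chartD E z₀ z v) := by
  have h1 : (fun y => covRep z (a y)) =ᶠ[𝓝 z]
      fun y => (covRep z₀ (a y)).comp (chartChange E z₀ z y) := by
    filter_upwards [(chartAt E z₀).open_source.mem_nhds hz] with y hy
    exact (covRep_comp_chartChange hy (a y)).symm
  have h2 : chartChange E z₀ z z v = chartD E z₀ z v :=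
    congrArg (chartD E z₀ z) (chartI_self (E := E) z v)
  have h3 := vdiff_clm_comp (W₁ := E) (W₂ := E) (W₃ := ℝ) (contMDiffAt_covRep ha hz)
    (contMDiffAt_chartChange hz (mem_chart_source E z)) u
  rw [vdiff_congr h1, ← h2]
  exact DFunLike.congr_fun h3 v

/-- The exterior derivative of a one-form in a chart. -/
theorem extD_apply {a : ∀ z : Z, Cotan E z} (ha : SmoothForm a) {z₀ z : Z}
    (hz : z ∈ (chartAt E z₀).source) (u v : TangentSpace 𝓘(ℝ, E) z) :
    extD a z u v = vdiff E (fun y => covRep z₀ (a y)) z u (chartD E z₀ z v) -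
      vdiff E (fun y => covRep z₀ (a y)) z v (chartD E z₀ z u) := by
  have h1 : extD a z u v = fderiv ℝ (formInChart a z) (extChartAt 𝓘(ℝ, E) z z) u v -
      fderiv ℝ (formInChart a z) (extChartAt 𝓘(ℝ, E) z z) v u := by
    have h2 : extD a z u v = fderiv ℝ (formInChart a z) (extChartAt 𝓘(ℝ, E) z z)
        (chartD E z z u) (chartD E z z v) - fderiv ℝ (formInChart a z)
          (extChartAt 𝓘(ℝ, E) z z) (chartD E z z v) (chartD E z z u) := rfl
    rw [h2, chartD_self, chartD_self]
  -- Passing to the chart at `z₀` adds the same second-derivative term to both halves, and it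
  -- cancels in the difference.
  rw [h1, fderiv_formInChart ha, fderiv_formInChart ha, vdiff_covRep_self ha hz,
    vdiff_covRep_self ha hz, vdiff_chartChange_symm hz]
  exact add_sub_add_left_eq_sub _ _ _

theorem covRep_dFun_eventuallyEq {H : Z → ℝ} (hH : ContMDiff 𝓘(ℝ, E) 𝓘(ℝ, ℝ) ∞ H) {z₀ z : Z}
    (hz : z ∈ (chartAt E z₀).source) :
    (fun y => covRep z₀ (dFun E H y)) =ᶠ[𝓝 z] fun y => fderiv ℝ
      (fun e => H ((extChartAt 𝓘(ℝ, E) z₀).symm e)) (extChartAt 𝓘(ℝ, E) z₀ y) := by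
  filter_upwards [(chartAt E z₀).open_source.mem_nhds hz] with y hy
  ext v
  have h := vdiff_eq_fderiv hy (hH y) (chartI E z₀ y v)
  rw [chartD_chartI hy] at h
  exact h

theorem smoothForm_dFun {H : Z → ℝ} (hH : ContMDiff 𝓘(ℝ, E) 𝓘(ℝ, ℝ) ∞ H) :
    SmoothForm (dFun E H) := by
  intro z
  have hz := mem_chart_source E z
  refine (contMDiffAt_cotan_iff (f := fun y : Z => y) contMDiffAt_id hz).2 ?_
  refine ContMDiffAt.congr_of_eventuallyEq ?_ (covRep_dFun_eventuallyEq hH hz)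
  exact ((contDiffAt_comp_extChartAt_symm hz (hH z)).fderiv_right (m := ∞)
    (by decide)).contMDiffAt.comp z (contMDiffAt_extChartAt_of_mem hz)

theorem vdiff_covRep_dFun {H : Z → ℝ} (hH : ContMDiff 𝓘(ℝ, E) 𝓘(ℝ, ℝ) ∞ H) {z₀ z : Z}
    (hz : z ∈ (chartAt E z₀).source) (u : TangentSpace 𝓘(ℝ, E) z) :
    vdiff E (fun y => covRep z₀ (dFun E H y)) z u = fderiv ℝ (fderiv ℝ
      (fun e => H ((extChartAt 𝓘(ℝ, E) z₀).symm e))) (extChartAt 𝓘(ℝ, E) z₀ z)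
        (chartD E z₀ z u) := by
  rw [vdiff_congr (covRep_dFun_eventuallyEq hH hz)]
  exact vdiff_comp_extChartAt hz (((contDiffAt_comp_extChartAt_symm hz (hH z)).fderiv_right
    (m := ∞) (by decide)).differentiableAt (by decide)) u

end Forms

/-! ### The tangent map of a one-form into the cotangent bundle -/

section SectionDerivative

variable {E : Type*} [NormedAddCommGroup E] [NormedSpace ℝ E]
  {Z : Type*} [TopologicalSpace Z] [ChartedSpace E Z] [IsManifold 𝓘(ℝ, E) ∞ Z]

/-- The chart of T*Z depends only on the base point `z₀`; the covector ξ₀ plays no role in it. -/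
theorem extChartAt_cotPoint {z₀ z : Z} (hz : z ∈ (chartAt E z₀).source) (ξ₀ : Cotan E z₀)
    (ξ : Cotan E z) :
    extChartAt (𝓘(ℝ, E).prod 𝓘(ℝ, E →L[ℝ] ℝ)) (cotPoint z₀ ξ₀) (cotPoint z ξ) =
      (extChartAt 𝓘(ℝ, E) z₀ z, covRep z₀ ξ) := by
  have h2 := trivializationAt_cotan hz ξ
  have h1 : (trivializationAt (E →L[ℝ] ℝ) (fun z : Z => Cotan E z) z₀ (cotPoint z ξ)).1 = z :=
    Trivialization.coe_fst' _ (by exact ⟨by simpa [cotPoint] using hz, trivial⟩)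
  rw [FiberBundle.extChartAt]
  refine Prod.ext ?_ ?_
  · exact congrArg (extChartAt 𝓘(ℝ, E) z₀) h1
  · exact h2

/-- The differential of a one-form, as a map to the cotangent bundle. -/
theorem mfderiv_cotPoint {a : ∀ z : Z, Cotan E z} (ha : SmoothForm a) (z : Z)
    (u : TangentSpace 𝓘(ℝ, E) z) :
    (mfderiv 𝓘(ℝ, E) (𝓘(ℝ, E).prod 𝓘(ℝ, E →L[ℝ] ℝ)) (fun z : Z => cotPoint z (a z)) z u :
      E × (E →L[ℝ] ℝ)) = (u, vdiff E (fun y => covRep z (a y)) z u) := by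
  have hz := mem_chart_source E z
  have h1 := ((ha z).mdifferentiableAt (by decide)).mfderiv
  have hc := contDiffAt_comp_extChartAt_symm hz (contMDiffAt_covRep ha hz)
  have h2 : writtenInExtChartAt 𝓘(ℝ, E) (𝓘(ℝ, E).prod 𝓘(ℝ, E →L[ℝ] ℝ)) z
      (fun z : Z => cotPoint z (a z)) =ᶠ[𝓝 (extChartAt 𝓘(ℝ, E) z z)] fun e =>
        (e, covRep z (a ((extChartAt 𝓘(ℝ, E) z).symm e))) := by
    filter_upwards [extChartAt_target_mem_nhds (I := 𝓘(ℝ, E)) z] with e he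
    have h3 := (extChartAt 𝓘(ℝ, E) z).map_target he
    rw [extChartAt_source] at h3
    refine (extChartAt_cotPoint h3 (a z) (a ((extChartAt 𝓘(ℝ, E) z).symm e))).trans ?_
    rw [(extChartAt 𝓘(ℝ, E) z).right_inv he]
  simp only [modelWithCornersSelf_coe, range_id, fderivWithin_univ] at h1
  have h3 : fderiv ℝ (writtenInExtChartAt 𝓘(ℝ, E) (𝓘(ℝ, E).prod 𝓘(ℝ, E →L[ℝ] ℝ)) z
      (fun z : Z => cotPoint z (a z))) (extChartAt 𝓘(ℝ, E) z z) =
      (ContinuousLinearMap.id ℝ E).prod (fderiv ℝ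
        (fun e => covRep z (a ((extChartAt 𝓘(ℝ, E) z).symm e))) (extChartAt 𝓘(ℝ, E) z z)) :=
    ((hasFDerivAt_id _).prodMk (hc.differentiableAt (by decide)).hasFDerivAt).fderiv.symm ▸
      h2.fderiv_eq
  refine (DFunLike.congr_fun (h1.trans h3) u).trans ?_
  refine Prod.ext rfl ?_
  have h4 := vdiff_eq_fderiv hz (contMDiffAt_covRep ha hz) u
  rw [chartD_self] at h4
  exact h4.symm

theorem mfderiv_zero_cotPoint (z : Z) (u : TangentSpace 𝓘(ℝ, E) z) :
    (mfderiv 𝓘(ℝ, E) (𝓘(ℝ, E).prod 𝓘(ℝ, E →L[ℝ] ℝ)) (fun z : Z => cotPoint z (0 : Cotan E z)) z u :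
      E × (E →L[ℝ] ℝ)) = (u, 0) := by
  have h := mfderiv_cotPoint (E := E) (Z := Z) (a := fun _ => 0)
    (fun z => contMDiffAt_zero_cotan (f := fun z : Z => z) contMDiffAt_id) z u
  refine h.trans (Prod.ext rfl ?_)
  exact DFunLike.congr_fun (vdiff_const (G := E) (0 : E →L[ℝ] ℝ) z) u

/-- The differential of the inclusion of a fibre of the cotangent bundle. -/
theorem mfderiv_cotPoint_fibre (z : Z) (ξ : E →L[ℝ] ℝ) :
    (mfderiv 𝓘(ℝ, E →L[ℝ] ℝ) (𝓘(ℝ, E).prod 𝓘(ℝ, E →L[ℝ] ℝ))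
        (fun ξ : E →L[ℝ] ℝ => cotPoint z (ξ : Cotan E z)) 0 ξ : E × (E →L[ℝ] ℝ)) = (0, ξ) := by
  have hz := mem_chart_source E z
  have h0 : ContMDiffAt 𝓘(ℝ, E →L[ℝ] ℝ) (𝓘(ℝ, E).prod 𝓘(ℝ, E →L[ℝ] ℝ)) ∞
      (fun ξ : E →L[ℝ] ℝ => cotPoint z (ξ : Cotan E z)) 0 := by
    refine (contMDiffAt_cotan_iff (f := fun _ : E →L[ℝ] ℝ => z) contMDiffAt_const hz).2 ?_
    exact contMDiffAt_id.congr_of_eventuallyEq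
      (Filter.Eventually.of_forall fun ξ => covRep_self (ξ : Cotan E z))
  have h1 := (h0.mdifferentiableAt (by decide)).mfderiv
  simp only [modelWithCornersSelf_coe, range_id, fderivWithin_univ] at h1
  have h2 : writtenInExtChartAt 𝓘(ℝ, E →L[ℝ] ℝ) (𝓘(ℝ, E).prod 𝓘(ℝ, E →L[ℝ] ℝ)) 0
      (fun ξ : E →L[ℝ] ℝ => cotPoint z (ξ : Cotan E z)) = fun ξ =>
        (extChartAt 𝓘(ℝ, E) z z, ξ) := by
    funext ξ
    exact (extChartAt_cotPoint hz _ _).trans (Prod.ext rfl (covRep_self (ξ : Cotan E z)))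
  rw [h2] at h1
  have h3 : fderiv ℝ (fun ξ : E →L[ℝ] ℝ => (extChartAt 𝓘(ℝ, E) z z, ξ))
      (extChartAt 𝓘(ℝ, E →L[ℝ] ℝ) (0 : E →L[ℝ] ℝ) 0) = ContinuousLinearMap.inr ℝ E (E →L[ℝ] ℝ) :=
    ((hasFDerivAt_const _ _).prodMk (hasFDerivAt_id _)).fderiv
  exact DFunLike.congr_fun (h1.trans h3) ξ

end SectionDerivative

/-- Reduces the equation T(dH)u = To(u) + (vertical part) to its fibre component. -/
theorem eq_add_iff_of_eq_mk {A B : Type*} [AddCommGroup A] [AddCommGroup B] {p q r : A × B} {u : A}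
    {ξ ζ : B} (hp : p = (u, ξ)) (hq : q = (u, 0)) (hr : r = (0, ζ)) : p = q + r ↔ ξ = ζ := by
  rw [hp, hq, hr, Prod.mk_add_mk, add_zero, zero_add, Prod.mk.injEq]
  exact and_iff_right rfl

/-! ### The vertical Hessian -/

namespace LagrangianInLeaf

section Hessian

variable {E F G : Type*}
  [NormedAddCommGroup E] [NormedSpace ℝ E]
  [NormedAddCommGroup F] [NormedSpace ℝ F]
  [NormedAddCommGroup G] [NormedSpace ℝ G]
  {Z : Type u} [TopologicalSpace Z] [ChartedSpace E Z]
  {S : Type*} [TopologicalSpace S] [ChartedSpace F S]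
  {X : Type*} [TopologicalSpace X] [ChartedSpace G X]
  [IsManifold 𝓘(ℝ, E) ∞ Z] [FiniteDimensional ℝ E]
  (D : LagrangianInLeaf E F G Z S X) {H : Z → ℝ}

/-- The second derivative of `H` at a point of `X`, in the chart at that point. -/
def hessian (D : LagrangianInLeaf E F G Z S X) (H : Z → ℝ) (x : X) :
    TangentSpace 𝓘(ℝ, E) (D.pt x) →L[ℝ] Cotan E (D.pt x) :=
  vdiff E (fun y => covRep (D.pt x) (dFun E H y)) (D.pt x)

theorem hessian_symm (hH : ContMDiff 𝓘(ℝ, E) 𝓘(ℝ, ℝ) ∞ H) (x : X)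
    (u v : TangentSpace 𝓘(ℝ, E) (D.pt x)) : D.hessian H x u v = D.hessian H x v u := by
  have hz := mem_chart_source E (D.pt x)
  have h := (contDiffAt_comp_extChartAt_symm hz (hH (D.pt x))).isSymmSndFDerivAt (by
    rw [minSmoothness_of_isRCLikeNormedField]; decide)
  have h1 : ∀ u v, D.hessian H x u v = fderiv ℝ (fderiv ℝ
      (fun e => H ((extChartAt 𝓘(ℝ, E) (D.pt x)).symm e)))
        (extChartAt 𝓘(ℝ, E) (D.pt x) (D.pt x)) u v := fun u v => by
    have h2 := vdiff_covRep_dFun hH hz u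
    rw [chartD_self] at h2
    exact DFunLike.congr_fun h2 v
  rw [h1, h1]
  exact h u v

/-- The function dH in coordinates is constantly zero along X, and the chain rule gives its
derivative in the directions of TX. -/
theorem hessian_TXZ (hH : ContMDiff 𝓘(ℝ, E) 𝓘(ℝ, ℝ) ∞ H) (hcrit : ∀ x : X, dFun E H (D.pt x) = 0)
    (x : X) (w : TangentSpace 𝓘(ℝ, G) x) : D.hessian H x (D.TXZ x w) = 0 := by
  have hz := mem_chart_source E (D.pt x)
  have h1 := vdiff_comp (contMDiffAt_covRep (smoothForm_dFun hH) hz)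
    (D.contMDiff_pt.contMDiffAt (x := x)) w
  rw [D.mfderiv_pt] at h1
  refine h1.symm.trans ?_
  have h2 : (fun y => covRep (D.pt x) (dFun E H (D.pt y))) = fun _ => 0 := by
    funext y
    rw [hcrit]
    rfl
  rw [h2]
  exact DFunLike.congr_fun (vdiff_const _ _) w

theorem isVerticalHessian_iff (hH : ContMDiff 𝓘(ℝ, E) 𝓘(ℝ, ℝ) ∞ H)
    {j : ∀ x, LinearMap.BilinForm ℝ (D.EStar x)} : D.IsVerticalHessian H j ↔
      ∀ x u v, j x (D.toEStar x u) (D.toEStar x v) = D.hessian H x u v := by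
  refine forall_congr' fun x => forall_congr' fun u => ?_
  have h1 := mfderiv_cotPoint (smoothForm_dFun hH) (D.pt x) u
  have h2 := mfderiv_zero_cotPoint (E := E) (D.pt x) u
  have h3 := mfderiv_cotPoint_fibre (E := E) (D.pt x)
    (D.sharp j x (D.toEStar x u) : Cotan E (D.pt x))
  refine (eq_add_iff_of_eq_mk (A := E) (B := E →L[ℝ] ℝ) h1 h2 h3).trans ⟨fun h v => ?_, fun h => ?_⟩
  · exact (DFunLike.congr_fun h v).symm
  · refine ContinuousLinearMap.ext fun v => ?_
    exact (h v).symm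

theorem exists_isVerticalHessian (hH : ContMDiff 𝓘(ℝ, E) 𝓘(ℝ, ℝ) ∞ H)
    (hcrit : ∀ x : X, dFun E H (D.pt x) = 0) : ∃ j, D.IsVerticalHessian H j := by
  have h0 : ∀ x u, D.toEStar x u = 0 → D.hessian H x u = 0 := fun x u hu => by
    obtain ⟨w, rfl⟩ := D.toEStar_eq_zero_iff.1 hu
    exact D.hessian_TXZ hH hcrit x w
  choose s hs using fun x => (D.toEStar x).exists_rightInverse_of_surjective
    (LinearMap.range_eq_top.2 (D.toEStar_surjective x))
  have hs' : ∀ x q, D.toEStar x (s x q) = q := fun x q => DFunLike.congr_fun (hs x) q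
  have h1 : ∀ x u, D.hessian H x (s x (D.toEStar x u)) = D.hessian H x u := fun x u => by
    have h2 := h0 x (s x (D.toEStar x u) - u) (by rw [map_sub, hs', sub_self])
    rwa [map_sub, sub_eq_zero] at h2
  let B : ∀ x, TangentSpace 𝓘(ℝ, E) (D.pt x) →ₗ[ℝ] TangentSpace 𝓘(ℝ, E) (D.pt x) →ₗ[ℝ] ℝ :=
    fun x => LinearMap.mk₂ ℝ (fun u v => D.hessian H x u v)
      (fun u u' v => by rw [map_add]; rfl) (fun c u v => by rw [map_smul]; rfl)
      (fun u v v' => map_add _ _ _) (fun c u v => map_smul _ _ _)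
  refine ⟨fun x => (B x).compl₁₂ (s x) (s x), (D.isVerticalHessian_iff hH).2 fun x u v => ?_⟩
  change D.hessian H x (s x (D.toEStar x u)) (s x (D.toEStar x v)) = _
  -- Vectors tangent to X are visibly killed only in the first argument; symmetry transfers this to
  -- the second one.
  rw [h1, D.hessian_symm hH, h1, D.hessian_symm hH]

theorem IsVerticalHessian.unique (hH : ContMDiff 𝓘(ℝ, E) 𝓘(ℝ, ℝ) ∞ H)
    {j j' : ∀ x, LinearMap.BilinForm ℝ (D.EStar x)} (h : D.IsVerticalHessian H j)
    (h' : D.IsVerticalHessian H j') : j' = j := by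
  rw [D.isVerticalHessian_iff hH] at h h'
  funext x
  refine LinearMap.ext fun q => LinearMap.ext fun q' => ?_
  obtain ⟨u, rfl⟩ := D.toEStar_surjective x q
  obtain ⟨v, rfl⟩ := D.toEStar_surjective x q'
  rw [h, h']

theorem IsVerticalHessian.isSymmetricSection [IsManifold 𝓘(ℝ, G) ∞ X]
    (hH : ContMDiff 𝓘(ℝ, E) 𝓘(ℝ, ℝ) ∞ H) (hcrit : ∀ x : X, dFun E H (D.pt x) = 0)
    {j : ∀ x, LinearMap.BilinForm ℝ (D.EStar x)} (h : D.IsVerticalHessian H j) :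
    D.IsSymmetricSection j := by
  rw [D.isVerticalHessian_iff hH] at h
  refine ⟨fun x q q' => ?_, fun U hU V hV x₀ => ?_⟩
  · obtain ⟨u, rfl⟩ := D.toEStar_surjective x q
    obtain ⟨v, rfl⟩ := D.toEStar_surjective x q'
    rw [h, h, D.hessian_symm hH]
  · have hz := mem_chart_source E (D.pt x₀)
    have hf := D.contMDiff_pt.contMDiffAt (x := x₀)
    have hev : ∀ᶠ y in 𝓝 x₀, D.pt y ∈ (chartAt E (D.pt x₀)).source :=
      hf.continuousAt.eventually ((chartAt E (D.pt x₀)).open_source.mem_nhds hz)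
    have hc := contDiffAt_comp_extChartAt_symm hz (hH (D.pt x₀))
    have h1 : ContMDiffAt 𝓘(ℝ, G) 𝓘(ℝ, E →L[ℝ] E →L[ℝ] ℝ) ∞ (fun x => fderiv ℝ (fderiv ℝ
        (fun e => H ((extChartAt 𝓘(ℝ, E) (D.pt x₀)).symm e)))
          (extChartAt 𝓘(ℝ, E) (D.pt x₀) (D.pt x))) x₀ :=
      ContMDiffAt.comp (g := fun z => fderiv ℝ (fderiv ℝ
        (fun e => H ((extChartAt 𝓘(ℝ, E) (D.pt x₀)).symm e)))
          (extChartAt 𝓘(ℝ, E) (D.pt x₀) z)) x₀ (((hc.fderiv_right (m := ∞) (by decide)).fderiv_right (m := ∞)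
        (by decide)).contMDiffAt.comp (D.pt x₀) (contMDiffAt_extChartAt_of_mem hz)) hf
    have h2 := (contMDiffAt_tangent_iff hf hz).1 (hU x₀)
    have h3 := (contMDiffAt_tangent_iff hf hz).1 (hV x₀)
    refine ((h1.clm_apply h2).clm_apply h3).congr_of_eventuallyEq ?_
    filter_upwards [hev] with x hx
    rw [h]
    -- The Hessian at x is defined in the chart at x. Passing to the fixed chart at x₀ costs a term
    -- containing dH at x, which vanishes on X.
    refine (vdiff_covRep_self (smoothForm_dFun hH) hx (U x) (V x)).trans ?_
    have h4 : covRep (D.pt x₀) (dFun E H (D.pt x)) = 0 := by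
      rw [hcrit]
      rfl
    rw [h4, zero_apply, zero_add, vdiff_covRep_dFun hH hx]

end Hessian

end LagrangianInLeaf

/-! ### The brackets and the Jacobi identity in a chart -/

section LocalBracket

variable {E : Type*} [NormedAddCommGroup E] [NormedSpace ℝ E] [FiniteDimensional ℝ E]
  {Z : Type*} [TopologicalSpace Z] [ChartedSpace E Z] [IsManifold 𝓘(ℝ, E) ∞ Z] [T2Space Z]
  (P : PoissonStructure E Z) {z₀ z : Z}

theorem PoissonStructure.pairing_eventuallyEq (hz : z ∈ (chartAt E z₀).source)
    (a b : ∀ z : Z, Cotan E z) : (fun y => a y (P.sharp y (b y))) =ᶠ[𝓝 z]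
      fun y => covRep z₀ (a y) (P.rep z₀ y (covRep z₀ (b y))) := by
  filter_upwards [(chartAt E z₀).open_source.mem_nhds hz] with y hy
  rw [P.rep_covRep hy, covRep_chartD hy]

/-- The differential of the pairing of two one-forms by the Poisson structure, in a chart. -/
theorem PoissonStructure.dFun_pairing (hz : z ∈ (chartAt E z₀).source) {a b : ∀ z : Z, Cotan E z}
    (ha : SmoothForm a) (hb : SmoothForm b) (v : TangentSpace 𝓘(ℝ, E) z) :
    dFun E (fun y => a y (P.sharp y (b y))) z v =
      -vdiff E (fun y => covRep z₀ (b y)) z v (chartD E z₀ z (P.sharp z (a z))) +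
        covRep z₀ (a z) (vdiff E (P.rep z₀) z v (covRep z₀ (b z))) +
        vdiff E (fun y => covRep z₀ (a y)) z v (chartD E z₀ z (P.sharp z (b z))) := by
  have h1 : dFun E (fun y => a y (P.sharp y (b y))) z v =
      vdiff E (fun y => covRep z₀ (a y) (P.rep z₀ y (covRep z₀ (b y)))) z v :=
    DFunLike.congr_fun (dFun_congr (P.pairing_eventuallyEq hz a b)) v
  have h2 := (P.contMDiffAt_rep hz).clm_apply (contMDiffAt_covRep hb hz)
  rw [h1, vdiff_clm_apply (contMDiffAt_covRep ha hz) h2,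
    vdiff_clm_apply (P.contMDiffAt_rep hz) (contMDiffAt_covRep hb hz), map_add, P.skew_rep,
    P.rep_covRep hz, P.rep_covRep hz]

/-- The bracket of one-forms in a chart. -/
theorem PoissonStructure.formBracket_apply (hz : z ∈ (chartAt E z₀).source)
    {a b : ∀ z : Z, Cotan E z} (ha : SmoothForm a) (hb : SmoothForm b)
    (v : TangentSpace 𝓘(ℝ, E) z) :
    P.formBracket a b z v =
      vdiff E (fun y => covRep z₀ (a y)) z (P.sharp z (b z)) (chartD E z₀ z v) -
        vdiff E (fun y => covRep z₀ (b y)) z (P.sharp z (a z)) (chartD E z₀ z v) +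
        covRep z₀ (a z) (vdiff E (P.rep z₀) z v (covRep z₀ (b z))) := by
  have h1 : P.formBracket a b z v = extD a z (P.sharp z (b z)) v - extD b z (P.sharp z (a z)) v +
    dFun E (fun y => a y (P.sharp y (b y))) z v := rfl
  -- The second halves of da and db cancel with the derivatives of a and b in d(ϖ(a, b)); of the
  -- latter only the derivative of ϖ survives.
  rw [h1, extD_apply ha hz, extD_apply hb hz, P.dFun_pairing hz ha hb]
  ring

/-- The derivative of the Poisson structure read in the chart centred at `z₀`, in the direction of
the Hamiltonian vector `w♯ ζ`. -/
theorem PoissonStructure.jacobi_rep (hz : z ∈ (chartAt E z₀).source) (ξ η ζ : E →L[ℝ] ℝ) :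
    η (vdiff E (P.rep z₀) z (chartI E z₀ z (P.rep z₀ z ξ)) ζ) +
      ζ (vdiff E (P.rep z₀) z (chartI E z₀ z (P.rep z₀ z η)) ξ) +
      ξ (vdiff E (P.rep z₀) z (chartI E z₀ z (P.rep z₀ z ζ)) η) = 0 := by
  -- For functions linear in the chart the differentials are constant, so an iterated bracket
  -- differentiates only the Poisson tensor.
  have key : ∀ ξ η ζ : E →L[ℝ] ℝ, ∀ f g h : Z → ℝ,
      (∀ᶠ y in 𝓝 z, dFun E f y = ξ.comp (chartD E z₀ y)) →
      (∀ᶠ y in 𝓝 z, dFun E g y = η.comp (chartD E z₀ y)) →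
      (∀ᶠ y in 𝓝 z, dFun E h y = ζ.comp (chartD E z₀ y)) →
      dFun E f z (P.sharp z (dFun E (fun y => dFun E g y (P.sharp y (dFun E h y))) z)) =
        -η (vdiff E (P.rep z₀) z (chartI E z₀ z (P.rep z₀ z ξ)) ζ) := by
    intro ξ η ζ f g h hf hg hh
    have h1 : (fun y => dFun E g y (P.sharp y (dFun E h y))) =ᶠ[𝓝 z]
        fun y => η (P.rep z₀ y ζ) := by
      filter_upwards [hg, hh] with y hy hy'
      rw [hy, hy']
      rfl
    have h2 := P.contMDiffAt_rep hz
    have h3 : ∀ w, dFun E (fun y => dFun E g y (P.sharp y (dFun E h y))) z w =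
        η (vdiff E (P.rep z₀) z w ζ) := fun w => by
      have h5 : ContMDiffAt 𝓘(ℝ, E) 𝓘(ℝ, E →L[ℝ] ℝ) ∞ (fun _ : Z => ζ) z := contMDiffAt_const
      have h4 := vdiff_clm η (h2.clm_apply h5) w
      rw [vdiff_clm_apply h2 h5, vdiff_const, zero_apply, map_zero, zero_add] at h4
      exact (DFunLike.congr_fun (dFun_congr h1) w).trans h4
    rw [P.skew, h3, hf.self_of_nhds, P.rep_apply, chartI_chartD hz]
  obtain ⟨f, hf, hf'⟩ := exists_linear_coordinate hz ξ
  obtain ⟨g, hg, hg'⟩ := exists_linear_coordinate hz η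
  obtain ⟨h, hh, hh'⟩ := exists_linear_coordinate hz ζ
  have h1 := P.jacobi f g h hf hg hh z
  rw [key ξ η ζ f g h hf' hg' hh', key η ζ ξ g h f hg' hh' hf', key ζ ξ η h f g hh' hf' hg'] at h1
  linarith

theorem funWith_spec (z : Z) (ξ : Cotan E z) :
    ContMDiff 𝓘(ℝ, E) 𝓘(ℝ, ℝ) ∞ (funWith z ξ) ∧ dFun E (funWith z ξ) z = ξ := by
  refine Classical.epsilon_spec
    (p := fun f => ContMDiff 𝓘(ℝ, E) 𝓘(ℝ, ℝ) ∞ f ∧ dFun E f z = ξ) ?_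
  have hz := mem_chart_source E z
  obtain ⟨f, hf, hf'⟩ := exists_linear_coordinate hz (covRep z ξ)
  exact ⟨f, hf, hf'.self_of_nhds.trans (comp_chartD_covRep hz ξ)⟩

/-- The isotropy bracket in a chart. -/
theorem PoissonStructure.isotropyBracket_apply (hz : z ∈ (chartAt E z₀).source) {ξ ζ : Cotan E z}
    (hξ : P.sharp z ξ = 0) (hζ : P.sharp z ζ = 0) (v : TangentSpace 𝓘(ℝ, E) z) :
    P.isotropyBracket z ξ ζ v = covRep z₀ ξ (vdiff E (P.rep z₀) z v (covRep z₀ ζ)) := by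
  obtain ⟨h1, h2⟩ := funWith_spec z ξ
  obtain ⟨h3, h4⟩ := funWith_spec z ζ
  have h5 := P.dFun_pairing hz (smoothForm_dFun h1) (smoothForm_dFun h3) v
  -- The derivatives of df and dg are paired with ϖ♯ζ = ϖ♯ξ = 0, so the bracket depends only on the
  -- two covectors.
  rw [h2, h4, hξ, hζ, map_zero, map_zero, map_zero, neg_zero, zero_add, add_zero] at h5
  exact h5

end LocalBracket

/-! ### Algebraic consequences of the Jacobi identity and of its derivative -/

section LocalModel

variable {E : Type*} [NormedAddCommGroup E] [NormedSpace ℝ E]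

/-- The bracket `[ξ, ζ](e) = ξ (Q_e ζ)` of linear forms, where `Q` is the derivative of a Poisson
structure on an open subset of a vector space. -/
def linBracket (Q : E →L[ℝ] (E →L[ℝ] ℝ) →L[ℝ] E) (ξ ζ : E →L[ℝ] ℝ) : E →L[ℝ] ℝ :=
  ξ.comp (Q.flip ζ)

theorem linBracket_apply (Q : E →L[ℝ] (E →L[ℝ] ℝ) →L[ℝ] E) (ξ ζ : E →L[ℝ] ℝ) (e : E) :
    linBracket Q ξ ζ e = ξ (Q e ζ) := rfl

theorem linBracket_add_right (Q : E →L[ℝ] (E →L[ℝ] ℝ) →L[ℝ] E) (ξ ζ ζ' : E →L[ℝ] ℝ) :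
    linBracket Q ξ (ζ + ζ') = linBracket Q ξ ζ + linBracket Q ξ ζ' := by
  ext e
  simp only [linBracket_apply, add_apply, map_add]

theorem linBracket_smul_right (Q : E →L[ℝ] (E →L[ℝ] ℝ) →L[ℝ] E) (c : ℝ) (ξ ζ : E →L[ℝ] ℝ) :
    linBracket Q ξ (c • ζ) = c • linBracket Q ξ ζ := by
  ext e
  simp only [linBracket_apply, smul_apply, map_smul]

theorem linBracket_add_left (Q : E →L[ℝ] (E →L[ℝ] ℝ) →L[ℝ] E) (ξ ξ' ζ : E →L[ℝ] ℝ) :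
    linBracket Q (ξ + ξ') ζ = linBracket Q ξ ζ + linBracket Q ξ' ζ := rfl

theorem linBracket_smul_left (Q : E →L[ℝ] (E →L[ℝ] ℝ) →L[ℝ] E) (c : ℝ) (ξ ζ : E →L[ℝ] ℝ) :
    linBracket Q (c • ξ) ζ = c • linBracket Q ξ ζ := rfl

section

variable {K : Type*} [NormedAddCommGroup K] [NormedSpace ℝ K] {p : E → K →L[ℝ] E} {e₀ : E}

theorem hasFDerivAt_apply_const (hp : DifferentiableAt ℝ p e₀) (ξ : E →L[ℝ] ℝ) (ζ : K) :
    HasFDerivAt (fun e => ξ (p e ζ)) (ξ.comp ((fderiv ℝ p e₀).flip ζ)) e₀ := by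
  have h1 := hp.hasFDerivAt.clm_apply (hasFDerivAt_const ζ e₀)
  have h2 := ξ.hasFDerivAt.comp e₀ h1
  refine h2.congr_fderiv ?_
  ext e
  simp

/-- For fixed ξ and ζ the skew-symmetry is an identity of functions of e, hence may be
differentiated. The map `ev` reads elements of K as covectors. -/
theorem fderiv_apply_skew (hp : DifferentiableAt ℝ p e₀) {ev : K → E →L[ℝ] ℝ}
    (hskew : ∀ e ξ ζ, ev ξ (p e ζ) = -ev ζ (p e ξ)) (w : E) (ξ ζ : K) :
    ev ξ (fderiv ℝ p e₀ w ζ) = -ev ζ (fderiv ℝ p e₀ w ξ) := by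
  have h2 := (hasFDerivAt_apply_const hp (ev ζ) ξ).neg.congr_of_eventuallyEq
    (Filter.Eventually.of_forall fun e => hskew e ξ ζ)
  exact DFunLike.congr_fun ((hasFDerivAt_apply_const hp (ev ξ) ζ).unique h2) w

theorem hasFDerivAt_jacobi_term (hp : DifferentiableAt ℝ p e₀)
    (hp2 : DifferentiableAt ℝ (fderiv ℝ p) e₀) (η : E →L[ℝ] ℝ) (ξ ζ : K) :
    HasFDerivAt (fun e => η (fderiv ℝ p e (p e ξ) ζ))
      (η.comp (((fderiv ℝ p e₀).comp ((fderiv ℝ p e₀).flip ξ) +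
        (fderiv ℝ (fderiv ℝ p) e₀).flip (p e₀ ξ)).flip ζ)) e₀ := by
  have h1 := hp.hasFDerivAt.clm_apply (hasFDerivAt_const ξ e₀)
  have h2 := (hp2.hasFDerivAt.clm_apply h1).clm_apply (hasFDerivAt_const ζ e₀)
  refine (η.hasFDerivAt.comp e₀ h2).congr_fderiv ?_
  ext e
  simp

/-- The derivative of the Jacobi identity, at elements of the kernel of the Poisson structure. -/
theorem fderiv_jacobi (hp : DifferentiableAt ℝ p e₀)
    (hp2 : DifferentiableAt ℝ (fderiv ℝ p) e₀) {ev : K → E →L[ℝ] ℝ}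
    (hjac : ∀ᶠ e in 𝓝 e₀, ∀ ξ η ζ : K, ev η (fderiv ℝ p e (p e ξ) ζ) +
      ev ζ (fderiv ℝ p e (p e η) ξ) + ev ξ (fderiv ℝ p e (p e ζ) η) = 0)
    (ξ : K) {η ζ : K} (hη : p e₀ η = 0) (hζ : p e₀ ζ = 0) (e : E) :
    ev η (fderiv ℝ (fderiv ℝ p) e₀ e (p e₀ ξ) ζ) + ev η (fderiv ℝ p e₀ (fderiv ℝ p e₀ e ξ) ζ) +
      ev ζ (fderiv ℝ p e₀ (fderiv ℝ p e₀ e η) ξ) +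
        ev ξ (fderiv ℝ p e₀ (fderiv ℝ p e₀ e ζ) η) = 0 := by
  have h2 := ((hasFDerivAt_jacobi_term hp hp2 (ev η) ξ ζ).add
    (hasFDerivAt_jacobi_term hp hp2 (ev ζ) η ξ)).add (hasFDerivAt_jacobi_term hp hp2 (ev ξ) ζ η)
  have h3 := h2.unique ((hasFDerivAt_const (0 : ℝ) e₀).congr_of_eventuallyEq
    (hjac.mono fun e he => he ξ η ζ))
  have h4 := DFunLike.congr_fun h3 e
  have h5 : ∀ (ξ : K) (η : E →L[ℝ] ℝ) (ζ : K), (η.comp (((fderiv ℝ p e₀).comp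
      ((fderiv ℝ p e₀).flip ξ) + (fderiv ℝ (fderiv ℝ p) e₀).flip (p e₀ ξ)).flip ζ)) e =
      η (fderiv ℝ p e₀ (fderiv ℝ p e₀ e ξ) ζ) + η (fderiv ℝ (fderiv ℝ p) e₀ e (p e₀ ξ) ζ) :=
    fun ξ η ζ => map_add η _ _
  have h6 : fderiv ℝ (fderiv ℝ p) e₀ e 0 = 0 := map_zero _
  -- Of the three second-derivative terms, two are taken in the directions p(η) = 0 and p(ζ) = 0 and
  -- vanish.
  rw [add_apply, add_apply, h5, h5, h5, hη, hζ, h6, zero_apply, zero_apply, map_zero, map_zero,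
    add_zero, add_zero, zero_apply] at h4
  rw [← h4]
  ring

end

/-- The covariant derivative of a section of the kernel of a Poisson structure lies in the kernel. -/
theorem covDeriv_sharp_eq_zero {π₀ : (E →L[ℝ] ℝ) → E} {Q : E →L[ℝ] (E →L[ℝ] ℝ) →L[ℝ] E}
    (hskew : ∀ ξ ζ : E →L[ℝ] ℝ, ξ (π₀ ζ) = -ζ (π₀ ξ))
    (hQ : ∀ (e : E) (ξ ζ : E →L[ℝ] ℝ), ξ (Q e ζ) = -ζ (Q e ξ))
    (hjac : ∀ ξ η ζ : E →L[ℝ] ℝ, η (Q (π₀ ξ) ζ) + ζ (Q (π₀ η) ξ) + ξ (Q (π₀ ζ) η) = 0)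
    {a s δ : E →L[ℝ] ℝ} (hs : π₀ s = 0) (hδ : π₀ δ = Q (π₀ a) s) (ζ : E →L[ℝ] ℝ) :
    (δ + linBracket Q a s) (π₀ ζ) = 0 := by
  -- Here Q is dπ and δ the derivative of s along -π₀ a, so that `hδ` is the derivative of π s = 0.
  -- As π₀ s = 0, only two terms remain in the Jacobi identity for a, ζ, s, and they are the two
  -- terms of the claim.
  have h0 : Q 0 = 0 := ContinuousLinearMap.map_zero Q
  have h1 := hjac a ζ s
  rw [hs, h0, zero_apply, map_zero, add_zero] at h1
  rw [add_apply, linBracket_apply, hskew, hδ, hQ _ a s]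
  linarith

/-- The covariant derivative is a derivation of the bracket of sections of the kernel. -/
theorem covDeriv_linBracket {Q : E →L[ℝ] (E →L[ℝ] ℝ) →L[ℝ] E} {a s s' δ δ' δt : E →L[ℝ] ℝ}
    {R : E → E} (hQ : ∀ (e : E) (ξ ζ : E →L[ℝ] ℝ), ξ (Q e ζ) = -ζ (Q e ξ))
    (hjac : ∀ e, s (R e) + s (Q (Q e a) s') + s' (Q (Q e s) a) + a (Q (Q e s') s) = 0)
    (hδt : ∀ e, δt e = δ (Q e s') - s (R e) + s (Q e δ')) :
    δt + linBracket Q a (linBracket Q s s') =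
      linBracket Q (δ + linBracket Q a s) s' + linBracket Q s (δ' + linBracket Q a s') := by
  ext e
  -- R is the second derivative of π in the directions e and π a. It enters `hδt` with a minus sign
  -- because the derivative is along -π a, and it cancels against the differentiated Jacobi
  -- identity.
  have h1 := hjac e
  have h3 := hQ e a (linBracket Q s s')
  have h4 := hQ e s (linBracket Q a s')
  have h5 := hQ (Q e s) a s'
  rw [linBracket_apply] at h3 h4
  have h6 : Q e (δ' + linBracket Q a s') = Q e δ' + Q e (linBracket Q a s') := map_add (Q e) _ _
  rw [add_apply, add_apply, linBracket_apply, linBracket_apply, linBracket_apply, add_apply,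
    linBracket_apply, h6, map_add, hδt, h3, h4]
  linarith

end LocalModel

/-! ### Extension of functions and sections from an immersed manifold -/

section Extension

variable {G : Type*} [NormedAddCommGroup G] [NormedSpace ℝ G] [FiniteDimensional ℝ G]

/-- The inverse function theorem, with smoothness of the inverse on a neighbourhood. -/
theorem exists_smooth_local_inverse {k : G → G} {g₀ : G}
    (hk : ∀ᶠ g in 𝓝 g₀, ContDiffAt ℝ ∞ k g)
    (h : HasFDerivAt k (ContinuousLinearMap.id ℝ G) g₀) :
    ∃ r : G → G, (∀ᶠ y in 𝓝 (k g₀), ContDiffAt ℝ ∞ r y) ∧ ∀ᶠ g in 𝓝 g₀, r (k g) = g := by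
  have h0 : HasFDerivAt k ((ContinuousLinearEquiv.refl ℝ G : G ≃L[ℝ] G) : G →L[ℝ] G) g₀ := h
  have hk0 := hk.self_of_nhds
  let Φ := hk0.toOpenPartialHomeomorph k h0 (by decide)
  have hΦ : (Φ : G → G) = k := hk0.toOpenPartialHomeomorph_coe h0 (by decide)
  have hmem : g₀ ∈ Φ.source := hk0.mem_toOpenPartialHomeomorph_source h0 (by decide)
  have hmem' : k g₀ ∈ Φ.target := by
    rw [← hΦ]
    exact Φ.map_source hmem
  have hinv : Φ.symm (k g₀) = g₀ := by
    rw [← hΦ]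
    exact Φ.left_inv hmem
  -- The derivative of k stays invertible near g₀, which gives smoothness of the inverse at all
  -- points near k(g₀) and not only there.
  have hunit : ∀ᶠ g in 𝓝 g₀, (fderiv ℝ k g).IsInvertible := by
    have h1 := ContinuousLinearEquiv.nhds (ContinuousLinearEquiv.refl ℝ G)
    rw [← h0.fderiv] at h1
    exact (hk0.fderiv_right (m := ∞) (by decide)).continuousAt h1
  have hc : Filter.Tendsto Φ.symm (𝓝 (k g₀)) (𝓝 g₀) := by
    have h1 := Φ.symm.continuousAt (x := k g₀) hmem'
    rw [ContinuousAt, hinv] at h1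
    exact h1
  refine ⟨Φ.symm, ?_, ?_⟩
  · filter_upwards [Φ.open_target.mem_nhds hmem', hc.eventually hk, hc.eventually hunit]
      with y hy h1 h2
    obtain ⟨e, he⟩ := h2
    refine Φ.contDiffAt_symm hy (f₀' := e) ?_ ?_
    · rw [he, hΦ]
      exact (h1.differentiableAt (by decide)).hasFDerivAt
    · rw [hΦ]
      exact h1
  · filter_upwards [Φ.open_source.mem_nhds hmem] with g hg
    have h1 := Φ.left_inv hg
    rwa [hΦ] at h1

variable {E : Type*} [NormedAddCommGroup E] [NormedSpace ℝ E] [FiniteDimensional ℝ E]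
  {Z : Type*} [TopologicalSpace Z] [ChartedSpace E Z] [IsManifold 𝓘(ℝ, E) ∞ Z] [T2Space Z]
  {X : Type*} [TopologicalSpace X] [ChartedSpace G X] [IsManifold 𝓘(ℝ, G) ∞ X]
  {W : Type*} [NormedAddCommGroup W] [NormedSpace ℝ W]

theorem eventually_contDiffAt_comp_symm {w : X → W} {x₀ : X}
    (hw : ∀ᶠ x in 𝓝 x₀, ContMDiffAt 𝓘(ℝ, G) 𝓘(ℝ, W) ∞ w x) :
    ∀ᶠ g in 𝓝 (extChartAt 𝓘(ℝ, G) x₀ x₀),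
      ContDiffAt ℝ ∞ (fun g => w ((extChartAt 𝓘(ℝ, G) x₀).symm g)) g := by
  have h1 : Filter.Tendsto (extChartAt 𝓘(ℝ, G) x₀).symm (𝓝 (extChartAt 𝓘(ℝ, G) x₀ x₀)) (𝓝 x₀) := by
    have h2 := continuousAt_extChartAt_symm (I := 𝓘(ℝ, G)) x₀
    rwa [ContinuousAt, extChartAt_to_inv] at h2
  filter_upwards [h1.eventually hw, extChartAt_target_mem_nhds (I := 𝓘(ℝ, G)) x₀] with g hg hg'
  have h3 := (extChartAt 𝓘(ℝ, G) x₀).map_target hg'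
  rw [extChartAt_source] at h3
  have h4 := contDiffAt_comp_extChartAt_symm h3 hg
  rwa [(extChartAt 𝓘(ℝ, G) x₀).right_inv hg'] at h4

/-- Near a point at which `f` is an immersion, a smooth function on `X` is the restriction of a
smooth function on `Z`. -/
theorem exists_extension_of_immersion {f : X → Z} (hf : ContMDiff 𝓘(ℝ, G) 𝓘(ℝ, E) ∞ f) {x₀ : X}
    (himm : Function.Injective (mfderiv 𝓘(ℝ, G) 𝓘(ℝ, E) f x₀)) {w : X → W}
    (hw : ∀ᶠ x in 𝓝 x₀, ContMDiffAt 𝓘(ℝ, G) 𝓘(ℝ, W) ∞ w x) :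
    ∃ g : Z → W, ContMDiff 𝓘(ℝ, E) 𝓘(ℝ, W) ∞ g ∧ ∀ᶠ x in 𝓝 x₀, g (f x) = w x := by
  have hz := mem_chart_source E (f x₀)
  have hx := mem_chart_source G x₀
  have hev : ∀ᶠ y in 𝓝 x₀, f y ∈ (chartAt E (f x₀)).source :=
    hf.continuous.continuousAt.eventually ((chartAt E (f x₀)).open_source.mem_nhds hz)
  have hq : ∀ᶠ x in 𝓝 x₀, ContMDiffAt 𝓘(ℝ, G) 𝓘(ℝ, E) ∞
      (fun y => extChartAt 𝓘(ℝ, E) (f x₀) (f y)) x := by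
    filter_upwards [hev] with x hx'
    exact (contMDiffAt_extChartAt_of_mem hx').comp x hf.contMDiffAt
  let A : G →L[ℝ] E := vdiff G (fun y => extChartAt 𝓘(ℝ, E) (f x₀) (f y)) x₀
  have hA : Function.Injective A := by
    have h1 : ∀ v, A v = chartD E (f x₀) (f x₀) (mfderiv 𝓘(ℝ, G) 𝓘(ℝ, E) f x₀ v) := fun v =>
      vdiff_comp (contMDiffAt_extChartAt_of_mem hz) hf.contMDiffAt v
    intro u v huv
    rw [h1, h1] at huv
    exact himm (chartD_injective hz huv)
  obtain ⟨l, hl⟩ := A.toLinearMap.exists_leftInverse_of_injective (LinearMap.ker_eq_bot.2 hA)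
  let L : E →L[ℝ] G := LinearMap.toContinuousLinearMap l
  -- In charts, f followed by a left inverse L of its derivative is a map of G with identity
  -- derivative, hence locally invertible.
  let k : G → G := fun g => L (extChartAt 𝓘(ℝ, E) (f x₀) (f ((extChartAt 𝓘(ℝ, G) x₀).symm g)))
  have hq' := eventually_contDiffAt_comp_symm hq
  have hk : ∀ᶠ g in 𝓝 (extChartAt 𝓘(ℝ, G) x₀ x₀), ContDiffAt ℝ ∞ k g := by
    filter_upwards [hq'] with g hg
    exact L.contDiff.contDiffAt.comp g hg
  have hk' : HasFDerivAt k (ContinuousLinearMap.id ℝ G) (extChartAt 𝓘(ℝ, G) x₀ x₀) := by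
    have h1 := L.hasFDerivAt.comp (extChartAt 𝓘(ℝ, G) x₀ x₀)
      (hq'.self_of_nhds.differentiableAt (by decide)).hasFDerivAt
    refine h1.congr_fderiv (ContinuousLinearMap.ext fun v => ?_)
    have h2 := vdiff_eq_fderiv hx hq.self_of_nhds (v : TangentSpace 𝓘(ℝ, G) x₀)
    have h3 := congrArg (fderiv ℝ (fun g => extChartAt 𝓘(ℝ, E) (f x₀)
      (f ((extChartAt 𝓘(ℝ, G) x₀).symm g))) (extChartAt 𝓘(ℝ, G) x₀ x₀)) (chartD_self x₀ v)
    exact (congrArg L (h2.trans h3)).symm.trans (DFunLike.congr_fun hl v)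
  obtain ⟨r, hr, hr'⟩ := exists_smooth_local_inverse hk hk'
  have hk0 : k (extChartAt 𝓘(ℝ, G) x₀ x₀) = L (extChartAt 𝓘(ℝ, E) (f x₀) (f x₀)) := by
    change L (extChartAt 𝓘(ℝ, E) (f x₀) (f ((extChartAt 𝓘(ℝ, G) x₀).symm _))) = _
    rw [extChartAt_to_inv]
  have hT1 : Filter.Tendsto (fun z => L (extChartAt 𝓘(ℝ, E) (f x₀) z)) (𝓝 (f x₀))
      (𝓝 (k (extChartAt 𝓘(ℝ, G) x₀ x₀))) := by
    rw [hk0]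
    exact L.continuous.continuousAt.comp (continuousAt_extChartAt (f x₀))
  have hT2 : Filter.Tendsto r (𝓝 (k (extChartAt 𝓘(ℝ, G) x₀ x₀)))
      (𝓝 (extChartAt 𝓘(ℝ, G) x₀ x₀)) := by
    have h1 := hr.self_of_nhds.continuousAt
    rwa [ContinuousAt, hr'.self_of_nhds] at h1
  -- With r the local inverse of k, the map r ∘ L retracts Z onto the coordinates of X near x₀; the
  -- extension is w composed with it, then cut off.
  obtain ⟨g, hg, hg'⟩ := exists_smooth_extension (G := E) (x₀ := f x₀)
    (f := fun z => w ((extChartAt 𝓘(ℝ, G) x₀).symm (r (L (extChartAt 𝓘(ℝ, E) (f x₀) z))))) (by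
      filter_upwards [(chartAt E (f x₀)).open_source.mem_nhds hz, hT1.eventually hr,
        (hT2.comp hT1).eventually (eventually_contDiffAt_comp_symm hw)] with z h1 h2 h3
      have h4 : ContDiffAt ℝ ∞ (fun e => w ((extChartAt 𝓘(ℝ, G) x₀).symm (r (L e))))
          (extChartAt 𝓘(ℝ, E) (f x₀) z) :=
        ContDiffAt.comp (extChartAt 𝓘(ℝ, E) (f x₀) z) (f := fun e => r (L e)) h3
          (ContDiffAt.comp (extChartAt 𝓘(ℝ, E) (f x₀) z) (f := L) h2 L.contDiff.contDiffAt)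
      exact h4.contMDiffAt.comp z (contMDiffAt_extChartAt_of_mem h1))
  refine ⟨g, hg, ?_⟩
  have hT3 : ∀ᶠ x in 𝓝 x₀, r (k (extChartAt 𝓘(ℝ, G) x₀ x)) = extChartAt 𝓘(ℝ, G) x₀ x :=
    (continuousAt_extChartAt (I := 𝓘(ℝ, G)) x₀).eventually hr'
  filter_upwards [hf.continuous.continuousAt.eventually hg', hT3, eventually_extChartAt_symm hx]
    with x h1 h2 h3
  have h4 : k (extChartAt 𝓘(ℝ, G) x₀ x) = L (extChartAt 𝓘(ℝ, E) (f x₀) (f x)) :=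
    congrArg (fun y => L (extChartAt 𝓘(ℝ, E) (f x₀) (f y))) h3.2
  rw [h1, ← h4, h2, h3.2]

/-- Near a point at which `f` is an immersion, a smooth section of the cotangent bundle along `f`
is the restriction of a one-form. -/
theorem exists_smoothForm_of_immersion {f : X → Z} (hf : ContMDiff 𝓘(ℝ, G) 𝓘(ℝ, E) ∞ f) {x₀ : X}
    (himm : Function.Injective (mfderiv 𝓘(ℝ, G) 𝓘(ℝ, E) f x₀)) {s : ∀ x, Cotan E (f x)}
    (hs : ∀ᶠ x in 𝓝 x₀, ContMDiffAt 𝓘(ℝ, G) (𝓘(ℝ, E).prod 𝓘(ℝ, E →L[ℝ] ℝ)) ∞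
      (fun x => cotPoint (f x) (s x)) x) :
    ∃ a : ∀ z : Z, Cotan E z, SmoothForm a ∧ ∀ᶠ x in 𝓝 x₀, a (f x) = s x := by
  have hz := mem_chart_source E (f x₀)
  have hev : ∀ᶠ y in 𝓝 x₀, f y ∈ (chartAt E (f x₀)).source :=
    hf.continuous.continuousAt.eventually ((chartAt E (f x₀)).open_source.mem_nhds hz)
  obtain ⟨g, hg, hg'⟩ := exists_extension_of_immersion hf himm
    (w := fun x => covRep (f x₀) (s x)) (by
      filter_upwards [hev, hs] with x h1 h2
      exact (contMDiffAt_cotan_iff hf.contMDiffAt h1).1 h2)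
  obtain ⟨φ, h1, h2, h3⟩ := exists_smooth_bump (G := E)
    ((chartAt E (f x₀)).open_source.mem_nhds hz)
  refine ⟨fun z => φ z • ((g z).comp (chartD E (f x₀) z) : Cotan E z), ?_, ?_⟩
  · exact contMDiff_bump_smul_cotan (f := fun z : Z => z) contMDiff_id h1 fun z hz' =>
      contMDiffAt_comp_chartD (f := fun z : Z => z) contMDiffAt_id (h3 hz') (hg z)
  · filter_upwards [hev, hg', hf.continuous.continuousAt.eventually h2] with x h4 h5 h6
    change φ (f x) • ((g (f x)).comp (chartD E (f x₀) (f x)) : Cotan E (f x)) = s x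
    rw [h6, one_smul, h5, comp_chartD_covRep h4]

end Extension

theorem eq_of_zero_eq_add_neg {E K : Type*} [NormedAddCommGroup E] [NormedSpace ℝ E]
    [NormedAddCommGroup K] [NormedSpace ℝ K] {Q : E →L[ℝ] K →L[ℝ] E} {v w : E} {k : K}
    (h : 0 = v + Q (-w) k) : v = Q w k := by
  rw [map_neg, neg_apply, eq_comm, add_neg_eq_zero] at h
  exact h

/-! ### The Poisson tensor as a function of coordinates -/

section RepE

variable {E : Type*} [NormedAddCommGroup E] [NormedSpace ℝ E]
  {Z : Type*} [TopologicalSpace Z] [ChartedSpace E Z]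
  {G : Type*} [NormedAddCommGroup G] [NormedSpace ℝ G]
  {X : Type*} [TopologicalSpace X] [ChartedSpace G X]
  {W : Type*} [NormedAddCommGroup W] [NormedSpace ℝ W]

theorem vdiff_comp_fderiv {f : E → W} {q : X → E} {x : X} (hf : ContDiffAt ℝ ∞ f (q x))
    (hq : ContMDiffAt 𝓘(ℝ, G) 𝓘(ℝ, E) ∞ q x) (u : TangentSpace 𝓘(ℝ, G) x) :
    vdiff G (fun y => f (q y)) x u = fderiv ℝ f (q x) (vdiff G q x u) := by
  have h := vdiff_comp (E := E) hf.contMDiffAt hq u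
  refine h.trans ?_
  exact DFunLike.congr_fun (mfderiv_eq_fderiv (f := f) (x := q x)) _

/-- The differential of a smooth function along a smooth vector field is smooth. -/
theorem contMDiffAt_vdiff_apply [IsManifold 𝓘(ℝ, G) ∞ X] {f : X → W} {x₀ : X}
    (hf : ∀ᶠ x in 𝓝 x₀, ContMDiffAt 𝓘(ℝ, G) 𝓘(ℝ, W) ∞ f x) {V : ∀ x, TangentSpace 𝓘(ℝ, G) x}
    (hV : ContMDiffAt 𝓘(ℝ, G) 𝓘(ℝ, G) ∞ (fun x => chartD G x₀ x (V x)) x₀) :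
    ContMDiffAt 𝓘(ℝ, G) 𝓘(ℝ, W) ∞ (fun x => vdiff G f x (V x)) x₀ := by
  have hx := mem_chart_source G x₀
  have h1 : ContMDiffAt 𝓘(ℝ, G) 𝓘(ℝ, G →L[ℝ] W) ∞ (fun x => fderiv ℝ
      (fun e => f ((extChartAt 𝓘(ℝ, G) x₀).symm e)) (extChartAt 𝓘(ℝ, G) x₀ x)) x₀ :=
    ((contDiffAt_comp_extChartAt_symm hx hf.self_of_nhds).fderiv_right (m := ∞)
      (by decide)).contMDiffAt.comp x₀ (contMDiffAt_extChartAt_of_mem hx)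
  refine (h1.clm_apply hV).congr_of_eventuallyEq ?_
  filter_upwards [hf, (chartAt G x₀).open_source.mem_nhds hx] with x h2 h3
  exact vdiff_eq_fderiv h3 h2 (V x)

theorem vdiff_trilinear {K : Type*} [NormedAddCommGroup K] [NormedSpace ℝ K]
    {Q : X → E →L[ℝ] K →L[ℝ] E} {s : X → E →L[ℝ] ℝ} {t : X → K} {x : X}
    (hQ : ContMDiffAt 𝓘(ℝ, G) 𝓘(ℝ, E →L[ℝ] K →L[ℝ] E) ∞ Q x)
    (hs : ContMDiffAt 𝓘(ℝ, G) 𝓘(ℝ, E →L[ℝ] ℝ) ∞ s x)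
    (ht : ContMDiffAt 𝓘(ℝ, G) 𝓘(ℝ, K) ∞ t x) (u : TangentSpace 𝓘(ℝ, G) x) (e : E) :
    vdiff G (fun y => s y (Q y e (t y))) x u =
      vdiff G s x u (Q x e (t x)) + s x (vdiff G Q x u e (t x)) + s x (Q x e (vdiff G t x u)) := by
  have he : ContMDiffAt 𝓘(ℝ, G) 𝓘(ℝ, E) ∞ (fun _ : X => e) x := contMDiffAt_const
  have h1 := hQ.clm_apply he
  rw [vdiff_clm_apply hs (h1.clm_apply ht), vdiff_clm_apply h1 ht, vdiff_clm_apply hQ he,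
    vdiff_const, zero_apply, map_zero, zero_add, map_add]
  ring

/-- The bundle map of a Poisson structure in a chart, as a function of the coordinates. -/
def PoissonStructure.repE (P : PoissonStructure E Z) (z₀ : Z) (e : E) : (E →L[ℝ] ℝ) →L[ℝ] E :=
  P.rep z₀ ((extChartAt 𝓘(ℝ, E) z₀).symm e)

variable (P : PoissonStructure E Z)

theorem PoissonStructure.repE_skew (z₀ : Z) (e : E) (ξ ζ : E →L[ℝ] ℝ) :
    ξ (P.repE z₀ e ζ) = -ζ (P.repE z₀ e ξ) :=
  P.skew_rep z₀ _ ξ ζ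

variable [IsManifold 𝓘(ℝ, E) ∞ Z] {z₀ z : Z}

theorem PoissonStructure.repE_extChartAt (hz : z ∈ (chartAt E z₀).source) :
    P.repE z₀ (extChartAt 𝓘(ℝ, E) z₀ z) = P.rep z₀ z :=
  congrArg (P.rep z₀) ((extChartAt 𝓘(ℝ, E) z₀).left_inv (by rwa [extChartAt_source]))

variable [FiniteDimensional ℝ E] [T2Space Z]

theorem PoissonStructure.contDiffAt_repE (hz : z ∈ (chartAt E z₀).source) :
    ContDiffAt ℝ ∞ (P.repE z₀) (extChartAt 𝓘(ℝ, E) z₀ z) :=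
  contDiffAt_comp_extChartAt_symm hz (P.contMDiffAt_rep hz)

theorem PoissonStructure.fderiv_repE (hz : z ∈ (chartAt E z₀).source)
    (u : TangentSpace 𝓘(ℝ, E) z) :
    fderiv ℝ (P.repE z₀) (extChartAt 𝓘(ℝ, E) z₀ z) (chartD E z₀ z u) = vdiff E (P.rep z₀) z u :=
  (vdiff_eq_fderiv hz (P.contMDiffAt_rep hz) u).symm

theorem PoissonStructure.jacobi_repE {e : E} (he : e ∈ (extChartAt 𝓘(ℝ, E) z₀).target)
    (ξ η ζ : E →L[ℝ] ℝ) : η (fderiv ℝ (P.repE z₀) e (P.repE z₀ e ξ) ζ) +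
      ζ (fderiv ℝ (P.repE z₀) e (P.repE z₀ e η) ξ) +
        ξ (fderiv ℝ (P.repE z₀) e (P.repE z₀ e ζ) η) = 0 := by
  have h1 := (extChartAt 𝓘(ℝ, E) z₀).map_target he
  rw [extChartAt_source] at h1
  have h2 := P.jacobi_rep h1 ξ η ζ
  simp only [← P.fderiv_repE h1, chartD_chartI h1] at h2
  rw [(extChartAt 𝓘(ℝ, E) z₀).right_inv he] at h2
  exact h2

/-- The identity is needed on a whole neighbourhood in the vector space, since it will be
differentiated. -/
theorem PoissonStructure.eventually_jacobi_repE (hz : z ∈ (chartAt E z₀).source) :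
    ∀ᶠ e in 𝓝 (extChartAt 𝓘(ℝ, E) z₀ z), ∀ ξ η ζ : E →L[ℝ] ℝ,
      η (fderiv ℝ (P.repE z₀) e (P.repE z₀ e ξ) ζ) +
      ζ (fderiv ℝ (P.repE z₀) e (P.repE z₀ e η) ξ) +
        ξ (fderiv ℝ (P.repE z₀) e (P.repE z₀ e ζ) η) = 0 := by
  filter_upwards [extChartAt_target_mem_nhds' (I := 𝓘(ℝ, E)) (x := z₀)
    ((extChartAt 𝓘(ℝ, E) z₀).map_source (by rwa [extChartAt_source]))] with e he ξ η ζ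
  exact P.jacobi_repE he ξ η ζ

theorem PoissonStructure.covRep_isotropyBracket (hz : z ∈ (chartAt E z₀).source) {ξ ζ : Cotan E z}
    (hξ : P.sharp z ξ = 0) (hζ : P.sharp z ζ = 0) :
    covRep z₀ (P.isotropyBracket z ξ ζ) =
      linBracket (fderiv ℝ (P.repE z₀) (extChartAt 𝓘(ℝ, E) z₀ z)) (covRep z₀ ξ) (covRep z₀ ζ) := by
  ext e
  rw [covRep_apply, P.isotropyBracket_apply hz hξ hζ, linBracket_apply, ← P.fderiv_repE hz,
    chartD_chartI hz]

end RepE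

/-! ### The covariant derivative on L_X in a chart -/

namespace LagrangianInLeaf

section CovariantDerivative

variable {E F G : Type*}
  [NormedAddCommGroup E] [NormedSpace ℝ E]
  [NormedAddCommGroup F] [NormedSpace ℝ F]
  [NormedAddCommGroup G] [NormedSpace ℝ G]
  {Z : Type u} [TopologicalSpace Z] [ChartedSpace E Z]
  {S : Type*} [TopologicalSpace S] [ChartedSpace F S]
  {X : Type*} [TopologicalSpace X] [ChartedSpace G X]
  (D : LagrangianInLeaf E F G Z S X)

/-- The covariant derivative `{a, s}` of a section `s` of `L_X` in the direction `u = -w♯ a`, read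
in the chart centred at `z₀`. -/
def covDerivRep (D : LagrangianInLeaf E F G Z S X) (z₀ : Z) {x : X} (a : Cotan E (D.pt x))
    (s : ∀ y, Cotan E (D.pt y)) (u : TangentSpace 𝓘(ℝ, G) x) : E →L[ℝ] ℝ :=
  vdiff G (fun y => covRep z₀ (s y)) x u +
    linBracket (fderiv ℝ (D.P.repE z₀) (extChartAt 𝓘(ℝ, E) z₀ (D.pt x))) (covRep z₀ a)
      (covRep z₀ (s x))

variable [IsManifold 𝓘(ℝ, E) ∞ Z] [FiniteDimensional ℝ E] [T2Space Z] {z₀ : Z} {x : X}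
  {a : Cotan E (D.pt x)} {u : TangentSpace 𝓘(ℝ, G) x} {s s' : ∀ y, Cotan E (D.pt y)}

/-- Sections of `L_X` which are smooth at a point. -/
structure SmoothLAt (D : LagrangianInLeaf E F G Z S X) (s : ∀ y, Cotan E (D.pt y)) (x : X) :
    Prop where
  smooth : ∀ᶠ y in 𝓝 x, ContMDiffAt 𝓘(ℝ, G) (𝓘(ℝ, E).prod 𝓘(ℝ, E →L[ℝ] ℝ)) ∞
    (fun y => cotPoint (D.pt y) (s y)) y
  sharp : ∀ᶠ y in 𝓝 x, D.P.sharp (D.pt y) (s y) = 0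

theorem eventually_mem_source (hx : D.pt x ∈ (chartAt E z₀).source) :
    ∀ᶠ y in 𝓝 x, D.pt y ∈ (chartAt E z₀).source :=
  D.contMDiff_pt.continuous.continuousAt.eventually ((chartAt E z₀).open_source.mem_nhds hx)

variable {D}

theorem SmoothLAt.contMDiffAt (hs : D.SmoothLAt s x) (hx : D.pt x ∈ (chartAt E z₀).source) :
    ContMDiffAt 𝓘(ℝ, G) 𝓘(ℝ, E →L[ℝ] ℝ) ∞ (fun y => covRep z₀ (s y)) x :=
  (contMDiffAt_cotan_iff D.contMDiff_pt.contMDiffAt hx).1 hs.smooth.self_of_nhds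

theorem SmoothLAt.eventually_contMDiffAt (hs : D.SmoothLAt s x)
    (hx : D.pt x ∈ (chartAt E z₀).source) :
    ∀ᶠ y in 𝓝 x, ContMDiffAt 𝓘(ℝ, G) 𝓘(ℝ, E →L[ℝ] ℝ) ∞ (fun y => covRep z₀ (s y)) y := by
  filter_upwards [hs.smooth, D.eventually_mem_source hx] with y h1 h2
  exact (contMDiffAt_cotan_iff D.contMDiff_pt.contMDiffAt h2).1 h1

variable (D) in
theorem contMDiffAt_coord (hx : D.pt x ∈ (chartAt E z₀).source) :
    ContMDiffAt 𝓘(ℝ, G) 𝓘(ℝ, E) ∞ (fun y => extChartAt 𝓘(ℝ, E) z₀ (D.pt y)) x :=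
  (contMDiffAt_extChartAt_of_mem hx).comp x D.contMDiff_pt.contMDiffAt

theorem vdiff_coord (hx : D.pt x ∈ (chartAt E z₀).source)
    (ha : -(D.P.sharp (D.pt x) a) = D.TXZ x u) :
    vdiff G (fun y => extChartAt 𝓘(ℝ, E) z₀ (D.pt y)) x u =
      -(D.P.repE z₀ (extChartAt 𝓘(ℝ, E) z₀ (D.pt x)) (covRep z₀ a)) := by
  have h1 := vdiff_comp (contMDiffAt_extChartAt_of_mem hx) (D.contMDiff_pt.contMDiffAt (x := x)) u
  rw [D.mfderiv_pt] at h1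
  refine h1.trans ?_
  rw [D.P.repE_extChartAt hx, D.P.rep_covRep hx, ← map_neg, ha]
  rfl

theorem repE_covRep (hx : D.pt x ∈ (chartAt E z₀).source) (ξ : Cotan E (D.pt x)) :
    D.P.repE z₀ (extChartAt 𝓘(ℝ, E) z₀ (D.pt x)) (covRep z₀ ξ) =
      chartD E z₀ (D.pt x) (D.P.sharp (D.pt x) ξ) := by
  rw [D.P.repE_extChartAt hx, D.P.rep_covRep hx]

theorem repE_covRep_eq_zero (hx : D.pt x ∈ (chartAt E z₀).source) {ξ : Cotan E (D.pt x)}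
    (hξ : D.P.sharp (D.pt x) ξ = 0) :
    D.P.repE z₀ (extChartAt 𝓘(ℝ, E) z₀ (D.pt x)) (covRep z₀ ξ) = 0 := by
  rw [repE_covRep hx, hξ, map_zero]

/-- Differentiate π(y) s(y) = 0 along X in the direction u, which in the chart is -π a by
`vdiff_coord`. -/
theorem repE_vdiff (hx : D.pt x ∈ (chartAt E z₀).source)
    (ha : -(D.P.sharp (D.pt x) a) = D.TXZ x u) (hs : D.SmoothLAt s x) :
    D.P.repE z₀ (extChartAt 𝓘(ℝ, E) z₀ (D.pt x)) (vdiff G (fun y => covRep z₀ (s y)) x u) =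
      fderiv ℝ (D.P.repE z₀) (extChartAt 𝓘(ℝ, E) z₀ (D.pt x))
        (D.P.repE z₀ (extChartAt 𝓘(ℝ, E) z₀ (D.pt x)) (covRep z₀ a)) (covRep z₀ (s x)) := by
  have hq := D.contMDiffAt_coord hx
  have hp := D.P.contDiffAt_repE hx
  have h1 : ContMDiffAt 𝓘(ℝ, G) 𝓘(ℝ, (E →L[ℝ] ℝ) →L[ℝ] E) ∞
      (fun y => D.P.repE z₀ (extChartAt 𝓘(ℝ, E) z₀ (D.pt y))) x :=
    ContMDiffAt.comp (g := D.P.repE z₀) x hp.contMDiffAt hq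
  have h2 := vdiff_clm_apply h1 (hs.contMDiffAt hx) u
  have h3 : (fun y => D.P.repE z₀ (extChartAt 𝓘(ℝ, E) z₀ (D.pt y)) (covRep z₀ (s y))) =ᶠ[𝓝 x]
      fun _ => (0 : E) := by
    filter_upwards [hs.sharp, D.eventually_mem_source hx] with y h4 h5
    exact repE_covRep_eq_zero h5 h4
  have h4 := vdiff_comp_fderiv (f := D.P.repE z₀)
    (q := fun y => extChartAt 𝓘(ℝ, E) z₀ (D.pt y)) hp hq u
  rw [vdiff_congr h3, vdiff_const, h4, vdiff_coord hx ha, zero_apply] at h2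
  exact eq_of_zero_eq_add_neg h2

end CovariantDerivative

end LagrangianInLeaf

section Instances

variable {E : Type*} [NormedAddCommGroup E] [NormedSpace ℝ E]

instance instNormedAddCommGroupDual : NormedAddCommGroup (E →L[ℝ] ℝ) :=
  ContinuousLinearMap.toNormedAddCommGroup

instance instAddCommGroupDual : AddCommGroup (E →L[ℝ] ℝ) := ContinuousLinearMap.addCommGroup

instance instAddCommGroupDualHom : AddCommGroup ((E →L[ℝ] ℝ) →L[ℝ] E) :=
  ContinuousLinearMap.addCommGroup

end Instances

/-! ### Differentiating a pairing with the derivative of a tensor -/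

section

variable {E K V : Type*} [NormedAddCommGroup E] [NormedSpace ℝ E]
  [NormedAddCommGroup K] [NormedSpace ℝ K] [NormedAddCommGroup V] [NormedSpace ℝ V]
  {G : Type*} [NormedAddCommGroup G] [NormedSpace ℝ G]
  {X : Type*} [TopologicalSpace X] [ChartedSpace G X]

theorem fderiv_neg_symm {p : E → V} {e₀ : E} (hp : ContDiffAt ℝ ∞ p e₀) (v e : E) :
    fderiv ℝ (fderiv ℝ p) e₀ (-v) e = -fderiv ℝ (fderiv ℝ p) e₀ e v := by
  rw [map_neg, neg_apply]
  congr 1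
  exact hp.isSymmSndFDerivAt (by rw [minSmoothness_of_isRCLikeNormedField]; decide) v e

theorem contMDiffAt_fderiv_comp {p : E → V} {q : X → E} {x : X} (hp : ContDiffAt ℝ ∞ p (q x))
    (hq : ContMDiffAt 𝓘(ℝ, G) 𝓘(ℝ, E) ∞ q x) :
    ContMDiffAt 𝓘(ℝ, G) 𝓘(ℝ, E →L[ℝ] V) ∞ (fun y => fderiv ℝ p (q y)) x :=
  ContMDiffAt.comp (g := fderiv ℝ p) x (hp.fderiv_right (m := ∞) (by decide)).contMDiffAt hq

variable {p : E → K →L[ℝ] E} {q : X → E} {s : X → E →L[ℝ] ℝ} {t : X → K} {x : X}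

theorem contMDiffAt_pairing_fderiv (hp : ContDiffAt ℝ ∞ p (q x))
    (hq : ContMDiffAt 𝓘(ℝ, G) 𝓘(ℝ, E) ∞ q x)
    (hs : ContMDiffAt 𝓘(ℝ, G) 𝓘(ℝ, E →L[ℝ] ℝ) ∞ s x)
    (ht : ContMDiffAt 𝓘(ℝ, G) 𝓘(ℝ, K) ∞ t x) (e : E) :
    ContMDiffAt 𝓘(ℝ, G) 𝓘(ℝ, ℝ) ∞ (fun y => s y (fderiv ℝ p (q y) e (t y))) x :=
  hs.clm_apply (((contMDiffAt_fderiv_comp hp hq).clm_apply contMDiffAt_const).clm_apply ht)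

theorem vdiff_pairing_fderiv (hp : ContDiffAt ℝ ∞ p (q x))
    (hq : ContMDiffAt 𝓘(ℝ, G) 𝓘(ℝ, E) ∞ q x)
    (hs : ContMDiffAt 𝓘(ℝ, G) 𝓘(ℝ, E →L[ℝ] ℝ) ∞ s x)
    (ht : ContMDiffAt 𝓘(ℝ, G) 𝓘(ℝ, K) ∞ t x) {u : TangentSpace 𝓘(ℝ, G) x} {w : E}
    (hw : vdiff G q x u = -w) (e : E) :
    vdiff G (fun y => s y (fderiv ℝ p (q y) e (t y))) x u =
      vdiff G s x u (fderiv ℝ p (q x) e (t x)) -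
        s x (fderiv ℝ (fderiv ℝ p) (q x) e w (t x)) +
        s x (fderiv ℝ p (q x) e (vdiff G t x u)) := by
  have h1 := vdiff_comp_fderiv (f := fderiv ℝ p) (q := q) (hp.fderiv_right (m := ∞) (by decide)) hq u
  -- Symmetry of the second derivative puts the direction of motion -w in second place, the order in
  -- which the differentiated Jacobi identity has it.
  have h2 := DFunLike.congr_fun (fderiv_neg_symm hp w e) (t x)
  rw [vdiff_trilinear (contMDiffAt_fderiv_comp hp hq) hs ht, h1, hw, h2, neg_apply, map_neg,
    ← sub_eq_add_neg]

end

/-! ### The covariant derivative preserves L_X and its bracket -/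

namespace LagrangianInLeaf

section CovariantDerivative

variable {E F G : Type*}
  [NormedAddCommGroup E] [NormedSpace ℝ E]
  [NormedAddCommGroup F] [NormedSpace ℝ F]
  [NormedAddCommGroup G] [NormedSpace ℝ G]
  {Z : Type u} [TopologicalSpace Z] [ChartedSpace E Z]
  {S : Type*} [TopologicalSpace S] [ChartedSpace F S]
  {X : Type*} [TopologicalSpace X] [ChartedSpace G X]
  {D : LagrangianInLeaf E F G Z S X}
  [IsManifold 𝓘(ℝ, E) ∞ Z] [FiniteDimensional ℝ E] [T2Space Z] {z₀ : Z} {x : X}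
  {a : Cotan E (D.pt x)} {u : TangentSpace 𝓘(ℝ, G) x} {s s' t : ∀ y, Cotan E (D.pt y)}

theorem eq_zero_of_forall_cotan {z : Z} {v : TangentSpace 𝓘(ℝ, E) z} (h : ∀ ξ : Cotan E z, ξ v = 0) :
    v = 0 := by
  by_contra hv
  obtain ⟨ξ, -, hξ⟩ := exists_cotan_of_notMem (p := (⊥ : Submodule ℝ (TangentSpace 𝓘(ℝ, E) z)))
    (v := v) (fun h => hv ((Submodule.mem_bot ℝ).1 h))
  exact hξ (h ξ)

/-- Shows that {a, s} stays in L_X: by skew-symmetry, ϖ♯N = 0 is tested by evaluating N on the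
vectors ϖ♯ζ, where `covDeriv_sharp_eq_zero` applies. -/
theorem SmoothLAt.sharp_eq_zero_of_covRep_eq (hs : D.SmoothLAt s x)
    (hx : D.pt x ∈ (chartAt E z₀).source) (ha : -(D.P.sharp (D.pt x) a) = D.TXZ x u)
    {N : Cotan E (D.pt x)} (hN : covRep z₀ N = D.covDerivRep z₀ a s u) :
    D.P.sharp (D.pt x) N = 0 := by
  refine eq_zero_of_forall_cotan fun ζ => ?_
  rw [D.P.skew, neg_eq_zero, ← covRep_chartD hx N, ← repE_covRep hx, hN]
  exact covDeriv_sharp_eq_zero (D.P.repE_skew z₀ _)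
    (fun e ξ ζ => fderiv_apply_skew ((D.P.contDiffAt_repE hx).differentiableAt (by decide))
      (ev := fun ξ => ξ) (fun e => D.P.repE_skew z₀ e) e ξ ζ)
    (D.P.eventually_jacobi_repE hx).self_of_nhds
    (repE_covRep_eq_zero hx hs.sharp.self_of_nhds) (repE_vdiff hx ha hs) (covRep z₀ ζ)

/-- The covariant derivative is a derivation of the fibrewise bracket of `L_X`. -/
theorem SmoothLAt.covDerivRep_bracket (hs : D.SmoothLAt s x) (hs' : D.SmoothLAt s' x)
    (hx : D.pt x ∈ (chartAt E z₀).source) (ha : -(D.P.sharp (D.pt x) a) = D.TXZ x u)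
    (ht : ∀ᶠ y in 𝓝 x, t y = D.P.isotropyBracket (D.pt y) (s y) (s' y)) :
    D.covDerivRep z₀ a t u =
      linBracket (fderiv ℝ (D.P.repE z₀) (extChartAt 𝓘(ℝ, E) z₀ (D.pt x)))
        (D.covDerivRep z₀ a s u) (covRep z₀ (s' x)) +
      linBracket (fderiv ℝ (D.P.repE z₀) (extChartAt 𝓘(ℝ, E) z₀ (D.pt x)))
        (covRep z₀ (s x)) (D.covDerivRep z₀ a s' u) := by
  have hp := D.P.contDiffAt_repE hx
  have hd := hp.differentiableAt (by decide)
  have hq := D.contMDiffAt_coord hx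
  have h0 : (fun y => covRep z₀ (t y)) =ᶠ[𝓝 x] fun y =>
      linBracket (fderiv ℝ (D.P.repE z₀) (extChartAt 𝓘(ℝ, E) z₀ (D.pt y)))
        (covRep z₀ (s y)) (covRep z₀ (s' y)) := by
    filter_upwards [ht, hs.sharp, hs'.sharp, D.eventually_mem_source hx] with y h1 h2 h3 h4
    rw [h1, D.P.covRep_isotropyBracket h4 h2 h3]
  have hst : ContMDiffAt 𝓘(ℝ, G) 𝓘(ℝ, E →L[ℝ] ℝ) ∞ (fun y => covRep z₀ (t y)) x := by
    refine ContMDiffAt.congr_of_eventuallyEq (contMDiffAt_clm_of_apply fun e => ?_) h0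
    exact contMDiffAt_pairing_fderiv (p := D.P.repE z₀)
      (q := fun y => extChartAt 𝓘(ℝ, E) z₀ (D.pt y)) hp hq (hs.contMDiffAt hx)
      (hs'.contMDiffAt hx) e
  have h3 : covRep z₀ (t x) = linBracket (fderiv ℝ (D.P.repE z₀)
      (extChartAt 𝓘(ℝ, E) z₀ (D.pt x))) (covRep z₀ (s x)) (covRep z₀ (s' x)) := h0.self_of_nhds
  unfold covDerivRep
  rw [h3]
  refine covDeriv_linBracket
    (R := fun e => fderiv ℝ (fderiv ℝ (D.P.repE z₀)) (extChartAt 𝓘(ℝ, E) z₀ (D.pt x)) e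
      (D.P.repE z₀ (extChartAt 𝓘(ℝ, E) z₀ (D.pt x)) (covRep z₀ a)) (covRep z₀ (s' x)))
    (fun e ξ ζ => fderiv_apply_skew hd (ev := fun ξ => ξ) (fun e => D.P.repE_skew z₀ e) e ξ ζ)
    (fun e => fderiv_jacobi hd
      ((hp.fderiv_right (m := ∞) (by decide)).differentiableAt (by decide)) (ev := fun ξ => ξ)
      (D.P.eventually_jacobi_repE hx) (covRep z₀ a)
      (repE_covRep_eq_zero hx hs.sharp.self_of_nhds)
      (repE_covRep_eq_zero hx hs'.sharp.self_of_nhds) e) fun e => ?_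
  have h4 := vdiff_pairing_fderiv (p := D.P.repE z₀)
    (q := fun y => extChartAt 𝓘(ℝ, E) z₀ (D.pt y)) hp hq (hs.contMDiffAt hx)
    (hs'.contMDiffAt hx) (vdiff_coord hx ha) e
  have h5 : ContMDiffAt 𝓘(ℝ, G) 𝓘(ℝ, E) ∞ (fun _ : X => e) x := contMDiffAt_const
  have h6 := vdiff_clm_apply hst h5 u
  rw [vdiff_const, zero_apply, map_zero, zero_add] at h6
  have h7 : vdiff G (fun y => covRep z₀ (t y) e) x u = vdiff G (fun y => covRep z₀ (s y)
      (fderiv ℝ (D.P.repE z₀) (extChartAt 𝓘(ℝ, E) z₀ (D.pt y)) e (covRep z₀ (s' y)))) x u :=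
    DFunLike.congr_fun (vdiff_congr (h0.mono fun y hy => DFunLike.congr_fun hy e)) u
  rw [← h6, h7, h4]

/-- The bracket of one-forms which extend `a` and a section of `L_X`. -/
theorem SmoothLAt.covRep_formBracket (hs : D.SmoothLAt s x)
    (hx : D.pt x ∈ (chartAt E z₀).source) {b c : ∀ z : Z, Cotan E z} (hb : SmoothForm b)
    (hc : SmoothForm c) (hu : -(D.P.sharp (D.pt x) (b (D.pt x))) = D.TXZ x u)
    (hcs : ∀ᶠ y in 𝓝 x, c (D.pt y) = s y) :
    covRep z₀ (D.P.formBracket b c (D.pt x)) = D.covDerivRep z₀ (b (D.pt x)) s u := by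
  have h0 := hcs.self_of_nhds
  have h1 : (fun y => covRep z₀ (c (D.pt y))) =ᶠ[𝓝 x] fun y => covRep z₀ (s y) :=
    hcs.mono fun y hy => congrArg (covRep z₀) hy
  have h2 := vdiff_comp (contMDiffAt_covRep hc hx) (D.contMDiff_pt.contMDiffAt (x := x)) u
  rw [D.mfderiv_pt, ← hu] at h2
  -- The form c is differentiated along ϖ♯b = -u, which is tangent to X; so only its values s along
  -- X matter.
  have h3 : vdiff E (fun y => covRep z₀ (c y)) (D.pt x) (D.P.sharp (D.pt x) (b (D.pt x))) =
      -vdiff G (fun y => covRep z₀ (s y)) x u := by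
    rw [← vdiff_congr h1, h2, map_neg, neg_neg]
  ext e
  rw [covRep_apply, D.P.formBracket_apply hx hb hc, h3, h0, hs.sharp.self_of_nhds, map_zero,
    zero_apply, chartD_chartI hx, ← D.P.fderiv_repE hx, chartD_chartI hx, neg_apply, zero_sub,
    neg_neg]
  rfl

variable [FiniteDimensional ℝ F] [FiniteDimensional ℝ G] [IsManifold 𝓘(ℝ, G) ∞ X]

theorem exists_smoothForm (hs : ∀ᶠ y in 𝓝 x, ContMDiffAt 𝓘(ℝ, G)
      (𝓘(ℝ, E).prod 𝓘(ℝ, E →L[ℝ] ℝ)) ∞ (fun y => cotPoint (D.pt y) (s y)) y) :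
    ∃ c : ∀ z : Z, Cotan E z, SmoothForm c ∧ ∀ᶠ y in 𝓝 x, c (D.pt y) = s y :=
  exists_smoothForm_of_immersion D.contMDiff_pt (by
    rw [D.mfderiv_pt]
    exact D.TXZ_injective x) hs

/-- The covariant derivative of a section of `L_X`. -/
theorem SmoothLAt.exists_covDeriv (hs : D.SmoothLAt s x)
    (ha : -(D.P.sharp (D.pt x) a) = D.TXZ x u) :
    ∃ N : Cotan E (D.pt x), ∀ z₀ : Z, D.pt x ∈ (chartAt E z₀).source →
      covRep z₀ N = D.covDerivRep z₀ a s u := by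
  obtain ⟨c, hc, hc'⟩ := exists_smoothForm hs.smooth
  -- Any one-form with value a at the point will do. Its bracket with an extension of s is a single
  -- covector, which makes the expressions in the various charts agree.
  obtain ⟨hf, hf'⟩ := funWith_spec (D.pt x) a
  refine ⟨D.P.formBracket (dFun E (funWith (D.pt x) a)) c (D.pt x), fun z₀ hx => ?_⟩
  have h := hs.covRep_formBracket hx (smoothForm_dFun hf) hc (u := u) (by rw [hf', ha]) hc'
  rwa [hf'] at h

end CovariantDerivative

end LagrangianInLeaf

theorem vdiff_sum {ι : Type} {G X W : Type*} [NormedAddCommGroup G] [NormedSpace ℝ G] [TopologicalSpace X]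
    [ChartedSpace G X] [NormedAddCommGroup W] [NormedSpace ℝ W] [Fintype ι] {f : ι → X → W} {x : X}
    (hf : ∀ i, ContMDiffAt 𝓘(ℝ, G) 𝓘(ℝ, W) ∞ (f i) x) (v : TangentSpace 𝓘(ℝ, G) x) :
    vdiff G (fun y => ∑ i, f i y) x v = ∑ i, vdiff G (f i) x v := by
  have h : HasMFDerivAt 𝓘(ℝ, G) 𝓘(ℝ, W) (∑ i, f i) x (∑ i, vdiff G (f i) x) :=
    HasMFDerivAt.sum fun i _ => hasMFDerivAt_vdiff (hf i)
  have h1 : (fun y => ∑ i, f i y) = ∑ i, f i := by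
    funext y
    rw [Finset.sum_apply]
  rw [h1]
  exact (DFunLike.congr_fun h.mfderiv v).trans (sum_apply _ _ _)

/-! ### Lifting bilinear maps to derivations -/

section LieLift

variable {U A V : Type*} [AddCommGroup U] [Module ℝ U] [AddCommGroup V] [Module ℝ V]

theorem exists_bilinear_lift [AddCommGroup A] [Module ℝ A] {f : A →ₗ[ℝ] V}
    (hf : Function.Injective f) (N : U →ₗ[ℝ] A →ₗ[ℝ] V) (h : ∀ u a, ∃ b, f b = N u a) :
    ∃ B : U →ₗ[ℝ] A →ₗ[ℝ] A, ∀ u a, f (B u a) = N u a := by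
  obtain ⟨l, hl⟩ := f.exists_leftInverse_of_injective (LinearMap.ker_eq_bot.2 hf)
  refine ⟨N.compr₂ l, fun u a => ?_⟩
  obtain ⟨b, hb⟩ := h u a
  rw [LinearMap.compr₂_apply, ← hb]
  exact congrArg f (DFunLike.congr_fun hl b)

/-- N takes values in the image of the injective f, so it can be composed with a left inverse; the
derivation rule is then checked after applying f. The operation `br` need only agree with the Lie
bracket on the image of f. -/
theorem exists_derivation_lift [LieRing A] [LieAlgebra ℝ A] {f : A →ₗ[ℝ] V}
    (hf : Function.Injective f) (N : U →ₗ[ℝ] A →ₗ[ℝ] V) (h : ∀ u a, ∃ b, f b = N u a)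
    {br : V → V → V} (hbr : ∀ a b, f ⁅a, b⁆ = br (f a) (f b))
    (hN : ∀ u a b, N u ⁅a, b⁆ = br (N u a) (f b) + br (f a) (N u b)) :
    ∃ B : U →ₗ[ℝ] LieDerivation ℝ A A, ∀ u a, f (B u a) = N u a := by
  obtain ⟨B, hB⟩ := exists_bilinear_lift hf N h
  have hB' : ∀ u a b, B u ⁅a, b⁆ = ⁅a, B u b⁆ - ⁅b, B u a⁆ := fun u a b => by
    apply hf
    rw [hB, hN, sub_eq_add_neg, lie_skew, map_add, hbr, hbr, hB, hB, add_comm]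
  exact ⟨{ toFun := fun u => ⟨B u, hB' u⟩
           map_add' := fun u v => LieDerivation.ext fun a => by
             change B (u + v) a = B u a + B v a
             rw [map_add, LinearMap.add_apply]
           map_smul' := fun c u => LieDerivation.ext fun a => by
             change B (c • u) a = c • B u a
             rw [map_smul, LinearMap.smul_apply] }, hB⟩

end LieLift

/-! ### The connection induced on the Lie frame bundle -/

namespace LagrangianInLeaf

section FrameBundle

variable {E F G : Type*}
  [NormedAddCommGroup E] [NormedSpace ℝ E]
  [NormedAddCommGroup F] [NormedSpace ℝ F]
  [NormedAddCommGroup G] [NormedSpace ℝ G]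
  {Z : Type u} [TopologicalSpace Z] [ChartedSpace E Z]
  {S : Type*} [TopologicalSpace S] [ChartedSpace F S]
  {X : Type*} [TopologicalSpace X] [ChartedSpace G X]
  {D : LagrangianInLeaf E F G Z S X}
  [IsManifold 𝓘(ℝ, E) ∞ Z] [FiniteDimensional ℝ E] [T2Space Z] {z₀ : Z} {x : X}
  [FiniteDimensional ℝ F] [FiniteDimensional ℝ G] [IsManifold 𝓘(ℝ, G) ∞ X]
  {𝔤 : Type*} [LieRing 𝔤] [LieAlgebra ℝ 𝔤]

theorem LocalFrame.smoothLAt (σ : D.LocalFrame 𝔤) (hx : x ∈ σ.dom) (c : 𝔤) :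
    D.SmoothLAt (fun y => σ.frame y c) x := by
  have hev := σ.isOpen_dom.mem_nhds hx
  refine ⟨?_, ?_⟩
  · filter_upwards [hev] with y hy
    exact (σ.smooth c).contMDiffAt (σ.isOpen_dom.mem_nhds hy)
  · filter_upwards [hev] with y hy
    rw [← D.mem_LX_iff_sharp, ← (σ.isLieFrame y hy).range_eq]
    exact ⟨c, rfl⟩

theorem LocalFrame.finiteDimensional (σ : D.LocalFrame 𝔤) (hx : x ∈ σ.dom) :
    FiniteDimensional ℝ 𝔤 :=
  Module.Finite.of_injective (σ.frame x) (σ.isLieFrame x hx).injective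

theorem covDerivRep_add_left {a a' : Cotan E (D.pt x)} {s : ∀ y, Cotan E (D.pt y)}
    {u u' : TangentSpace 𝓘(ℝ, G) x} : D.covDerivRep z₀ (a + a') s (u + u') =
      D.covDerivRep z₀ a s u + D.covDerivRep z₀ a' s u' := by
  have h : covRep z₀ (a + a') = covRep z₀ a + covRep z₀ a' := rfl
  unfold covDerivRep
  rw [map_add, h, linBracket_add_left]
  abel

theorem covDerivRep_smul_left {c : ℝ} {a : Cotan E (D.pt x)} {s : ∀ y, Cotan E (D.pt y)}
    {u : TangentSpace 𝓘(ℝ, G) x} : D.covDerivRep z₀ (c • a) s (c • u) =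
      c • D.covDerivRep z₀ a s u := by
  have h : covRep z₀ (c • a) = c • covRep z₀ a := rfl
  unfold covDerivRep
  rw [map_smul, h, linBracket_smul_left, smul_add]

/-- The covariant derivative of a combination of sections with variable coefficients. -/
theorem covDerivRep_sum {ι : Type} [Fintype ι] (hx : D.pt x ∈ (chartAt E z₀).source)
    {a : Cotan E (D.pt x)} {s : ι → ∀ y, Cotan E (D.pt y)} (hs : ∀ i, D.SmoothLAt (s i) x)
    {c : ι → X → ℝ} (hc : ∀ i, ContMDiffAt 𝓘(ℝ, G) 𝓘(ℝ, ℝ) ∞ (c i) x)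
    {t : ∀ y, Cotan E (D.pt y)} (ht : ∀ᶠ y in 𝓝 x, t y = ∑ i, c i y • s i y)
    (u : TangentSpace 𝓘(ℝ, G) x) :
    D.covDerivRep z₀ a t u = ∑ i, c i x • D.covDerivRep z₀ a (s i) u +
      ∑ i, dFun G (c i) x u • covRep z₀ (s i x) := by
  have h0 : ∀ᶠ y in 𝓝 x, covRep z₀ (t y) = ∑ i, c i y • covRep z₀ (s i y) := by
    filter_upwards [ht] with y hy
    rw [hy]
    exact (map_sum (covRepₗ z₀ (D.pt y)) _ _).trans (Finset.sum_congr rfl fun i _ => rfl)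
  have h1 : ∀ i, vdiff G (fun y => c i y • covRep z₀ (s i y)) x u =
      c i x • vdiff G (fun y => covRep z₀ (s i y)) x u + dFun G (c i) x u • covRep z₀ (s i x) :=
    fun i => vdiff_bilinear (ContinuousLinearMap.lsmul ℝ ℝ) (hc i) ((hs i).contMDiffAt hx) u
  have h2 : vdiff G (fun y => ∑ i, c i y • covRep z₀ (s i y)) x u =
      ∑ i, vdiff G (fun y => c i y • covRep z₀ (s i y)) x u :=
    vdiff_sum (fun i => (hc i).smul ((hs i).contMDiffAt hx)) u
  have h5 : ∀ (ξ : E →L[ℝ] ℝ) (ζ : ι → E →L[ℝ] ℝ) (r : ι → ℝ) Q,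
      linBracket Q ξ (∑ i, r i • ζ i) = ∑ i, r i • linBracket Q ξ (ζ i) := fun ξ ζ r Q => by
    let B : (E →L[ℝ] ℝ) →ₗ[ℝ] (E →L[ℝ] ℝ) :=
      { toFun := fun ζ => linBracket Q ξ ζ
        map_add' := fun ζ ζ' => linBracket_add_right Q ξ ζ ζ'
        map_smul' := fun r ζ => linBracket_smul_right Q r ξ ζ }
    have h6 : B (∑ i, r i • ζ i) = ∑ i, r i • B (ζ i) := by
      rw [map_sum]
      simp only [map_smul]
    exact h6
  unfold covDerivRep
  rw [vdiff_congr h0, h2, h0.self_of_nhds, h5]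
  simp only [h1, smul_add, Finset.sum_add_distrib]
  abel

variable (D) in
theorem covDerivRep_frame_linear (σ : D.LocalFrame 𝔤) (hx : x ∈ σ.dom) (z₀ : Z)
    (hz : D.pt x ∈ (chartAt E z₀).source)
    (a : Cotan E (D.pt x)) (u : TangentSpace 𝓘(ℝ, G) x) (r : ℝ) (c c' : 𝔤) :
    D.covDerivRep z₀ a (fun y => σ.frame y (r • c + c')) u =
      r • D.covDerivRep z₀ a (fun y => σ.frame y c) u +
        D.covDerivRep z₀ a (fun y => σ.frame y c') u := by
  -- The Leibniz rule with the constant coefficients r and 1, whose differentials vanish.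
  have h := covDerivRep_sum hz (a := a) (u := u)
    (s := fun (i : Fin 2) y => σ.frame y (![c, c'] i)) (c := fun i _ => ![r, 1] i)
    (t := fun y => σ.frame y (r • c + c')) (fun i => σ.smoothLAt hx _)
    (fun i => contMDiffAt_const) (Filter.Eventually.of_forall fun y => by
      rw [Fin.sum_univ_two, map_add, map_smul]
      exact congrArg _ (one_smul ℝ _).symm)
  have h0 : ∀ r : ℝ, dFun G (fun _ : X => r) x u = 0 := fun r =>
    DFunLike.congr_fun (vdiff_const (G := G) r x) u
  rw [Fin.sum_univ_two, Fin.sum_univ_two, h0, h0, zero_smul, zero_smul, add_zero, add_zero] at h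
  refine h.trans (congrArg _ ?_)
  exact one_smul ℝ _

variable {α : ∀ x : X, TangentSpace 𝓘(ℝ, G) x →ₗ[ℝ] D.EX x}

/-- In a Lie frame the covariant derivative of σ(c) lies in L_X, the image of σ, and is a derivation
for the bracket; pulling it back by σ gives a derivation of 𝔤. -/
theorem LocalFrame.exists_connectionAt (σ : D.LocalFrame 𝔤) (hα : D.IsConnectionForm α)
    (hx : x ∈ σ.dom) : ∃ A : TangentSpace 𝓘(ℝ, G) x →ₗ[ℝ] LieDerivation ℝ 𝔤 𝔤, ∀ u c,
      covRep (D.pt x) (σ.frame x (A u c)) =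
        D.covDerivRep (D.pt x) (α x u : Cotan E (D.pt x)) (fun y => σ.frame y c) u := by
  have hz := mem_chart_source E (D.pt x)
  have hlin := D.covDerivRep_frame_linear σ hx (D.pt x) hz
  have hσ := σ.isLieFrame x hx
  let f : 𝔤 →ₗ[ℝ] (E →L[ℝ] ℝ) := covRepₗ (D.pt x) (D.pt x) ∘ₗ σ.frame x
  have hf : Function.Injective f := (covRepₗ_injective hz).comp hσ.injective
  let N : TangentSpace 𝓘(ℝ, G) x →ₗ[ℝ] 𝔤 →ₗ[ℝ] (E →L[ℝ] ℝ) :=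
    LinearMap.mk₂ ℝ (fun u c => D.covDerivRep (D.pt x) (α x u : Cotan E (D.pt x))
        (fun y => σ.frame y c) u)
      (fun u u' c => (congrArg (fun a : Cotan E (D.pt x) => D.covDerivRep (D.pt x) a
        (fun y => σ.frame y c) (u + u')) (congrArg Subtype.val (map_add (α x) u u'))).trans
        covDerivRep_add_left)
      (fun r u c => (congrArg (fun a : Cotan E (D.pt x) => D.covDerivRep (D.pt x) a
        (fun y => σ.frame y c) (r • u)) (congrArg Subtype.val (map_smul (α x) r u))).trans
        covDerivRep_smul_left)
      (fun u c c' => by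
        have h := hlin (α x u) u 1 c c'
        rwa [one_smul, one_smul] at h)
      (fun r u c => by
        -- The additive rule at c = c' = 0 shows that the zero section has zero derivative, which
        -- isolates the scalar factor.
        have h0 := hlin (α x u) u 1 0 0
        have h := hlin (α x u) u r c 0
        rw [one_smul, one_smul, add_zero, left_eq_add] at h0
        rwa [add_zero, h0, add_zero] at h)
  refine exists_derivation_lift hf N (fun u c => ?_)
    (br := linBracket (fderiv ℝ (D.P.repE (D.pt x)) (extChartAt 𝓘(ℝ, E) (D.pt x) (D.pt x))))
    (fun c c' => ?_) (fun u c c' => ?_)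
  · obtain ⟨M, hM⟩ := (σ.smoothLAt hx c).exists_covDeriv (hα.splitting x u)
    have h1 := (σ.smoothLAt hx c).sharp_eq_zero_of_covRep_eq hz (hα.splitting x u) (hM _ hz)
    rw [← D.mem_LX_iff_sharp, ← hσ.range_eq] at h1
    obtain ⟨b, hb⟩ := h1
    exact ⟨b, (congrArg (covRep (D.pt x)) hb).trans (hM _ hz)⟩
  · change covRep (D.pt x) (σ.frame x ⁅c, c'⁆) = _
    rw [hσ.map_lie, D.P.covRep_isotropyBracket hz (σ.smoothLAt hx c).sharp.self_of_nhds
      (σ.smoothLAt hx c').sharp.self_of_nhds]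
    rfl
  · have h1 : ∀ᶠ y in 𝓝 x, σ.frame y ⁅c, c'⁆ =
        D.P.isotropyBracket (D.pt y) (σ.frame y c) (σ.frame y c') := by
      filter_upwards [σ.isOpen_dom.mem_nhds hx] with y hy
      exact (σ.isLieFrame y hy).map_lie c c'
    have h2 := (σ.smoothLAt hx c).covDerivRep_bracket (σ.smoothLAt hx c') hz (hα.splitting x u) h1
    exact h2

open Classical in
/-- The connection on the Lie frame bundle induced by an `E_X`-connection form, pulled back by a
local section. -/
def inducedConnection (hα : D.IsConnectionForm α) (σ : D.LocalFrame 𝔤) (x : X) :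
    TangentSpace 𝓘(ℝ, G) x →ₗ[ℝ] LieDerivation ℝ 𝔤 𝔤 :=
  if hx : x ∈ σ.dom then (σ.exists_connectionAt hα hx).choose else 0

/-- The definition uses the chart centred at the point itself. The intrinsic covector of
`exists_covDeriv` carries the formula to any chart, as is required for smoothness in the point. -/
theorem covRep_inducedConnection (hα : D.IsConnectionForm α) (σ : D.LocalFrame 𝔤) (hx : x ∈ σ.dom)
    (hz : D.pt x ∈ (chartAt E z₀).source) (u : TangentSpace 𝓘(ℝ, G) x) (c : 𝔤) :
    covRep z₀ (σ.frame x (inducedConnection hα σ x u c)) =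
      D.covDerivRep z₀ (α x u : Cotan E (D.pt x)) (fun y => σ.frame y c) u := by
  have h1 : covRep (D.pt x) (σ.frame x (inducedConnection hα σ x u c)) =
      D.covDerivRep (D.pt x) (α x u : Cotan E (D.pt x)) (fun y => σ.frame y c) u := by
    rw [inducedConnection, dif_pos hx]
    exact (σ.exists_connectionAt hα hx).choose_spec u c
  obtain ⟨M, hM⟩ := (σ.smoothLAt hx c).exists_covDeriv (hα.splitting x u)
  have h2 : σ.frame x (inducedConnection hα σ x u c) = M :=
    covRepₗ_injective (mem_chart_source E (D.pt x)) (h1.trans (hM _ (mem_chart_source E _)).symm)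
  rw [h2, hM _ hz]

theorem inducedConnection_isInducedBy (hα : D.IsConnectionForm α) :
    D.IsInducedBy 𝔤 α (inducedConnection hα) := by
  intro σ x hx V hV c a b ha hb haV hbc
  have hz := mem_chart_source E (D.pt x)
  have h0 := haV.self_of_nhds
  refine covRepₗ_injective hz ?_
  refine (covRep_inducedConnection hα σ hx hz (V x) c).trans ?_
  have h := (σ.smoothLAt hx c).covRep_formBracket hz ha hb (u := V x)
    (by rw [h0]; exact hα.splitting x (V x)) hbc
  rw [h0] at h
  exact h.symm

/-- `IsInducedBy` constrains A only through extensions to one-forms; these exist because X is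
immersed in Z. Injectivity of the frame then determines A. -/
theorem IsInducedBy.eq_inducedConnection (hα : D.IsConnectionForm α)
    {A : D.LocalFrame 𝔤 → ∀ x : X, TangentSpace 𝓘(ℝ, G) x →ₗ[ℝ] LieDerivation ℝ 𝔤 𝔤}
    (hA : D.IsInducedBy 𝔤 α A) (σ : D.LocalFrame 𝔤) (hx : x ∈ σ.dom) :
    A σ x = inducedConnection hα σ x := by
  refine LinearMap.ext fun u => LieDerivation.ext fun c => ?_
  obtain ⟨V, hV, rfl⟩ := D.exists_ΓTX u
  obtain ⟨a, ha, ha'⟩ := exists_smoothForm (D := D) (x := x)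
    (s := fun y => (α y (V y) : Cotan E (D.pt y)))
    (Filter.Eventually.of_forall (D.mem_ΓEX_iff.1 (hα.smooth V hV)))
  obtain ⟨b, hb, hb'⟩ := exists_smoothForm (σ.smoothLAt hx c).smooth
  apply (σ.isLieFrame x hx).injective
  rw [hA σ x hx V hV c a b ha hb ha' hb',
    inducedConnection_isInducedBy hα σ x hx V hV c a b ha hb ha' hb']

end FrameBundle

end LagrangianInLeaf

/-! ### Smoothness and gauge transformation of the induced connection -/

namespace LagrangianInLeaf

section FrameBundle

variable {E F G : Type*}
  [NormedAddCommGroup E] [NormedSpace ℝ E]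
  [NormedAddCommGroup F] [NormedSpace ℝ F]
  [NormedAddCommGroup G] [NormedSpace ℝ G]
  {Z : Type u} [TopologicalSpace Z] [ChartedSpace E Z]
  {S : Type*} [TopologicalSpace S] [ChartedSpace F S]
  {X : Type*} [TopologicalSpace X] [ChartedSpace G X]
  {D : LagrangianInLeaf E F G Z S X}
  [IsManifold 𝓘(ℝ, E) ∞ Z] [FiniteDimensional ℝ E] [T2Space Z] {z₀ : Z} {x : X}
  [FiniteDimensional ℝ F] [FiniteDimensional ℝ G] [IsManifold 𝓘(ℝ, G) ∞ X]
  {𝔤 : Type*} [LieRing 𝔤] [LieAlgebra ℝ 𝔤]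

/-- The frame maps a basis of 𝔤 to independent smooth covectors, with respect to which coefficients
are smooth. -/
theorem LocalFrame.contMDiffAt_repr (σ : D.LocalFrame 𝔤) (hx : x ∈ σ.dom)
    (hz : D.pt x ∈ (chartAt E z₀).source) {ι : Type*} [Fintype ι] (e : Module.Basis ι ℝ 𝔤)
    {c : X → 𝔤}
    (hc : ContMDiffAt 𝓘(ℝ, G) 𝓘(ℝ, E →L[ℝ] ℝ) ∞ (fun y => covRep z₀ (σ.frame y (c y))) x) (i : ι) :
    ContMDiffAt 𝓘(ℝ, G) 𝓘(ℝ, ℝ) ∞ (fun y => e.repr (c y) i) x := by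
  let f : ∀ y, 𝔤 →ₗ[ℝ] (E →L[ℝ] ℝ) := fun y => covRepₗ z₀ (D.pt y) ∘ₗ σ.frame y
  have hf : Function.Injective (f x) := (covRepₗ_injective hz).comp (σ.isLieFrame x hx).injective
  refine contMDiffAt_coeff (S := fun i y => f y (e i)) (c := fun i y => e.repr (c y) i)
    (fun i => (σ.smoothLAt hx (e i)).contMDiffAt hz)
    (e.linearIndependent.map_injOn (f x) hf.injOn) hc (Filter.Eventually.of_forall fun y => ?_) i
  have h : f y (∑ i, e.repr (c y) i • e i) = f y (c y) := by rw [e.sum_repr]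
  rw [map_sum] at h
  refine Eq.trans (Finset.sum_congr rfl fun i _ => ?_) h
  exact (map_smul (f y) _ _).symm

theorem contMDiffAt_covDerivRep {α : ∀ x : X, TangentSpace 𝓘(ℝ, G) x →ₗ[ℝ] D.EX x}
    (hα : D.IsConnectionForm α) {V : ∀ x, TangentSpace 𝓘(ℝ, G) x} (hV : V ∈ D.ΓTX)
    {s : ∀ y, Cotan E (D.pt y)} (hs : D.SmoothLAt s x) (hz : D.pt x ∈ (chartAt E z₀).source) :
    ContMDiffAt 𝓘(ℝ, G) 𝓘(ℝ, E →L[ℝ] ℝ) ∞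
      (fun y => D.covDerivRep z₀ (α y (V y) : Cotan E (D.pt y)) s (V y)) x := by
  have h1 := contMDiffAt_vdiff_apply (hs.eventually_contMDiffAt hz)
    (D.contMDiffAt_chartD_of_mem_ΓTX hV x)
  have ha : ContMDiffAt 𝓘(ℝ, G) 𝓘(ℝ, E →L[ℝ] ℝ) ∞
      (fun y => covRep z₀ (α y (V y) : Cotan E (D.pt y))) x :=
    (contMDiffAt_cotan_iff D.contMDiff_pt.contMDiffAt hz).1 (D.mem_ΓEX_iff.1 (hα.smooth V hV) x)
  have h2 : ContMDiffAt 𝓘(ℝ, G) 𝓘(ℝ, E →L[ℝ] ℝ) ∞ (fun y =>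
      linBracket (fderiv ℝ (D.P.repE z₀) (extChartAt 𝓘(ℝ, E) z₀ (D.pt y)))
        (covRep z₀ (α y (V y) : Cotan E (D.pt y))) (covRep z₀ (s y))) x :=
    contMDiffAt_clm_of_apply fun e => contMDiffAt_pairing_fderiv (p := D.P.repE z₀)
      (q := fun y => extChartAt 𝓘(ℝ, E) z₀ (D.pt y)) (D.P.contDiffAt_repE hz)
      (D.contMDiffAt_coord hz) ha (hs.contMDiffAt hz) e
  exact h1.add h2

variable {α : ∀ x : X, TangentSpace 𝓘(ℝ, G) x →ₗ[ℝ] D.EX x}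

theorem contMDiffAt_inducedConnection (hα : D.IsConnectionForm α) (σ : D.LocalFrame 𝔤)
    (hx : x ∈ σ.dom) {V : ∀ x, TangentSpace 𝓘(ℝ, G) x} (hV : V ∈ D.ΓTX) (a : 𝔤) (l : 𝔤 →ₗ[ℝ] ℝ) :
    ContMDiffAt 𝓘(ℝ, G) 𝓘(ℝ, ℝ) ∞ (fun y => l (inducedConnection hα σ y (V y) a)) x := by
  have := σ.finiteDimensional hx
  have hz := mem_chart_source E (D.pt x)
  let e := Module.finBasis ℝ 𝔤
  have h1 : ContMDiffAt 𝓘(ℝ, G) 𝓘(ℝ, E →L[ℝ] ℝ) ∞ (fun y =>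
      covRep (D.pt x) (σ.frame y (inducedConnection hα σ y (V y) a))) x := by
    refine (contMDiffAt_covDerivRep hα hV (σ.smoothLAt hx a) hz).congr_of_eventuallyEq ?_
    filter_upwards [σ.isOpen_dom.mem_nhds hx, D.eventually_mem_source hz] with y hy hy'
    exact covRep_inducedConnection hα σ hy hy' (V y) a
  have h2 : (fun y => l (inducedConnection hα σ y (V y) a)) = fun y =>
      ∑ i, e.repr (inducedConnection hα σ y (V y) a) i * l (e i) := by
    funext y
    conv_lhs => rw [← e.sum_repr (inducedConnection hα σ y (V y) a)]
    rw [map_sum]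
    simp only [map_smul, smul_eq_mul]
  rw [h2]
  exact ContMDiffAt.sum fun i _ => (σ.contMDiffAt_repr hx hz e h1 i).mul contMDiffAt_const

/-- Write σ'(a) = σ(g a) as a combination of the σ(e_i) with variable coefficients. In the Leibniz
rule the terms with derivatives of σ(e_i) give A_σ(g a), and the derivatives of the coefficients
give dg. -/
theorem inducedConnection_gauge (hα : D.IsConnectionForm α) (σ σ' : D.LocalFrame 𝔤)
    {g : X → 𝔤 →ₗ[ℝ] 𝔤} (hx : x ∈ σ.dom) (hx' : x ∈ σ'.dom)
    (hg : ∀ᶠ y in 𝓝 x, ∀ a, σ'.frame y a = σ.frame y (g y a))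
    (v : TangentSpace 𝓘(ℝ, G) x) (a : 𝔤) (l : 𝔤 →ₗ[ℝ] ℝ) :
    l (g x (inducedConnection hα σ' x v a)) =
      l (inducedConnection hα σ x v (g x a)) + dFun G (fun y => l (g y a)) x v := by
  have := σ.finiteDimensional hx
  have hz := mem_chart_source E (D.pt x)
  let e := Module.finBasis ℝ 𝔤
  let f : 𝔤 →ₗ[ℝ] (E →L[ℝ] ℝ) := covRepₗ (D.pt x) (D.pt x) ∘ₗ σ.frame x
  have hf : Function.Injective f := (covRepₗ_injective hz).comp (σ.isLieFrame x hx).injective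
  have hc : ∀ i, ContMDiffAt 𝓘(ℝ, G) 𝓘(ℝ, ℝ) ∞ (fun y => e.repr (g y a) i) x := fun i => by
    refine σ.contMDiffAt_repr hx hz e (c := fun y => g y a) ?_ i
    refine ((σ'.smoothLAt hx' a).contMDiffAt hz).congr_of_eventuallyEq ?_
    filter_upwards [hg] with y hy
    rw [hy]
  have hsum : ∀ᶠ y in 𝓝 x, σ'.frame y a = ∑ i, e.repr (g y a) i • σ.frame y (e i) := by
    filter_upwards [hg] with y hy
    rw [hy]
    conv_lhs => rw [← e.sum_repr (g y a)]
    exact (map_sum (σ.frame y) _ _).trans (Finset.sum_congr rfl fun i _ => map_smul (σ.frame y) _ _)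
  have h1 : f (g x (inducedConnection hα σ' x v a)) =
      ∑ i, e.repr (g x a) i • f (inducedConnection hα σ x v (e i)) +
        ∑ i, dFun G (fun y => e.repr (g y a) i) x v • f (e i) := by
    have h2 := covDerivRep_sum hz (a := (α x v : Cotan E (D.pt x)))
      (fun i => σ.smoothLAt hx (e i)) hc hsum v
    have h3 : f (g x (inducedConnection hα σ' x v a)) =
        covRep (D.pt x) (σ'.frame x (inducedConnection hα σ' x v a)) :=
      congrArg (covRep (D.pt x)) (hg.self_of_nhds _).symm
    rw [h3, covRep_inducedConnection hα σ' hx' hz, h2]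
    refine congrArg₂ _ (Finset.sum_congr rfl fun i _ => congrArg _ ?_) rfl
    exact (covRep_inducedConnection hα σ hx hz v (e i)).symm
  have h4 : g x (inducedConnection hα σ' x v a) = inducedConnection hα σ x v (g x a) +
      ∑ i, dFun G (fun y => e.repr (g y a) i) x v • e i := by
    apply hf
    rw [h1, map_add, map_sum]
    simp only [map_smul]
    congr 1
    have h5 : ∀ (d : 𝔤 →ₗ[ℝ] 𝔤) (b : 𝔤), ∑ i, e.repr b i • f (d (e i)) = f (d b) := fun d b => by
      conv_rhs => rw [← e.sum_repr b]
      rw [map_sum, map_sum]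
      simp only [map_smul]
    exact h5 (inducedConnection hα σ x v).toLinearMap (g x a)
  have h6 : dFun G (fun y => l (g y a)) x v =
      ∑ i, dFun G (fun y => e.repr (g y a) i) x v * l (e i) := by
    have h7 : (fun y => l (g y a)) = fun y => ∑ i, e.repr (g y a) i * l (e i) := by
      funext y
      conv_lhs => rw [← e.sum_repr (g y a)]
      rw [map_sum]
      simp only [map_smul, smul_eq_mul]
    rw [h7]
    refine (vdiff_sum (fun i => (hc i).mul contMDiffAt_const) v).trans ?_
    refine Finset.sum_congr rfl fun i _ => ?_
    exact vdiff_clm ((ContinuousLinearMap.mul ℝ ℝ).flip (l (e i))) (hc i) v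
  rw [h4, h6, map_add, map_sum]
  simp only [map_smul, smul_eq_mul]

theorem inducedConnection_isPrincipalConnection (hα : D.IsConnectionForm α) :
    D.IsPrincipalConnection 𝔤 (inducedConnection hα) where
  smooth σ _ hV a l _ hx := (contMDiffAt_inducedConnection hα σ hx hV a l).contMDiffWithinAt
  gauge σ σ' _ _ hx hx' hg v a l := inducedConnection_gauge hα σ σ' hx hx' hg v a l

end FrameBundle

end LagrangianInLeaf

/-! ### The main theorem -/

theorem mainTheorem2
    {E F G : Type*}
    [NormedAddCommGroup E] [NormedSpace ℝ E] [FiniteDimensional ℝ E]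
    [NormedAddCommGroup F] [NormedSpace ℝ F] [FiniteDimensional ℝ F]
    [NormedAddCommGroup G] [NormedSpace ℝ G] [FiniteDimensional ℝ G]
    {Z : Type*} [TopologicalSpace Z] [ChartedSpace E Z] [IsManifold 𝓘(ℝ, E) ∞ Z]
    [T2Space Z] [SecondCountableTopology Z]
    {S : Type*} [TopologicalSpace S] [ChartedSpace F S] [IsManifold 𝓘(ℝ, F) ∞ S]
    {X : Type*} [TopologicalSpace X] [ChartedSpace G X] [IsManifold 𝓘(ℝ, G) ∞ X]
    (D : LagrangianInLeaf E F G Z S X)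
    (𝔤 : Type*) [LieRing 𝔤] [LieAlgebra ℝ 𝔤]
    (H : Z → ℝ) (hH : ContMDiff 𝓘(ℝ, E) 𝓘(ℝ, ℝ) ∞ H)
    (hcrit : ∀ x : X, dFun E H (D.pt x) = 0) :
    -- the vertical Hessian, the scalar products `η` it defines, and the triple of fields
    (∃ j : ∀ x, LinearMap.BilinForm ℝ (D.EStar x),
      D.IsVerticalHessian H j ∧ (∀ j', D.IsVerticalHessian H j' → j' = j) ∧
      D.IsSymmetricSection j ∧
      ((∀ x, Function.Bijective (D.sharp j x)) →
        ∃ η : ∀ x, LinearMap.BilinForm ℝ (D.EX x),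
          D.IsInverse j η ∧ (∀ η', D.IsInverse j η' → η' = η) ∧
          IsScalarProductField (G := G) D.ΓEX η ∧
          (∀ x, Function.Bijective (D.sharp0 j x) ↔
            ∀ ξ, (∀ ζ, D.restrictL η x ξ ζ = 0) → ξ = 0) ∧
          (∀ x, ((∀ ξ, ξ ≠ 0 → 0 < η x ξ ξ) ∨ (∀ ξ, ξ ≠ 0 → η x ξ ξ < 0)) →
            Function.Bijective (D.sharp0 j x)) ∧
          ((∀ x, Function.Bijective (D.sharp0 j x)) →
            ∃ t : D.Triple, D.IsTripleOf j η t ∧ (∀ t', D.IsTripleOf j η t' → t' = t) ∧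
              t.IsAdmissible))) ∧
    -- scalar products on `E_X` determine, and are determined by, their triples
    (∀ η : ∀ x, LinearMap.BilinForm ℝ (D.EX x), IsScalarProductField (G := G) D.ΓEX η →
      (∀ x ξ, (∀ ζ, D.restrictL η x ξ ζ = 0) → ξ = 0) →
      ∃! t : D.Triple, t.IsAdmissible ∧ D.Corresponds η t) ∧
    (∀ t : D.Triple, t.IsAdmissible →
      ∃! η : ∀ x, LinearMap.BilinForm ℝ (D.EX x),
        IsScalarProductField (G := G) D.ΓEX η ∧ D.Corresponds η t) ∧
    (∀ (η : ∀ x, LinearMap.BilinForm ℝ (D.EX x)) (t : D.Triple),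
      IsScalarProductField (G := G) D.ΓEX η → D.Corresponds η t → ∀ x,
      ((∀ ξ, ξ ≠ 0 → 0 < η x ξ ξ) ↔
        (∀ u, u ≠ 0 → 0 < t.γ x u u) ∧ (∀ ξ, ξ ≠ 0 → 0 < t.χ x ξ ξ))) ∧
    -- connection forms determine principal connections on the Lie frame bundle
    (∀ α : ∀ x : X, TangentSpace 𝓘(ℝ, G) x →ₗ[ℝ] D.EX x, D.IsConnectionForm α →
      ∃ A : D.LocalFrame 𝔤 → ∀ x : X, TangentSpace 𝓘(ℝ, G) x →ₗ[ℝ] LieDerivation ℝ 𝔤 𝔤,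
        D.IsPrincipalConnection 𝔤 A ∧ D.IsInducedBy 𝔤 α A ∧
        ∀ A', D.IsInducedBy 𝔤 α A' → ∀ (σ : D.LocalFrame 𝔤), ∀ x ∈ σ.dom, A' σ x = A σ x) := by
  refine ⟨?_, fun η hη hL => ?_, fun t ht => ?_, fun η t hη ht x => ?_, fun α hα => ?_⟩
  · obtain ⟨j, hj⟩ := D.exists_isVerticalHessian hH hcrit
    have hsymm := LagrangianInLeaf.IsVerticalHessian.isSymmetricSection D hH hcrit hj
    refine ⟨j, hj, fun j' hj' => LagrangianInLeaf.IsVerticalHessian.unique D hH hj hj', hsymm,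
      fun hb => ?_⟩
    obtain ⟨η, hη⟩ := LagrangianInLeaf.exists_inverse_of_bijective hb
    have hS := hη.isScalarProductField hsymm
    refine ⟨η, hη, fun η' h' => hη.unique_right h', hS, hη.sharp0_bijective_iff, fun x hd => ?_,
      fun h0 => ?_⟩
    · refine (hη.sharp0_bijective_iff x).2 fun ξ hξ => ?_
      -- A nonzero ξ in L_X orthogonal to all of L_X would satisfy η(ξ, ξ) = 0, which definiteness
      -- excludes.
      by_contra hne
      have hne' : D.LtoE x ξ ≠ 0 := fun h =>
        hne (Subtype.ext (congrArg (fun w : D.EX x => (w : Cotan E (D.pt x))) h))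
      have h1 : η x (D.LtoE x ξ) (D.LtoE x ξ) = 0 := hξ ξ
      rcases hd with hd | hd
      · exact (hd _ hne').ne' h1
      · exact (hd _ hne').ne h1
    · have hL := fun x => (hη.sharp0_bijective_iff x).1 (h0 x)
      obtain ⟨t, ht⟩ := LagrangianInLeaf.exists_isOrthogonalTriple hL
      exact ⟨t, (hη.isTripleOf_iff hL).2 ht,
        fun t' ht' => ((hη.isTripleOf_iff hL).1 ht').unique hL ht, ht.isAdmissible hS hL⟩
  · obtain ⟨t, ht⟩ := LagrangianInLeaf.exists_isOrthogonalTriple hL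
    have hiff := fun t : D.Triple => LagrangianInLeaf.corresponds_iff hη.nondegenerate (t := t)
    exact ⟨t, ⟨ht.isAdmissible hη hL, (hiff t).2 ⟨hL, ht⟩⟩,
      fun t' ht' => ((hiff t').1 ht'.2).2.unique hL ht⟩
  · obtain ⟨η, hη, h⟩ := ht.exists_eta
    refine ⟨η, ⟨hη, (LagrangianInLeaf.corresponds_iff hη.nondegenerate).2 ⟨fun x ξ hξ => ?_, h⟩⟩,
      fun η' h' => ?_⟩
    · refine ht.scalar.nondegenerate x ξ ?_
      rw [h.scalar]
      exact hξ
    -- Both forms are given by the same expression ρ*γ + p*χ, in which p depends only on α.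
    · have h1 := ((LagrangianInLeaf.corresponds_iff h'.1.nondegenerate).1 h'.2).2
      funext x
      refine LinearMap.ext fun ξ => LinearMap.ext fun ζ => ?_
      rw [h1.eta_apply h'.1.symm, h.eta_apply hη.symm]
  · exact ((LagrangianInLeaf.corresponds_iff hη.nondegenerate).1 ht).2.posDef_iff hη.symm x
  · exact ⟨LagrangianInLeaf.inducedConnection hα,
      LagrangianInLeaf.inducedConnection_isPrincipalConnection hα,
      LagrangianInLeaf.inducedConnection_isInducedBy hα,
      fun A' hA' σ x hx => hA'.eq_inducedConnection hα σ hx⟩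

end
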